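/- Let $p$ be a prime, $\mathbf{F}_q$ a finite field of characteristic $p$, $\mathbf{Q}_q$ the unramified extension of $\mathbf{Q}_p$ with residue field $\mathbf{F}_q$, and $\mathbf{Z}_q$ its ring of integers. Let $\mathcal{Q}\in\mathbf{Z}_q[x,y]$ be monic of degree $d_x$ in $y$, with the same monomials in its support as its reduction $Q$ modulo $p$, and suppose that $Q$ is irreducible in $\mathbf{F}_q[x,y]$ and separable in $y$ over $\mathbf{F}_q(x)$. Let $\Delta\in\mathbf{Z}_q[x]$ be the discriminant of $\mathcal{Q}$ with respect to $y$, let $r=\Delta/\gcd(\Delta,\frac{d\Delta}{dx})$, and put $\mathcal{U}=\operatorname{Spec}\mathbf{Z}_q[x,1/r,y]/(\mathcal{Q})$, $\mathcal{V}=\operatorname{Spec}\mathbf{Z}_q[x,1/r]$, $\mathbb{U}=\mathcal{U}\otimes\mathbf{Q}_q$. Assume: 1. there are a smooth proper curve $\mathcal{X}$ over $\mathbf{Z}_q$ and a smooth relative divisor $\mathcal{D}$ on $\mathcal{X}$ with $\mathcal{U}=\mathcal{X}\setminus\mathcal{D}$, and a smooth relative divisor $\mathcal{D}'$ on $\mathbf{P}^1_{\mathbf{Z}_q}$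 with $\mathcal{V}=\mathbf{P}^1_{\mathbf{Z}_q}\setminus\mathcal{D}'$; 2. the zero locus of $\mathcal{Q}$ in $\mathbf{A}^2_{\mathbf{Q}_q}$ is smooth; 3. $W^\infty\in GL_{d_x}(\mathbf{Z}_q[x,x^{-1}])$ is such that the functions $b_j^\infty=\sum_{i=0}^{d_x-1}W^\infty_{i+1,j+1}y^i$ $(0\le j\le d_x-1)$ form an integral basis of $\mathbf{Q}_q(x,y)$ over $\mathbf{Q}_q[x^{-1}]$. Write $\operatorname{ord}_0$ and $\operatorname{ord}_\infty$ for the orders at $x=0$ and $x=\infty$ of elements of $\mathbf{Q}_q[x,x^{-1}]$, extended to vectors and matrices by taking the minimum over the entries. For $w\in\mathbf{Q}_q[x,x^{-1}]^{\oplus d_x}$ write $\omega_w=\bigl(\sum_i w_i b_i^\infty\bigr)\frac{dx}{r}$ and, if $w\ne 0$, $m(w)=-\operatorname{ord}_\infty(w)-\deg(r)+1$. Let $e_\infty$ be the maximal ramification index of $x$ at the points over $x=\infty$ of the generic fibre of $\mathcal{X}$. The reduction procedure at the points over $x=\infty$ is the following. As long as $\operatorname{ord}_\infty(w)\le\operatorname{ord}_0(W^\infty)-\deg(r)+1$,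 replace $w$ by a vector $w'\in\mathbf{Q}_q[x,x^{-1}]^{\oplus d_x}$ such that $\operatorname{ord}_\infty(w')>\operatorname{ord}_\infty(w)$ and $\omega_w=d\bigl(\sum_i c_i x^{m(w)}b_i^\infty\bigr)+\omega_{w'}$ for some $c\in\mathbf{Q}_q^{\oplus d_x}$, where the function $\sum_i c_i x^{m(w)}b_i^\infty$ is regular on $\mathbb{U}$ (so that the cohomology class is unchanged). It ends when $\operatorname{ord}_\infty(w)>\operatorname{ord}_0(W^\infty)-\deg(r)+1$. Let $w\in\mathbf{Z}_q[x,x^{-1}]^{\oplus d_x}$ satisfy $\omega_w\in\Omega^1(\mathcal{U})$ and $\operatorname{ord}_\infty(w)\le\operatorname{ord}_0(W^\infty)-\deg(r)+1$, and put $m=m(w)$. Then the reduction procedure can be carried out to its end starting from $w$, and every vector $u\in\mathbf{Q}_q[x,x^{-1}]^{\oplus d_x}$ with which it ends satisfies $$p^{\lfloor\log_p(m e_\infty)\rfloor}\,u\in\mathbf{Z}_q[x,x^{-1}]^{\oplus d_x}.$$ -/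

import Mathlib

open CategoryTheory AlgebraicGeometry
open scoped Polynomial LaurentPolynomial KaehlerDifferential

universe u

/-- The ring `ℤ_q` of integers of `ℚ_q`, for `k = 𝔽_q`: the ring of `p`-typical Witt vectors. -/
abbrev Zq (p : ℕ) [Fact p.Prime] (k : Type u) [Field k] : Type u := WittVector p k

/-- The field `ℚ_q`, the unramified extension of `ℚ_p` with residue field `k = 𝔽_q`. -/
abbrev Qq (p : ℕ) [Fact p.Prime] (k : Type u) [Field k] : Type u := FractionRing (Zq p k)

/-- The set-up.  `k` is the finite field `𝔽_q`.
`Q` is the chosen lift to `ℤ_q[x][y]` (outer variable `y`) of the polynomial `Q mod p`, which is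
monic in `y`, irreducible, and separable in `y` over `𝔽_q(x)`. -/
structure CurveLift (p : ℕ) [Fact p.Prime] (k : Type u) [Field k] [Finite k] [CharP k p] where
  /-- the lift `𝒬 ∈ ℤ_q[x][y]` -/
  Q : (Zq p k)[X][X]
  monic : Q.Monic
  irreducible_mod :
    Irreducible (Q.map (Polynomial.mapRingHom (WittVector.constantCoeff : Zq p k →+* k)))
  separable_mod :
    ((Q.map (Polynomial.mapRingHom (WittVector.constantCoeff : Zq p k →+* k))).map
      (algebraMap k[X] (RatFunc k))).Separable
  /-- the lift has the same monomials in its support as its reduction -/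
  support_eq : ∀ i j, (Q.coeff i).coeff j ≠ 0 →
    WittVector.constantCoeff ((Q.coeff i).coeff j) ≠ 0
  /-- a greatest common divisor of `Δ` and `dΔ/dx`, where `Δ` is the discriminant of `𝒬` in `y` -/
  g : (Zq p k)[X]
  isGCD : ∀ e : (Zq p k)[X], e ∣ g ↔ e ∣ Q.discr ∧ e ∣ Polynomial.derivative Q.discr
  /-- the squarefree polynomial `r = Δ / gcd(Δ, dΔ/dx)` -/
  r : (Zq p k)[X]
  disc_eq : Q.discr = g * r

/-- Order at `x = 0` of a Laurent polynomial in `x`. -/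
noncomputable def LaurentPolynomial.ordZero {A : Type*} [Semiring A] (f : A[T;T⁻¹]) : WithTop ℤ :=
  f.coeff.support.min

/-- Order at `x = ∞` of a Laurent polynomial in `x`. -/
noncomputable def LaurentPolynomial.ordInfty {A : Type*} [Semiring A] (f : A[T;T⁻¹]) :
    WithTop ℤ :=
  (f.coeff.support.image (fun n => -n)).min

namespace CurveLift

variable {p : ℕ} [Fact p.Prime] {k : Type u} [Field k] [Finite k] [CharP k p] (C : CurveLift p k)

/-- The degree `d_x` of `𝒬` in `y`. -/
noncomputable abbrev d : ℕ := C.Q.natDegree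

/-- `𝒜 = ℤ_q[x, y] / (𝒬)`. -/
abbrev A : Type u := AdjoinRoot C.Q

theorem degree_ne_zero : C.Q.degree ≠ 0 := by
  intro h
  have h1 : C.Q = 1 := by
    apply C.monic.natDegree_eq_zero.mp
    exact Polynomial.natDegree_eq_of_degree_eq_some h
  exact C.irreducible_mod.not_isUnit (by rw [h1]; simp)

instance isDomain_A : IsDomain C.A := by
  have : Irreducible C.Q :=
    Polynomial.Monic.irreducible_of_irreducible_map _ C.Q C.monic C.irreducible_mod
  exact AdjoinRoot.isDomain_of_prime this.prime

/-- The function field `L = ℚ_q(x, y)`, the fraction field of `𝒜`. -/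
def L : Type u := FractionRing C.A

noncomputable instance : Field C.L := inferInstanceAs (Field (FractionRing C.A))

noncomputable instance : Algebra C.A C.L := inferInstanceAs (Algebra C.A (FractionRing C.A))

instance : IsFractionRing C.A C.L := inferInstanceAs (IsFractionRing C.A (FractionRing C.A))

noncomputable instance : Algebra (Zq p k) C.L :=
  inferInstanceAs (Algebra (Zq p k) (FractionRing C.A))

instance : IsScalarTower (Zq p k) C.A C.L :=
  inferInstanceAs (IsScalarTower (Zq p k) C.A (FractionRing C.A))

/-- The embedding of `ℤ_q[x]` in the function field. -/
noncomputable def incl : (Zq p k)[X] →+* C.L := (algebraMap C.A C.L).comp (AdjoinRoot.of C.Q)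

theorem incl_injective : Function.Injective C.incl :=
  (IsFractionRing.injective C.A C.L).comp
    (AdjoinRoot.of.injective_of_degree_ne_zero C.degree_ne_zero)

theorem algebraMap_injective : Function.Injective (algebraMap (Zq p k) C.L) := by
  have : algebraMap (Zq p k) C.L = C.incl.comp Polynomial.C := by
    rw [IsScalarTower.algebraMap_eq (Zq p k) C.A C.L]
    rfl
  rw [this]
  exact C.incl_injective.comp Polynomial.C_injective

instance : FaithfulSMul (Zq p k) C.L :=
  (faithfulSMul_iff_algebraMap_injective _ _).mpr C.algebraMap_injective

/-- The function field as an extension of `ℚ_q`. -/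
noncomputable instance : Algebra (Qq p k) C.L := FractionRing.liftAlgebra _ _

instance : IsScalarTower (Zq p k) (Qq p k) C.L :=
  FractionRing.isScalarTower_liftAlgebra _ _

/-- The function `x`. -/
noncomputable def x : C.L := C.incl Polynomial.X

/-- The function `y`. -/
noncomputable def y : C.L := algebraMap C.A C.L (AdjoinRoot.root C.Q)

theorem x_ne_zero : C.x ≠ 0 :=
  (map_ne_zero_iff _ C.incl_injective).mpr Polynomial.X_ne_zero

/-- The function `x` as a unit of the function field. -/
noncomputable def xUnit : C.Lˣ := Units.mk0 C.x C.x_ne_zero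

/-- The ring `ℛ = ℤ_q[x, 1/r, y] / (𝒬)`, realised inside the function field. -/
noncomputable def R : Subalgebra (Zq p k) C.L := Algebra.adjoin (Zq p k) {C.x, (C.incl C.r)⁻¹, C.y}

/-- The ring `ℛ ⊗ ℚ_q` of regular functions on the generic fibre of `𝒰 = Spec ℛ`. -/
noncomputable def RK : Subalgebra (Qq p k) C.L :=
  Algebra.adjoin (Qq p k) {C.x, (C.incl C.r)⁻¹, C.y}

/-- The `ℛ`-module `Ω¹(𝒰)`, realised inside the differentials of the function field. -/
noncomputable def OmegaU : Submodule C.R Ω[C.L⁄(Qq p k)] :=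
  Submodule.span C.R
    {η | ∃ h : C.R, η = KaehlerDifferential.D (Qq p k) C.L (h : C.L)}

/-- `𝒰 = Spec ℛ`. -/
noncomputable def U : Scheme.{u} := Spec (CommRingCat.of C.R)

/-- The structure morphism `𝒰 ⟶ Spec ℤ_q`. -/
noncomputable def UStr : C.U ⟶ Spec (CommRingCat.of (Zq p k)) :=
  Spec.map (CommRingCat.ofHom (algebraMap (Zq p k) C.R))

end CurveLift

attribute [local instance] MvPolynomial.gradedAlgebra

/-- The projective line over `A`, as `Proj` of the graded ring `A[X₀, X₁]`, with `x = X₀ / X₁`. -/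
noncomputable def ProjLine (A : Type u) [CommRing A] : Scheme.{u} :=
  Proj (MvPolynomial.homogeneousSubmodule (Fin 2) A)

/-- The structure morphism of the projective line. -/
noncomputable def projLineStr (A : Type u) [CommRing A] :
    ProjLine A ⟶ Spec (CommRingCat.of A) :=
  Proj.toSpecZero (MvPolynomial.homogeneousSubmodule (Fin 2) A) ≫
    Spec.map (CommRingCat.ofHom
      (algebraMap A (MvPolynomial.homogeneousSubmodule (Fin 2) A 0)))

/-- The open subscheme `Spec A[x, 1/f]` of the projective line over `A`: the locus where
`X₁ * F(X₀, X₁)` does not vanish, `F` being the homogenisation of `f`. -/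
noncomputable def projLineOpen {A : Type u} [CommRing A] (f : A[X]) : (ProjLine A).Opens :=
  Proj.basicOpen (MvPolynomial.homogeneousSubmodule (Fin 2) A)
    (MvPolynomial.X 1 * f.homogenize f.natDegree)

namespace CurveLift

variable {p : ℕ} [Fact p.Prime] {k : Type u} [Field k] [Finite k] [CharP k p] (C : CurveLift p k)

/-- The good lift assumption.
(1) `𝒰` is the complement of a smooth relative divisor `D` in a smooth proper curve `𝒳` over `ℤ_q`.
(2) `𝒱 = Spec ℤ_q[x, 1/r]` is the complement of a smooth relative divisor in the projective line
over `ℤ_q`.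
A smooth relative divisor of a smooth relative curve over `ℤ_q` is a closed subscheme that is
smooth of relative dimension zero, that is, étale, over `ℤ_q`. -/
def GoodLift : Prop :=
  (∃ (𝒳 D : Scheme.{u}) (f : 𝒳 ⟶ Spec (CommRingCat.of (Zq p k))) (j : C.U ⟶ 𝒳) (i : D ⟶ 𝒳),
    IsProper f ∧ SmoothOfRelativeDimension 1 f ∧ IsOpenImmersion j ∧ j ≫ f = C.UStr ∧
    IsClosedImmersion i ∧ Etale (i ≫ f) ∧ Set.range j = (Set.range i)ᶜ) ∧
  (∃ (D : Scheme.{u}) (i : D ⟶ ProjLine (Zq p k)),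
    IsClosedImmersion i ∧ Etale (i ≫ projLineStr (Zq p k)) ∧
    (projLineOpen C.r : Set (ProjLine (Zq p k))) = (Set.range i)ᶜ)

/-- The zero locus of `𝒬` in the affine plane over `ℚ_q` is smooth. -/
def SmoothLocus : Prop :=
  Algebra.Smooth (Qq p k)
    (AdjoinRoot (C.Q.map (Polynomial.mapRingHom (algebraMap (Zq p k) (Qq p k)))))

/-- The element `b_j^∞ = ∑ i, W_{ij} y^i` of the function field. -/
noncomputable def b (W : GL (Fin C.d) (Zq p k)[T;T⁻¹]) (j : Fin C.d) : C.L :=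
  ∑ i : Fin C.d, LaurentPolynomial.eval₂ (algebraMap (Zq p k) C.L) C.xUnit (W.val i j) * C.y ^ (i : ℕ)

/-- The subring `ℚ_q[1/x]` of the function field. -/
noncomputable def Kt : Subalgebra (Qq p k) C.L :=
  Algebra.adjoin (Qq p k) {C.x⁻¹}

/-- `[b_0^∞, …, b_{d_x-1}^∞]` is an integral basis for `ℚ_q(x, y)` over `ℚ_q[1/x]`, i.e. a basis of
the integral closure of `ℚ_q[1/x]` as a `ℚ_q[1/x]`-module. -/
def IsIntegralBasisAtInfinity (W : GL (Fin C.d) (Zq p k)[T;T⁻¹]) : Prop :=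
  LinearIndependent C.Kt (C.b W) ∧
  Submodule.span C.Kt (Set.range (C.b W)) = Subalgebra.toSubmodule (integralClosure C.Kt C.L)

/-- The set of the ramification indices `e_P` of `x` at the points `P` of the generic fibre lying
over `x = ∞`; these points are the primes `P` containing `1/x` of the integral closure of
`ℚ_q[1/x]` in the function field. -/
def ramificationIndicesAtInfinity : Set ℕ :=
  {e | ∃ P : Ideal (integralClosure C.Kt C.L), P.IsPrime ∧
    (∃ t : integralClosure C.Kt C.L, (t : C.L) = C.x⁻¹ ∧ t ∈ P) ∧ P.ramificationIdx C.Kt = e}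

/-- Order at `x = ∞` of a vector of Laurent polynomials. -/
noncomputable def ordInf {K : Type*} [Semiring K] {n : ℕ} (w : Fin n → K[T;T⁻¹]) : WithTop ℤ :=
  Finset.univ.inf fun i => (w i).ordInfty

/-- Order at `x = 0` of a matrix of Laurent polynomials. -/
noncomputable def ordZeroMatrix {K : Type*} [Semiring K] {n : ℕ}
    (W : Matrix (Fin n) (Fin n) K[T;T⁻¹]) : WithTop ℤ :=
  Finset.univ.inf fun i => Finset.univ.inf fun j => (W i j).ordZero

/-- A vector over `ℚ_q[x, 1/x]` has all its entries in `ℤ_q[x, 1/x]`. -/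
def IsIntegralVec {n : ℕ} (w : Fin n → (Qq p k)[T;T⁻¹]) : Prop :=
  ∀ i j, (w i).coeff j ∈ Set.range (algebraMap (Zq p k) (Qq p k))

/-- The function `∑ i, w_i(x, 1/x) b_i^∞`. -/
noncomputable def comb (W : GL (Fin C.d) (Zq p k)[T;T⁻¹])
    (w : Fin C.d → (Qq p k)[T;T⁻¹]) : C.L :=
  ∑ i, LaurentPolynomial.eval₂ (algebraMap (Qq p k) C.L) C.xUnit (w i) * C.b W i

/-- The 1-form `(∑ i, w_i(x, 1/x) b_i^∞) dx / r`. -/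
noncomputable def form (W : GL (Fin C.d) (Zq p k)[T;T⁻¹])
    (w : Fin C.d → (Qq p k)[T;T⁻¹]) : Ω[C.L⁄(Qq p k)] :=
  (C.comb W w / C.incl C.r) • KaehlerDifferential.D (Qq p k) C.L C.x

/-- The bound `ord_0(W^∞) - deg(r) + 1`. -/
noncomputable def bound (W : GL (Fin C.d) (Zq p k)[T;T⁻¹]) : WithTop ℤ :=
  ordZeroMatrix W.val + ((1 - (C.r.natDegree : ℤ) : ℤ) : WithTop ℤ)

/-- `m = -ord_∞(w) - deg(r) + 1` (only meaningful for `w ≠ 0`). -/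
noncomputable def poleOrder {n : ℕ} (w : Fin n → (Qq p k)[T;T⁻¹]) : ℤ :=
  -(ordInf w).untopD 0 - (C.r.natDegree : ℤ) + 1

/-- `C.Reduces W w u`: the reduction procedure at the points over `x = ∞`, applied to the 1-form
with coefficient vector `w`, ends with the 1-form with coefficient vector `u`.  As long as
`ord_∞(w) ≤ ord_0(W^∞) - deg(r) + 1`, one subtracts from the form the differential of
`∑ i, v_i b_i^∞`, where `v = c x ^ m` with `c` a constant vector and `m = -ord_∞(w) - deg(r) + 1`
is such that the order at infinity of the coefficient vector increases.  The functions
`∑ i, v_i b_i^∞` are regular on the generic fibre of `𝒰`, so the class in the first (rigid, or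
de Rham) cohomology does not change. -/
inductive Reduces (W : GL (Fin C.d) (Zq p k)[T;T⁻¹]) :
    (Fin C.d → (Qq p k)[T;T⁻¹]) → (Fin C.d → (Qq p k)[T;T⁻¹]) → Prop
  | done (u : Fin C.d → (Qq p k)[T;T⁻¹]) (hu : C.bound W < ordInf u) : Reduces W u u
  | step (w w' u : Fin C.d → (Qq p k)[T;T⁻¹]) (c : Fin C.d → Qq p k)
      (hw : ordInf w ≤ C.bound W)
      (hreg : C.comb W (fun i => LaurentPolynomial.C (c i) * LaurentPolynomial.T (C.poleOrder w)) ∈ C.RK)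
      (heq : C.form W w =
        KaehlerDifferential.D (Qq p k) C.L
            (C.comb W (fun i => LaurentPolynomial.C (c i) * LaurentPolynomial.T (C.poleOrder w))) + C.form W w')
      (hlt : ordInf w < ordInf w') (hrest : Reduces W w' u) : Reduces W w u

end CurveLift

/-!
Write `∂ = d/dx` and `θ = x ∂` for the derivations of the function field `L = ℚ_q(x, y)`, and let
`Fil J ⊆ L` be the functions whose order at every point `P` over `x = ∞` is at least `J e_P`.  As the `b_i`
form an integral basis, the order at infinity of a coefficient vector is the largest `J` for which `Fil J`
contains the function it represents (`comb_mem_Fil_iff`).  A form `ω_w` is `h dx` with `h = (∑ w_i b_i) / r`,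
and one step of the reduction subtracts `∂f` from `h`, where `f = ∑ c_i x ^ m b_i`.

*Existence.*  At the points at infinity `θ` is a logarithmic vector field (`valuation_theta_lt_one`), which
acts on functions of order `c` at `P` as `-c / e_P`, up to higher order.  It therefore has no zero eigenvalue
on the functions with a pole of order `m > 0` modulo those with a smaller pole, and `θ f ≡ x h` can be solved
(`exists_theta_sub_mem_Fil`).  That the new coefficient vector has entries in `ℚ_q[x, 1/x]` means that
`r ∂f` is regular outside `x = 0, ∞`, and this holds because the affine curve is smooth
(`SmoothLocus.r_mul_ddx_mem_AK`).  The pole order `m` is positive as long as the procedure runs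
(`one_le_poleOrder`); the only doubtful case is that of a matrix `W` without pole at `x = 0`, where
smoothness forces `r` to be constant, and a regular function vanishing at infinity is zero.

*Loss of precision.*  Let `f` be the sum of the functions whose differentials are subtracted.  By construction
`∂f` agrees at infinity with an element of `ℤ_q[x, 1/x, y, 1/Δ]` in all orders up to `J`, where `J` is an
integer exceeding all orders of terms in `f`.  As the leading coefficient of `r`, and hence that of `Δ`, is a
unit (`GoodLift.isUnit_leadingCoeff`, the divisor of `r` being disjoint from `x = ∞`), such elements agree at
infinity to any order with elements of `ℤ_q[x, 1/x, y]`.  The lattice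
`intFil J = ℤ_q[x, 1/x, y] + Fil J` is stable under the operators `binom(θ, n) = xⁿ ∂ⁿ / n!`: the divided
powers `∂ⁿ / n!` are the coefficients of Taylor expansions, and the Taylor expansion of `y` is found by
Newton's iteration, which introduces no denominators other than powers of `∂𝒬/∂y`
(`dividedPow_mem_AXD`, `aeval_binomPoly_mem_intFil`).  Since `n binom(θ, n) f = x binom(θ, n - 1) ∂f`, the
functions `n binom(θ, n) f` lie in `intFil J`.  On the other hand `f` is killed modulo `Fil J` by a product
of factors `θ - λ` with eigenvalues `λ = -c / e_P`, `0 < -c ≤ m e_P`, whose `p`-adic valuation is at most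
`N = ⌊log_p (m e_∞)⌋`.  With `T_k = binom(θ, p ^ k)`, the operator `∏_{k ≤ N} (1 - T_k ^ (p - 1))` is the
identity on `p ^ N f` modulo `intFil J`, but takes a value divisible by `p` at each `p`-integral `λ`, while
`θ (p ^ N f) ∈ intFil J` accounts for the other eigenvalues; hence `p ^ N f ∈ intFil J`
(`mem_of_aeval_prod_sub_mem`, `pow_mul_mem_intFil`).  As all terms of `f` have order less
than `J`, all the coefficients of `p ^ N f` are integral, and so are those of `p ^ N u`
(`isIntegralVec_of_reduces`).
-/


/-! ### Taylor expansions and Newton's iteration -/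

section Taylor

variable {K L : Type*} [Field K] [Field L] [Algebra K L]

/-- The `n`-th divided power `∂ⁿ / n!` of a derivation of a field of characteristic zero. -/
noncomputable def Derivation.dividedPow (D : Derivation K L L) (n : ℕ) (f : L) : L :=
  (n.factorial : L)⁻¹ * (D^[n]) f

theorem Derivation.dividedPow_zero (D : Derivation K L L) (f : L) : D.dividedPow 0 f = f := by
  simp [Derivation.dividedPow]

theorem Derivation.succ_mul_dividedPow [CharZero L] (D : Derivation K L L) (n : ℕ) (f : L) :
    D.dividedPow (n + 1) f * ((n : L) + 1) = D.dividedPow n (D f) := by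
  have h1 : ((n : L) + 1) ≠ 0 := by exact_mod_cast n.succ_ne_zero
  simp only [Derivation.dividedPow, Function.iterate_succ_apply, Nat.factorial_succ]
  push_cast
  rw [mul_inv]
  field_simp

theorem Derivation.dividedPow_add (D : Derivation K L L) (n : ℕ) (f g : L) :
    D.dividedPow n (f + g) = D.dividedPow n f + D.dividedPow n g := by
  simp only [Derivation.dividedPow, iterate_map_add, mul_add]

/-- The Taylor series `∑ (∂ⁿ f / n!) uⁿ` is multiplicative: both sides of the product formula solve
the same differential equation in `u`. -/
theorem Derivation.mk_dividedPow_mul [CharZero L] (D : Derivation K L L) (f g : L) :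
    PowerSeries.mk (fun n => D.dividedPow n (f * g)) =
      PowerSeries.mk (fun n => D.dividedPow n f) * PowerSeries.mk (fun n => D.dividedPow n g) := by
  have hd : ∀ f : L, PowerSeries.derivative L (PowerSeries.mk (fun n => D.dividedPow n f)) =
      PowerSeries.mk (fun n => D.dividedPow n (D f)) := by
    intro f
    ext n
    rw [PowerSeries.coeff_derivative, PowerSeries.coeff_mk, PowerSeries.coeff_mk,
      D.succ_mul_dividedPow]
  ext n
  induction n generalizing f g with
  | zero => simp [Derivation.dividedPow_zero]
  | succ n ih =>
    have h1 : ((n : L) + 1) ≠ 0 := by exact_mod_cast n.succ_ne_zero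
    apply mul_right_cancel₀ h1
    rw [← PowerSeries.coeff_derivative, ← PowerSeries.coeff_derivative, hd,
      Derivation.leibniz, Derivation.leibniz, hd, hd, smul_eq_mul, smul_eq_mul, smul_eq_mul,
      smul_eq_mul]
    have h2 : PowerSeries.mk (fun m => D.dividedPow m (f * D g + g * D f)) =
        PowerSeries.mk (fun m => D.dividedPow m (f * D g)) +
          PowerSeries.mk (fun m => D.dividedPow m (g * D f)) := by
      ext m
      simp [D.dividedPow_add]
    rw [h2, map_add, map_add, ih, ih]

/-- The Taylor homomorphism `f ↦ ∑ (∂ⁿ f / n!) uⁿ`. -/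
noncomputable def Derivation.taylor [CharZero L] (D : Derivation K L L) : L →+* PowerSeries L where
  toFun f := PowerSeries.mk (fun n => D.dividedPow n f)
  map_one' := by
    ext n
    rcases n with _ | n
    · simp [Derivation.dividedPow_zero]
    · simp [Derivation.dividedPow, PowerSeries.coeff_one]
  map_mul' := D.mk_dividedPow_mul
  map_zero' := by
    ext n
    simp [Derivation.dividedPow]
  map_add' f g := by
    ext n
    simp [D.dividedPow_add]

theorem Derivation.coeff_taylor [CharZero L] (D : Derivation K L L) (n : ℕ) (f : L) :
    PowerSeries.coeff n (D.taylor f) = D.dividedPow n f := by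
  simp [Derivation.taylor]

end Taylor

/-- Newton's iteration, coefficient by coefficient: a power series root of a polynomial with
coefficients in `S⟦u⟧` lies in `S⟦u⟧` as soon as its constant term `y` does and the derivative of
the polynomial is a unit of `S` at `y`. -/
theorem PowerSeries.coeff_mem_of_eval_eq_zero {L : Type*} [CommRing L] (S : Subring L)
    (G : (PowerSeries S)[X]) (Y : PowerSeries L)
    (hG : G.eval₂ (PowerSeries.map S.subtype) Y = 0)
    (h0 : PowerSeries.constantCoeff Y ∈ S) (v : L) (hv : v ∈ S)
    (hu : PowerSeries.constantCoeff (G.derivative.eval₂ (PowerSeries.map S.subtype) Y) * v = 1)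
    (n : ℕ) : PowerSeries.coeff n Y ∈ S := by
  induction n using Nat.strong_induction_on with
  | _ n ih =>
  rcases Nat.eq_zero_or_pos n with rfl | hn
  · simpa using h0
  -- `Y = Y₀ + uⁿ Z` with `Y₀` a polynomial over `S`
  let Y0 : PowerSeries S := PowerSeries.mk fun i => if h : i < n then ⟨_, ih i h⟩ else 0
  let φ := PowerSeries.map S.subtype
  obtain ⟨Z, hZ⟩ : (PowerSeries.X : PowerSeries L) ^ n ∣ Y - φ Y0 := by
    rw [PowerSeries.X_pow_dvd_iff]
    intro m hm
    simp [φ, Y0, hm]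
  have hY : Y = φ Y0 + PowerSeries.X ^ n * Z := by rw [← hZ]; ring
  have hc : PowerSeries.coeff n Y = PowerSeries.constantCoeff Z := by
    rw [hY, map_add]
    simp [φ, Y0, PowerSeries.coeff_X_pow_mul']
  have hcc : PowerSeries.constantCoeff Y = PowerSeries.constantCoeff (φ Y0) := by
    rw [hY, map_add, map_mul, map_pow, PowerSeries.constantCoeff_X, zero_pow hn.ne']
    simp
  rw [Polynomial.eval₂_eq_eval_map] at hG hu
  obtain ⟨k, hk⟩ := (G.map φ).binomExpansion (φ Y0) (PowerSeries.X ^ n * Z)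
  rw [← hY] at hk
  change (G.map φ).eval Y = 0 at hG
  rw [hG, Polynomial.eval_map, Polynomial.eval₂_at_apply] at hk
  have hcoef := congrArg (PowerSeries.coeff n) hk
  have h3 : PowerSeries.coeff n (k * (PowerSeries.X ^ n * Z) ^ 2) = 0 := by
    have : k * (PowerSeries.X ^ n * Z) ^ 2 = PowerSeries.X ^ (n + n) * (k * Z ^ 2) := by ring
    rw [this, PowerSeries.coeff_X_pow_mul']
    simp [hn.ne']
  have h4 : PowerSeries.coeff n ((G.map φ).derivative.eval (φ Y0) * (PowerSeries.X ^ n * Z)) =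
      PowerSeries.constantCoeff ((G.map φ).derivative.eval (φ Y0)) *
        PowerSeries.constantCoeff Z := by
    rw [mul_left_comm, PowerSeries.coeff_X_pow_mul']
    simp
  have h5 : PowerSeries.constantCoeff ((G.map φ).derivative.eval (φ Y0)) =
      PowerSeries.constantCoeff ((G.map φ).derivative.eval Y) := by
    rw [Polynomial.eval, Polynomial.eval, Polynomial.hom_eval₂, Polynomial.hom_eval₂, hcc]
  rw [map_add, map_add, h3, h4, h5] at hcoef
  rw [Polynomial.derivative_map] at hcoef
  rw [hc]
  have h6 : PowerSeries.constantCoeff Z =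
      -(PowerSeries.coeff n (φ (G.eval Y0)) * v) := by
    have h7 : PowerSeries.constantCoeff Z = (PowerSeries.constantCoeff
      ((G.derivative.map φ).eval Y) * v) * PowerSeries.constantCoeff Z := by
      rw [hu, one_mul]
    rw [h7]
    simp only [map_zero, add_zero] at hcoef
    linear_combination (-v) * hcoef
  rw [h6]
  refine S.neg_mem (S.mul_mem ?_ hv)
  simp [φ]

/-! ### Integer-valued polynomials and `p`-adic denominators -/

section IntegerValued

/-- The binomial coefficient `X (X - 1) ⋯ (X - n + 1) / n!` as a polynomial. -/
noncomputable def binomPoly (n : ℕ) : ℚ[X] :=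
  Polynomial.C ((n.factorial : ℚ)⁻¹) * descPochhammer ℚ n

theorem eval_binomPoly (n : ℕ) (a : ℚ) : (binomPoly n).eval a = Ring.choose a n := by
  rw [binomPoly, Ring.choose_eq_smul, Polynomial.eval_mul, Polynomial.eval_C, smul_eq_mul,
    ← Polynomial.aeval_eq_smeval, Polynomial.aeval_def, Polynomial.eval₂_eq_eval_map,
    descPochhammer_map]

theorem binomPoly_one : binomPoly 1 = Polynomial.X := by
  simp [binomPoly]

variable {p : ℕ} [hp : Fact p.Prime]

theorem norm_choose_le_one (a : ℚ) (ha : ‖(a : ℚ_[p])‖ ≤ 1) (n : ℕ) :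
    ‖((Ring.choose a n : ℚ) : ℚ_[p])‖ ≤ 1 := by
  have h1 : ((Ring.choose a n : ℚ) : ℚ_[p]) = Ring.choose (a : ℚ_[p]) n :=
    Ring.map_choose (Rat.castHom ℚ_[p]) a n
  let a' : ℤ_[p] := ⟨a, ha⟩
  have h2 : ((Ring.choose a' n : ℤ_[p]) : ℚ_[p]) = Ring.choose (a : ℚ_[p]) n :=
    Ring.map_choose (PadicInt.Coe.ringHom (p := p)) a' n
  rw [h1, ← h2]
  exact PadicInt.norm_le_one _

/-- `binom(a, p ^ k)` is a `p`-adic unit when `a` has valuation exactly `k`: each factor `a - i`,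
`0 < i < p ^ k`, has the absolute value of `i`. -/
theorem norm_choose_prime_pow (a : ℚ) (k : ℕ) (ha : ‖(a : ℚ_[p])‖ = (p : ℝ) ^ (-(k : ℤ))) :
    ‖((Ring.choose a (p ^ k) : ℚ) : ℚ_[p])‖ = 1 := by
  have hp1 : (1 : ℝ) < p := by exact_mod_cast hp.out.one_lt
  have hi : ∀ i ∈ Finset.range (p ^ k - 1), ‖(a : ℚ_[p]) - ((i + 1 : ℕ) : ℚ_[p])‖ =
      ‖((i + 1 : ℕ) : ℚ_[p])‖ := by
    intro i hi
    have hi' : i + 1 < p ^ k := by rw [Finset.mem_range] at hi; omega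
    have hlt : ‖(a : ℚ_[p])‖ < ‖((i + 1 : ℕ) : ℚ_[p])‖ := by
      rw [ha]
      by_contra hcon
      push Not at hcon
      have := (Padic.norm_int_le_pow_iff_dvd (p := p) ((i + 1 : ℕ) : ℤ) k).mp
        (by exact_mod_cast hcon)
      have h2 : p ^ k ∣ i + 1 := by exact_mod_cast this
      exact absurd (Nat.le_of_dvd (Nat.succ_pos i) h2) (by omega)
    rw [sub_eq_add_neg, Padic.add_eq_max_of_ne (by rw [norm_neg]; exact hlt.ne), norm_neg,
      max_eq_right hlt.le]
  obtain ⟨m, hm⟩ : ∃ m, p ^ k = m + 1 := ⟨p ^ k - 1, by have := pow_pos hp.out.pos k; omega⟩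
  have hpoch : ∀ n : ℕ, ((descPochhammer ℚ (n + 1)).eval a : ℚ) =
      a * ∏ i ∈ Finset.range n, (a - ((i + 1 : ℕ) : ℚ)) := by
    intro n
    induction n with
    | zero => simp
    | succ n ih =>
      rw [descPochhammer_succ_eval, ih, Finset.prod_range_succ]
      push_cast
      ring
  have hfac : ∀ n : ℕ, ‖((n.factorial : ℕ) : ℚ_[p])‖ =
      ∏ i ∈ Finset.range n, ‖((i + 1 : ℕ) : ℚ_[p])‖ := by
    intro n
    rw [← Finset.prod_range_add_one_eq_factorial, Nat.cast_prod, norm_prod]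
  rw [← eval_binomPoly, binomPoly, Polynomial.eval_mul, Polynomial.eval_C, hm, hpoch]
  push_cast
  rw [norm_mul, norm_mul, norm_prod, norm_inv, hfac, Finset.prod_range_succ]
  rw [hm, Nat.add_sub_cancel] at hi
  have h3 : ∏ b ∈ Finset.range m, ‖(a : ℚ_[p]) - ((b : ℚ_[p]) + 1)‖ =
      ∏ i ∈ Finset.range m, ‖((i + 1 : ℕ) : ℚ_[p])‖ := by
    refine Finset.prod_congr rfl fun i h => ?_
    rw [← hi i h]
    push_cast
    rfl
  have h4 : ‖((m + 1 : ℕ) : ℚ_[p])‖ = ‖(a : ℚ_[p])‖ := by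
    rw [← hm, ha, Nat.cast_pow, norm_pow, Padic.norm_p, zpow_neg, inv_pow, zpow_natCast]
  have h5 : ∏ i ∈ Finset.range m, ‖((i + 1 : ℕ) : ℚ_[p])‖ ≠ 0 := by
    refine Finset.prod_ne_zero_iff.mpr fun i _ => ?_
    rw [norm_ne_zero_iff]
    exact_mod_cast i.succ_ne_zero
  have h6 : ‖(a : ℚ_[p])‖ ≠ 0 := by
    rw [ha]
    exact zpow_ne_zero _ (by positivity)
  rw [h3, h4]
  field_simp

/-- The polynomial `∏_{k ≤ N} (1 - binom(X, p ^ k) ^ (p - 1))`: modulo `p`, the indicator function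
of `p ^ (N + 1) ℤ_p` on `ℤ_p`. -/
noncomputable def indicatorPoly (p N : ℕ) : ℚ[X] :=
  ∏ k ∈ Finset.range (N + 1), (1 - binomPoly (p ^ k) ^ (p - 1))

theorem norm_eval_indicatorPoly_lt_one (N : ℕ) (a : ℚ) (ha : ‖(a : ℚ_[p])‖ ≤ 1) (ha0 : a ≠ 0)
    (hv : padicValRat p a ≤ N) : ‖(((indicatorPoly p N).eval a : ℚ) : ℚ_[p])‖ < 1 := by
  have ha0' : (a : ℚ_[p]) ≠ 0 := by exact_mod_cast ha0
  have hnorm : ‖(a : ℚ_[p])‖ = (p : ℝ) ^ (-padicValRat p a) := by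
    rw [Padic.eq_padicNorm, padicNorm.eq_zpow_of_nonzero ha0]
    push_cast
    rfl
  have hp1 : (1 : ℝ) < p := by exact_mod_cast hp.out.one_lt
  have hv0 : 0 ≤ padicValRat p a := by
    rw [hnorm] at ha
    by_contra hneg
    exact absurd ha (not_le.mpr (one_lt_zpow₀ hp1 (by omega)))
  obtain ⟨k, hk⟩ := Int.eq_ofNat_of_zero_le hv0
  have hkN : k ∈ Finset.range (N + 1) := by rw [Finset.mem_range]; omega
  rw [indicatorPoly, Polynomial.eval_prod, Rat.cast_prod, norm_prod,
    ← Finset.mul_prod_erase _ _ hkN]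
  have hfac : ∀ j, ‖((Polynomial.eval a (1 - binomPoly (p ^ j) ^ (p - 1)) : ℚ) : ℚ_[p])‖ ≤ 1 := by
    intro j
    rw [Polynomial.eval_sub, Polynomial.eval_one, Polynomial.eval_pow, eval_binomPoly]
    push_cast
    rw [sub_eq_add_neg]
    refine (Padic.nonarchimedean _ _).trans (max_le (by simp) ?_)
    rw [norm_neg, norm_pow]
    exact pow_le_one₀ (norm_nonneg _) (norm_choose_le_one a ha _)
  have hstrict : ‖((Polynomial.eval a (1 - binomPoly (p ^ k) ^ (p - 1)) : ℚ) : ℚ_[p])‖ < 1 := by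
    rw [Polynomial.eval_sub, Polynomial.eval_one, Polynomial.eval_pow, eval_binomPoly]
    have h1 := norm_choose_prime_pow (p := p) a k (by rw [hnorm, hk])
    set z : ℤ_[p] := ⟨_, h1.le⟩ with hz
    have h2 : ‖z‖ = 1 := h1
    have h3 : ((1 - z ^ (p - 1) : ℤ_[p]) : ℚ_[p]) =
        ((1 - Ring.choose a (p ^ k) ^ (p - 1) : ℚ) : ℚ_[p]) := by
      push_cast
      rfl
    rw [← h3, ← PadicInt.norm_def, PadicInt.norm_lt_one_iff_dvd, ← Ideal.mem_span_singleton,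
      ← PadicInt.maximalIdeal_eq_span_p, ← PadicInt.ker_toZMod, RingHom.mem_ker, map_sub, map_one,
      map_pow, ZMod.pow_card_sub_one_eq_one, sub_self]
    intro h4
    rw [← RingHom.mem_ker, PadicInt.ker_toZMod, PadicInt.maximalIdeal_eq_span_p,
      Ideal.mem_span_singleton, ← PadicInt.norm_lt_one_iff_dvd] at h4
    exact absurd h2 h4.ne
  calc _ ≤ ‖((Polynomial.eval a (1 - binomPoly (p ^ k) ^ (p - 1)) : ℚ) : ℚ_[p])‖ * 1 := by
        refine mul_le_mul_of_nonneg_left ?_ (norm_nonneg _)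
        exact Finset.prod_le_one (fun _ _ => norm_nonneg _) fun j _ => hfac j
    _ < 1 := by rwa [mul_one]

/-- A rational number that is a `p`-adic unit is a quotient of integers prime to `p`. -/
theorem not_dvd_num_den_of_norm_eq_one (q : ℚ) (hq : ‖(q : ℚ_[p])‖ = 1) :
    ¬ (p : ℤ) ∣ q.num ∧ ¬ (p : ℤ) ∣ q.den := by
  have h1 : ‖((q.num : ℤ) : ℚ_[p])‖ = ‖((q.den : ℤ) : ℚ_[p])‖ := by
    have h2 : ((q.num : ℤ) : ℚ_[p]) = (q : ℚ_[p]) * ((q.den : ℤ) : ℚ_[p]) := by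
      have h3 := Rat.mul_den_eq_num q
      have h4 : ((q * q.den : ℚ) : ℚ_[p]) = ((q.num : ℚ) : ℚ_[p]) := by rw [h3]
      push_cast at h4 ⊢
      exact h4.symm
    rw [h2, norm_mul, hq, one_mul]
  rw [← Padic.norm_intCast_lt_one_iff, ← Padic.norm_intCast_lt_one_iff, h1, and_self,
    Padic.norm_intCast_lt_one_iff]
  intro hden
  have hnum : (p : ℤ) ∣ q.num := by
    rwa [← Padic.norm_intCast_lt_one_iff, h1, Padic.norm_intCast_lt_one_iff]
  have hcop := q.reduced
  have h5 : p ∣ q.num.natAbs := Int.natCast_dvd.mp hnum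
  have h6 : p ∣ q.den := by exact_mod_cast hden
  exact hp.out.one_lt.ne' (Nat.eq_one_of_dvd_coprimes hcop h5 h6)

end IntegerValued

/-- The arithmetic core.  Let `I` be a lattice stable under all `binom(θ, n)`, and `g` a vector
which is killed modulo `I` by a product of factors `θ - λ`, with `λ` nonzero rational numbers of
`p`-adic valuation at most `N`.  If `binom(θ, p ^ k) g ∈ I` for all `k ≤ N`, then `g ∈ I`.

The polynomials `F` such that `F(θ)` preserves `I` form a ring `𝓟`, in which those with
`F(θ) g ∈ I` form an ideal.  Modulo this ideal the polynomial `V = indicatorPoly p N` is `1` and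
`X` is `0`.  The factors `X - λ` divide either `V - V(λ)`, where `V(λ) ∈ p ℤ_(p)`, or, if `λ` is
not `p`-integral, a polynomial `D X - n` with `n` prime to `p`; all these are units modulo the
ideal, while their product is zero. -/
theorem mem_of_aeval_prod_sub_mem {p : ℕ} [hp : Fact p.Prime] {M : Type*} [AddCommGroup M]
    [Module ℚ M] (θ : M →ₗ[ℚ] M) (I F : AddSubgroup M) (hFI : F ≤ I)
    (hbin : ∀ n, ∀ h ∈ I, Polynomial.aeval θ (binomPoly n) h ∈ I)
    (hunit : ∀ n : ℤ, ¬ (p : ℤ) ∣ n → ∀ h, n • h ∈ I → h ∈ I)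
    (hF : ∀ q : ℚ[X], ∀ h ∈ F, Polynomial.aeval θ q h ∈ F) (N : ℕ) (g : M)
    (hT : ∀ k ≤ N, Polynomial.aeval θ (binomPoly (p ^ k)) g ∈ I) (Λ : Multiset ℚ)
    (hΛ : ∀ a ∈ Λ, a ≠ 0 ∧ padicValRat p a ≤ N)
    (hχ : Polynomial.aeval θ (Λ.map fun a => Polynomial.X - Polynomial.C a).prod g ∈ F) :
    g ∈ I := by
  let P : Subring ℚ[X] :=
    { carrier := {f | ∀ h ∈ I, Polynomial.aeval θ f h ∈ I}
      mul_mem' := fun {a b} ha hb h hh => by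
        rw [map_mul, Module.End.mul_apply]
        exact ha _ (hb _ hh)
      one_mem' := fun h hh => by simpa using hh
      add_mem' := fun {a b} ha hb h hh => by
        rw [map_add, LinearMap.add_apply]
        exact I.add_mem (ha _ hh) (hb _ hh)
      zero_mem' := fun h _ => by simp
      neg_mem' := fun {a} ha h hh => by
        rw [map_neg, LinearMap.neg_apply]
        exact I.neg_mem (ha _ hh) }
  let J : Ideal P :=
    { carrier := {f | Polynomial.aeval θ (f : ℚ[X]) g ∈ I}
      add_mem' := fun {a b} ha hb => by
        simp only [Set.mem_ofPred_eq] at ha hb ⊢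
        rw [Subring.coe_add, map_add, LinearMap.add_apply]
        exact I.add_mem ha hb
      zero_mem' := by simp
      smul_mem' := fun c x hx => by
        simp only [Set.mem_ofPred_eq, smul_eq_mul] at hx ⊢
        rw [Subring.coe_mul, map_mul, Module.End.mul_apply]
        exact c.2 _ hx }
  have hJ : ∀ f : P, Ideal.Quotient.mk J f = 0 ↔ Polynomial.aeval θ (f : ℚ[X]) g ∈ I :=
    fun f => Ideal.Quotient.eq_zero_iff_mem
  let T : ℕ → P := fun n => ⟨binomPoly n, hbin n⟩
  have hTJ : ∀ k ≤ N, Ideal.Quotient.mk J (T (p ^ k)) = 0 := fun k hk => (hJ _).mpr (hT k hk)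
  let V : P := ∏ k ∈ Finset.range (N + 1), (1 - T (p ^ k) ^ (p - 1))
  have hp1 : p - 1 ≠ 0 := by have := hp.out.two_le; omega
  have hVJ : Ideal.Quotient.mk J V = 1 := by
    rw [map_prod]
    refine Finset.prod_eq_one fun k hk => ?_
    rw [map_sub, map_pow, hTJ k (by rw [Finset.mem_range] at hk; omega), zero_pow hp1, map_one,
      sub_zero]
  have hV : (V : ℚ[X]) = indicatorPoly p N := by
    simp [V, indicatorPoly, T]
  have hprime : Prime (p : ℤ) := Nat.prime_iff_prime_int.mp hp.out
  have key : ∀ a ∈ Λ, ∃ (G : P) (n : ℤ), Polynomial.X - Polynomial.C a ∣ (G : ℚ[X]) ∧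
      Ideal.Quotient.mk J G = (n : P ⧸ J) ∧ ¬ (p : ℤ) ∣ n := by
    intro a ha
    obtain ⟨ha0, hav⟩ := hΛ a ha
    by_cases hint : ‖(a : ℚ_[p])‖ ≤ 1
    · set c := (indicatorPoly p N).eval a
      have hc : ‖(c : ℚ_[p])‖ < 1 := norm_eval_indicatorPoly_lt_one N a hint ha0 hav
      have hc1 : ‖((1 - c : ℚ) : ℚ_[p])‖ = 1 := by
        push_cast
        rw [sub_eq_add_neg, Padic.add_eq_max_of_ne (by rw [norm_neg, norm_one]; exact hc.ne'),
          norm_neg, norm_one, max_eq_left hc.le]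
      obtain ⟨hnum, hden⟩ := not_dvd_num_den_of_norm_eq_one _ hc1
      set u := 1 - c
      -- the polynomial `den * (V - 1) + num = den * (V - V(a))`
      refine ⟨((u.den : ℤ) : P) * (V - 1) + (u.num : P), u.num, ?_, ?_, hnum⟩
      · rw [Polynomial.dvd_iff_isRoot, Polynomial.IsRoot]
        push_cast
        rw [hV]
        simp only [Polynomial.eval_add, Polynomial.eval_mul, Polynomial.eval_sub,
          Polynomial.eval_one, Polynomial.eval_natCast, Polynomial.eval_intCast]
        have h3 := Rat.mul_den_eq_num u
        rw [← h3]
        change (u.den : ℚ) * (c - 1) + u * u.den = 0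
        simp only [u]
        ring
      · rw [map_add, map_mul, map_sub, hVJ, map_one, sub_self, mul_zero, zero_add, map_intCast]
    · have hden : p ∣ a.den := by
        by_contra h
        exact hint (Padic.norm_rat_le_one h)
      have hnum : ¬ (p : ℤ) ∣ a.num := by
        intro h
        exact hp.out.one_lt.ne' (Nat.eq_one_of_dvd_coprimes a.reduced (Int.natCast_dvd.mp h) hden)
      refine ⟨((a.den : ℤ) : P) * T (p ^ 0) - (a.num : P), -a.num, ?_, ?_, by
        rwa [dvd_neg]⟩
      · rw [Polynomial.dvd_iff_isRoot, Polynomial.IsRoot]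
        push_cast
        have h3 := Rat.mul_den_eq_num a
        simp only [T, pow_zero, binomPoly_one, Polynomial.eval_sub, Polynomial.eval_mul,
          Polynomial.eval_natCast, Polynomial.eval_intCast, Polynomial.eval_X]
        rw [← h3]
        ring
      · rw [map_sub, map_mul, hTJ 0 (Nat.zero_le _), mul_zero, zero_sub, map_intCast, Int.cast_neg]
  have key2 : ∀ Λ' : Multiset ℚ, Λ' ≤ Λ → ∃ (G : P) (n : ℤ),
      (Λ'.map fun a => Polynomial.X - Polynomial.C a).prod ∣ (G : ℚ[X]) ∧
      Ideal.Quotient.mk J G = (n : P ⧸ J) ∧ ¬ (p : ℤ) ∣ n := by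
    intro Λ'
    induction Λ' using Multiset.induction_on with
    | empty => exact fun _ => ⟨1, 1, by simp, by simp, hprime.not_dvd_one⟩
    | cons a s ih =>
      intro hle
      obtain ⟨G, n, h1, h2, h3⟩ := ih ((Multiset.le_cons_self s a).trans hle)
      obtain ⟨G', n', h1', h2', h3'⟩ := key a (Multiset.mem_of_le hle (Multiset.mem_cons_self a s))
      refine ⟨G' * G, n' * n, ?_, ?_, ?_⟩
      · rw [Multiset.map_cons, Multiset.prod_cons, Subring.coe_mul]
        exact mul_dvd_mul h1' h1
      · rw [map_mul, h2, h2', Int.cast_mul]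
      · exact fun h => (hprime.dvd_or_dvd h).elim h3' h3
  obtain ⟨G, n, ⟨q, hq⟩, h2, h3⟩ := key2 Λ le_rfl
  have h4 : Ideal.Quotient.mk J G = 0 := by
    rw [hJ, hq, mul_comm, map_mul, Module.End.mul_apply]
    exact hFI (hF q _ hχ)
  have h5 : Ideal.Quotient.mk J ((n : ℤ) : P) = 0 := by rw [map_intCast, ← h2, h4]
  rw [hJ] at h5
  refine hunit n h3 g ?_
  simpa using h5

/-! ### Logarithmic derivations of valued fields -/

section LogDerivation

open scoped WithZero

variable {K L : Type*} [Field K] [Field L] [Algebra K L]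

theorem Valuation.map_aeval_le_one (v : Valuation L ℤᵐ⁰)
    (hK : ∀ c : K, c ≠ 0 → v (algebraMap K L c) = 1) (f : L) (hf : v f ≤ 1) (h : K[X]) :
    v (Polynomial.aeval f h) ≤ 1 := by
  rw [Polynomial.aeval_eq_sum_range]
  refine v.map_sum_le fun i _ => ?_
  rw [Algebra.smul_def, map_mul, map_pow]
  refine mul_le_one' ?_ (pow_le_one' hf _)
  by_cases hc : h.coeff i = 0
  · simp [hc]
  · rw [hK _ hc]

/-- If the residue field of `v` is algebraic over `K`, then every `f` with `v f ≤ 1` satisfies a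
polynomial relation modulo the maximal ideal which is separable at `f`. -/
theorem Valuation.exists_aeval_lt_one_and_derivative_eq_one [CharZero K] (v : Valuation L ℤᵐ⁰)
    (hK : ∀ c : K, c ≠ 0 → v (algebraMap K L c) = 1) (f : L) (hf : v f ≤ 1)
    (hres : ∃ h : K[X], h ≠ 0 ∧ v (Polynomial.aeval f h) < 1) :
    ∃ h : K[X], v (Polynomial.aeval f h) < 1 ∧
      v (Polynomial.aeval f (Polynomial.derivative h)) = 1 := by
  classical
  have hex : ∃ n, ∃ h : K[X], h ≠ 0 ∧ v (Polynomial.aeval f h) < 1 ∧ h.natDegree = n := by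
    obtain ⟨h, h0, h1⟩ := hres
    exact ⟨_, h, h0, h1, rfl⟩
  -- a relation of minimal degree
  obtain ⟨h, h0, h1, hn⟩ := Nat.find_spec hex
  refine ⟨h, h1, le_antisymm (v.map_aeval_le_one hK f hf _) ?_⟩
  by_contra hlt
  push Not at hlt
  have hdeg : h.natDegree ≠ 0 := by
    intro hd
    obtain ⟨c, rfl⟩ := Polynomial.natDegree_eq_zero.mp hd
    rw [Polynomial.aeval_C, hK c (by simpa using h0)] at h1
    exact lt_irrefl _ h1
  have hd0 : Polynomial.derivative h ≠ 0 := fun hd =>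
    hdeg (Polynomial.derivative_eq_zero.mp hd)
  exact Nat.find_min hex (m := (Polynomial.derivative h).natDegree)
    (by rw [← hn]; exact Polynomial.natDegree_derivative_lt hdeg) ⟨_, hd0, hlt, rfl⟩

/-- A bounded derivation `D` with `D s = -s`, `v s < 1`, maps the valuation ring of `v` into its
maximal ideal, if the residue field is algebraic over the field of constants and of characteristic
zero.  Otherwise choose `f` in the valuation ring with `v (D f) ≥ 1` maximal; replacing `f` by
`h(f)` one may assume `v f < 1`.  With `a`, `e` the orders of `f` and `s`, the element
`u = f ^ e / s ^ a` is a unit and `D u / u = e D f / f + a` violates maximality. -/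
theorem Valuation.derivation_lt_one [CharZero K] (v : Valuation L ℤᵐ⁰)
    (hK : ∀ c : K, c ≠ 0 → v (algebraMap K L c) = 1)
    (hres : ∀ f, v f ≤ 1 → ∃ h : K[X], h ≠ 0 ∧ v (Polynomial.aeval f h) < 1)
    (D : Derivation K L L) (hbd : ∃ C, ∀ f, v f ≤ 1 → v (D f) ≤ C)
    (s : L) (hs0 : s ≠ 0) (hs : v s < 1) (hDs : D s = -s) (f : L) (hf : v f ≤ 1) :
    v (D f) < 1 := by
  by_contra hcon
  push Not at hcon
  obtain ⟨C, hC⟩ := hbd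
  have hnat : ∀ n : ℕ, n ≠ 0 → v (n : L) = 1 := fun n hn => by
    rw [← map_natCast (algebraMap K L)]
    exact hK _ (by exact_mod_cast hn)
  obtain ⟨z, ⟨f1, hf1, hz⟩, hmax⟩ := Int.exists_greatest_of_bdd
    (P := fun z => ∃ f, v f ≤ 1 ∧ v (D f) = WithZero.exp z)
    ⟨WithZero.log C, by
      rintro z ⟨f', h1, h2⟩
      have h3 := hC f' h1
      rw [h2] at h3
      have hC0 : C ≠ 0 := by
        rintro rfl
        simp at h3
      rwa [← WithZero.exp_log hC0, WithZero.exp_le_exp] at h3⟩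
    ⟨WithZero.log (v (D f)), f, hf, (WithZero.exp_log (by
      intro h0
      rw [h0] at hcon
      simp at hcon)).symm⟩
  have hz0 : 0 ≤ z := by
    have h0 : v (D f) ≠ 0 := by
      intro h0
      rw [h0] at hcon
      simp at hcon
    have h1 := hmax (WithZero.log (v (D f))) ⟨f, hf, (WithZero.exp_log h0).symm⟩
    refine le_trans ?_ h1
    rwa [← WithZero.exp_le_exp, WithZero.exp_log h0, WithZero.exp_zero]
  obtain ⟨h, hh1, hh2⟩ := v.exists_aeval_lt_one_and_derivative_eq_one hK f1 hf1 (hres f1 hf1)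
  set g := Polynomial.aeval f1 h
  have hDg : v (D g) = WithZero.exp z := by
    rw [Derivation.map_aeval, smul_eq_mul, map_mul, hh2, one_mul, hz]
  have hg0 : g ≠ 0 := by
    intro h0
    rw [h0, map_zero, map_zero] at hDg
    exact WithZero.exp_ne_zero hDg.symm
  have hvg : v g ≠ 0 := (v.ne_zero_iff).mpr hg0
  have hvs : v s ≠ 0 := (v.ne_zero_iff).mpr hs0
  obtain ⟨a, ha⟩ : ∃ a : ℤ, v g = WithZero.exp (-a) :=
    ⟨-WithZero.log (v g), by rw [neg_neg, WithZero.exp_log hvg]⟩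
  obtain ⟨e, he⟩ : ∃ e : ℤ, v s = WithZero.exp (-e) :=
    ⟨-WithZero.log (v s), by rw [neg_neg, WithZero.exp_log hvs]⟩
  have ha1 : 1 ≤ a := by
    rw [ha, ← WithZero.exp_zero, WithZero.exp_lt_exp] at hh1
    omega
  have he1 : 1 ≤ e := by
    rw [he, ← WithZero.exp_zero, WithZero.exp_lt_exp] at hs
    omega
  lift a to ℕ using by omega
  lift e to ℕ using by omega
  -- the unit `u` has a derivative of larger absolute value than that of `f1`
  set u := g ^ e / s ^ a
  have hu : v u = 1 := by
    simp only [u, map_div₀, map_pow, ha, he, ← WithZero.exp_nsmul, ← WithZero.exp_sub]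
    rw [← WithZero.exp_zero]
    congr 1
    simp only [nsmul_eq_mul]
    ring
  have hu0 : u ≠ 0 := div_ne_zero (pow_ne_zero _ hg0) (pow_ne_zero _ hs0)
  have hDu : D u = u * (e * (D g / g) + a) := by
    have he' : g ^ e = g ^ (e - 1) * g := by rw [← pow_succ]; congr 1; omega
    have ha' : s ^ a = s ^ (a - 1) * s := by rw [← pow_succ]; congr 1; omega
    simp only [u, Derivation.leibniz_div, Derivation.leibniz_pow, hDs, smul_eq_mul, nsmul_eq_mul]
    rw [he', ha']
    field_simp
    ring
  have h1 : v (e * (D g / g)) = WithZero.exp (z + a) := by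
    rw [map_mul, hnat e (by omega), one_mul, map_div₀, hDg, ha, ← WithZero.exp_sub, sub_neg_eq_add]
  have h2 : v (D u) = WithZero.exp (z + a) := by
    rw [hDu, map_mul, hu, one_mul, ← h1]
    refine v.map_add_eq_of_lt_left ?_
    rw [h1, hnat a (by omega), ← WithZero.exp_zero, WithZero.exp_lt_exp]
    omega
  have h3 := hmax _ ⟨u, hu.le, h2⟩
  omega

/-- Under the hypotheses of `Valuation.derivation_lt_one`, `D` acts on elements of order `a` as
multiplication by `-a / e`, up to higher order, where `e` is the order of `s`. -/
theorem Valuation.derivation_add_smul_lt [CharZero K] (v : Valuation L ℤᵐ⁰)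
    (hK : ∀ c : K, c ≠ 0 → v (algebraMap K L c) = 1)
    (D : Derivation K L L) (hD : ∀ f, v f ≤ 1 → v (D f) < 1)
    (s : L) (hs0 : s ≠ 0) (e : ℕ) (he : e ≠ 0) (hs : v s = WithZero.exp (-(e : ℤ)))
    (hDs : D s = -s) (f : L) (a : ℤ) (hf : v f = WithZero.exp (-a)) :
    v (D f + algebraMap K L (a / e) * f) < WithZero.exp (-a) := by
  have hf0 : f ≠ 0 := by
    rintro rfl
    rw [map_zero] at hf
    exact WithZero.exp_ne_zero hf.symm
  have hnat : v (e : L) = 1 := by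
    rw [← map_natCast (algebraMap K L)]
    exact hK _ (by exact_mod_cast he)
  have he0 : (e : L) ≠ 0 := by
    intro h0
    rw [h0, map_zero] at hnat
    exact zero_ne_one hnat
  -- `D u / u = e D f / f + a` for the unit `u = f ^ e / s ^ a`
  set u := f ^ e / s ^ a
  have hu : v u = 1 := by
    simp only [u, map_div₀, map_pow, map_zpow₀, hs, hf, ← WithZero.exp_nsmul, ← WithZero.exp_zsmul,
      ← WithZero.exp_sub]
    rw [← WithZero.exp_zero]
    congr 1
    simp only [nsmul_eq_mul, zsmul_eq_mul]
    push_cast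
    ring
  have hu0 : u ≠ 0 := div_ne_zero (pow_ne_zero _ hf0) (zpow_ne_zero _ hs0)
  have hDu : D u = u * (e * ((D f + algebraMap K L (a / e) * f) / f)) := by
    have he' : f ^ e = f ^ (e - 1) * f := by
      rw [← pow_succ]; congr 1; omega
    have ha' : s ^ a = s ^ (a - 1) * s := by
      rw [← zpow_add_one₀ hs0, sub_add_cancel]
    simp only [u, Derivation.leibniz_div, Derivation.leibniz_pow, Derivation.leibniz_zpow, hDs,
      smul_eq_mul, nsmul_eq_mul, zsmul_eq_mul, map_div₀, map_intCast, map_natCast]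
    have hz : s ^ (a - 1) ≠ 0 := zpow_ne_zero _ hs0
    rw [he', ha']
    field_simp
    ring
  have h1 := hD u hu.le
  rw [hDu, map_mul, hu, one_mul, map_mul, hnat, one_mul, map_div₀, hf] at h1
  rwa [div_lt_one₀ (by simp)] at h1

theorem Valuation.derivation_le [CharZero K] (v : Valuation L ℤᵐ⁰)
    (hK : ∀ c : K, c ≠ 0 → v (algebraMap K L c) = 1)
    (D : Derivation K L L) (hD : ∀ f, v f ≤ 1 → v (D f) < 1)
    (s : L) (hs0 : s ≠ 0) (e : ℕ) (he : e ≠ 0) (hs : v s = WithZero.exp (-(e : ℤ)))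
    (hDs : D s = -s) (f : L) : v (D f) ≤ v f := by
  by_cases hf0 : f = 0
  · simp [hf0]
  have hvf : v f ≠ 0 := (v.ne_zero_iff).mpr hf0
  have hf : v f = WithZero.exp (-(-WithZero.log (v f))) := by rw [neg_neg, WithZero.exp_log hvf]
  have h1 := v.derivation_add_smul_lt hK D hD s hs0 e he hs hDs f _ hf
  rw [← hf] at h1
  set c : K := ((-WithZero.log (v f) : ℤ) : K) / e
  have h2 : D f = (D f + algebraMap K L c * f) - algebraMap K L c * f := by ring
  rw [h2]
  refine v.map_sub_le h1.le ?_
  rw [map_mul]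
  refine mul_le_of_le_one_left' ?_
  by_cases hc : c = 0
  · simp [hc]
  · rw [hK c hc]

/-- A derivation of a field of characteristic zero as a `ℚ`-linear operator. -/
noncomputable def Derivation.toRatLinearMap [CharZero L] (D : Derivation K L L) : L →ₗ[ℚ] L :=
  ((D : L →ₗ[K] L) : L →+ L).toRatLinearMap

@[simp]
theorem Derivation.toRatLinearMap_apply [CharZero L] (D : Derivation K L L) (f : L) :
    D.toRatLinearMap f = D f := rfl

theorem Valuation.map_ratCast_le_one (v : Valuation L ℤᵐ⁰)
    (hK : ∀ c : K, c ≠ 0 → v (algebraMap K L c) = 1) (c : ℚ) : v (c : L) ≤ 1 := by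
  rw [← map_ratCast (algebraMap K L)]
  by_cases hc : (c : K) = 0
  · simp [hc]
  · rw [hK _ hc]

theorem Valuation.aeval_derivation_le [CharZero L] (v : Valuation L ℤᵐ⁰)
    (hK : ∀ c : K, c ≠ 0 → v (algebraMap K L c) = 1) (D : Derivation K L L)
    (hD : ∀ f, v (D f) ≤ v f) (q : ℚ[X]) (f : L) :
    v (Polynomial.aeval D.toRatLinearMap q f) ≤ v f := by
  induction q using Polynomial.induction_on' with
  | add q r hq hr =>
    rw [map_add, LinearMap.add_apply]
    exact v.map_add_le hq hr
  | monomial n c =>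
    rw [Polynomial.aeval_monomial, Module.algebraMap_end_eq_smul_id, Module.End.mul_apply,
      LinearMap.smul_apply, LinearMap.id_apply, Algebra.smul_def, eq_ratCast, map_mul]
    refine (mul_le_of_le_one_left' (v.map_ratCast_le_one hK c)).trans ?_
    induction n with
    | zero => simp
    | succ n ih =>
      rw [pow_succ', Module.End.mul_apply]
      exact (hD _).trans ih

/-- The eigenvalues `-a / e`, `lo ≤ a < hi`, of a logarithmic derivation on the elements of order
at least `lo` modulo those of order at least `hi`. -/
noncomputable def logEigenvalues (e : ℕ) (lo hi : ℤ) : Multiset ℚ :=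
  (Finset.Ico lo hi).val.map fun a : ℤ => -(a : ℚ) / e

/-- The product of the factors `D + a / e`, `lo ≤ a < hi`, raises the order from `lo` to `hi`, because each
of them kills the corresponding graded piece. -/
theorem Valuation.aeval_prod_logEigenvalues_le [CharZero K] [CharZero L] (v : Valuation L ℤᵐ⁰)
    (hK : ∀ c : K, c ≠ 0 → v (algebraMap K L c) = 1)
    (D : Derivation K L L) (hD : ∀ f, v f ≤ 1 → v (D f) < 1)
    (s : L) (hs0 : s ≠ 0) (e : ℕ) (he : e ≠ 0) (hs : v s = WithZero.exp (-(e : ℤ)))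
    (hDs : D s = -s) (lo hi : ℤ) (hlo : lo ≤ hi) (f : L) (hf : v f ≤ WithZero.exp (-lo)) :
    v (Polynomial.aeval D.toRatLinearMap
      ((logEigenvalues e lo hi).map fun a => Polynomial.X - Polynomial.C a).prod f) ≤
        WithZero.exp (-hi) := by
  induction hi, hlo using Int.leInduction with
  | base => simpa [logEigenvalues] using hf
  | succ n hn ih =>
    have hins : logEigenvalues e lo (n + 1) = (-(n : ℚ) / e) ::ₘ logEigenvalues e lo n := by
      rw [logEigenvalues, ← Finset.insert_Ico_right_eq_Ico_add_one hn,
        Finset.insert_val_of_notMem (by simp), Multiset.map_cons]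
      rfl
    rw [hins, Multiset.map_cons, Multiset.prod_cons, map_mul, Module.End.mul_apply]
    set g := Polynomial.aeval D.toRatLinearMap
      ((logEigenvalues e lo n).map fun a => Polynomial.X - Polynomial.C a).prod f
    have h1 : Polynomial.aeval D.toRatLinearMap
        (Polynomial.X - Polynomial.C (-(n : ℚ) / e)) g = D g + algebraMap K L (n / e) * g := by
      rw [_root_.map_sub, Polynomial.aeval_X, Polynomial.aeval_C, LinearMap.sub_apply,
        D.toRatLinearMap_apply, Module.algebraMap_end_apply, Algebra.smul_def, eq_ratCast]
      push_cast
      simp only [map_intCast]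
      ring
    rw [h1]
    suffices h : v (D g + algebraMap K L (n / e) * g) < WithZero.exp (-n) by
      by_cases h0 : v (D g + algebraMap K L (n / e) * g) = 0
      · rw [h0]
        exact zero_le
      · rw [← WithZero.exp_log h0, WithZero.exp_lt_exp] at h
        rw [← WithZero.exp_log h0, WithZero.exp_le_exp]
        omega
    rcases ih.lt_or_eq with hlt | heq
    · refine v.map_add_lt ?_ ?_
      · exact (v.derivation_le hK D hD s hs0 e he hs hDs g).trans_lt hlt
      · rw [map_mul]
        refine lt_of_le_of_lt (mul_le_of_le_one_left' ?_) hlt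
        by_cases hc : ((n : K) / e) = 0
        · simp [hc]
        · rw [hK _ hc]
    · exact v.derivation_add_smul_lt hK D hD s hs0 e he hs hDs g n heq

end LogDerivation

/-! ### Differentiation with respect to `x` on the curve -/

section BivariateTaylor

/-- The partial derivative `∂G/∂x` of `G ∈ R[x][y]`, taken coefficientwise. -/
noncomputable def Polynomial.coeffDeriv {R : Type*} [CommRing R] (G : R[X][X]) : R[X][X] :=
  G.sum fun i a => Polynomial.monomial i (Polynomial.derivative a)

theorem Polynomial.coeffDeriv_add {R : Type*} [CommRing R] (G H : R[X][X]) :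
    (G + H).coeffDeriv = G.coeffDeriv + H.coeffDeriv :=
  Polynomial.sum_add_index G H _ (by simp) (by simp)

theorem Polynomial.coeffDeriv_monomial {R : Type*} [CommRing R] (n : ℕ) (a : R[X]) :
    (Polynomial.monomial n a).coeffDeriv = Polynomial.monomial n (Polynomial.derivative a) :=
  Polynomial.sum_monomial_index _ _ (by simp)

theorem Polynomial.coeff_coeffDeriv {R : Type*} [CommRing R] (G : R[X][X]) (n : ℕ) :
    G.coeffDeriv.coeff n = Polynomial.derivative (G.coeff n) := by
  induction G using Polynomial.induction_on' with
  | add G H hG hH => simp [Polynomial.coeffDeriv_add, hG, hH]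
  | monomial m a =>
    rw [Polynomial.coeffDeriv_monomial, Polynomial.coeff_monomial, Polynomial.coeff_monomial]
    split_ifs <;> simp

theorem Polynomial.coeffDeriv_map {R S : Type*} [CommRing R] [CommRing S] (φ : R →+* S)
    (G : R[X][X]) : (G.map (Polynomial.mapRingHom φ)).coeffDeriv =
      G.coeffDeriv.map (Polynomial.mapRingHom φ) := by
  ext1 n
  simp [Polynomial.coeff_coeffDeriv, Polynomial.derivative_map]

/-- Taylor's formula to first order for a polynomial in two variables. -/
theorem Polynomial.eval₂_eval₂_add_of_mul_eq_zero {R S : Type*} [CommRing R] [CommRing S]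
    (φ : R →+* S) (x y a b : S) (haa : a * a = 0) (hab : a * b = 0) (hbb : b * b = 0)
    (G : R[X][X]) :
    G.eval₂ (Polynomial.eval₂RingHom φ (x + a)) (y + b) =
      G.eval₂ (Polynomial.eval₂RingHom φ x) y +
        G.coeffDeriv.eval₂ (Polynomial.eval₂RingHom φ x) y * a +
        G.derivative.eval₂ (Polynomial.eval₂RingHom φ x) y * b := by
  induction G using Polynomial.induction_on' with
  | add G H hG hH =>
    rw [Polynomial.coeffDeriv_add, Polynomial.derivative_add, Polynomial.eval₂_add,
      Polynomial.eval₂_add, Polynomial.eval₂_add, Polynomial.eval₂_add, hG, hH]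
    ring
  | monomial n c =>
    have h1 : (c.eval₂ φ (x + a)) = c.eval₂ φ x + c.derivative.eval₂ φ x * a := by
      have := (c.map φ).eval_add_of_sq_eq_zero x a (by rw [sq, haa])
      simpa [Polynomial.eval_map, Polynomial.derivative_map] using this
    have h2 : (y + b) ^ n = y ^ n + n * y ^ (n - 1) * b := by
      have := (Polynomial.X ^ n : S[X]).eval_add_of_sq_eq_zero y b (by rw [sq, hbb])
      simpa [Polynomial.derivative_X_pow] using this
    rw [Polynomial.coeffDeriv_monomial, Polynomial.derivative_monomial,
      Polynomial.eval₂_monomial, Polynomial.eval₂_monomial, Polynomial.eval₂_monomial,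
      Polynomial.eval₂_monomial, h2]
    simp only [Polynomial.coe_eval₂RingHom]
    rw [h1, Polynomial.eval₂_mul, Polynomial.eval₂_natCast]
    linear_combination (n * y ^ (n - 1) * c.derivative.eval₂ φ x) * hab

end BivariateTaylor

namespace CurveLift

variable {p : ℕ} [Fact p.Prime] {k : Type u} [Field k] [Finite k] [CharP k p] (C : CurveLift p k)

instance : CharZero (Zq p k) := by
  refine charZero_of_inj_zero fun n hn => ?_
  by_contra h0
  obtain ⟨a, m, hm, rfl⟩ := Nat.exists_eq_pow_mul_and_not_dvd h0 p (Fact.out : p.Prime).ne_one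
  push_cast at hn
  have h1 : (m : Zq p k) = 0 :=
    (mul_eq_zero.mp hn).resolve_left (pow_ne_zero _ (WittVector.irreducible p).ne_zero)
  have h2 : (m : k) = 0 := by
    have := congrArg WittVector.constantCoeff h1
    simpa using this
  exact hm ((CharP.cast_eq_zero_iff k p m).mp h2)

instance : CharZero (Qq p k) :=
  charZero_of_injective_algebraMap (IsFractionRing.injective (Zq p k) (Qq p k))

instance : CharZero C.L :=
  charZero_of_injective_algebraMap (algebraMap (Qq p k) C.L).injective

/-- Evaluation of `G ∈ ℤ_q[x][y]` at `(x, y)`. -/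
noncomputable def ev : (Zq p k)[X][X] →+* C.L :=
  (algebraMap C.A C.L).comp (AdjoinRoot.mk C.Q)

theorem ev_Q : C.ev C.Q = 0 := by
  simp [ev]

theorem ev_eq_eval₂ (G : (Zq p k)[X][X]) : C.ev G = G.eval₂ C.incl C.y := by
  have h : C.ev = Polynomial.eval₂RingHom C.incl C.y := by
    apply Polynomial.ringHom_ext
    · intro a
      simp [ev, incl]
    · simp [ev, y]
  rw [h]
  rfl

theorem incl_eq_eval₂RingHom :
    C.incl = Polynomial.eval₂RingHom (algebraMap (Zq p k) C.L) C.x := by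
  apply Polynomial.ringHom_ext
  · intro a
    rw [Polynomial.coe_eval₂RingHom, Polynomial.eval₂_C]
    rfl
  · simp [x]

theorem one_le_d : 1 ≤ C.d := by
  by_contra h
  have h0 : C.Q.natDegree = 0 := by
    have : C.Q.natDegree = C.d := rfl
    omega
  apply C.degree_ne_zero
  rw [Polynomial.degree_eq_natDegree C.monic.ne_zero, h0]
  rfl

/-- The value `∂𝒬/∂y (x, y)`. -/
noncomputable def Qy : C.L := C.ev C.Q.derivative

/-- The value `∂𝒬/∂x (x, y)`. -/
noncomputable def Qx : C.L := C.ev C.Q.coeffDeriv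

theorem Qy_ne_zero : C.Qy ≠ 0 := by
  rw [Qy, ev, RingHom.comp_apply, Ne, map_eq_zero_iff _ (IsFractionRing.injective C.A C.L),
    AdjoinRoot.mk_eq_zero]
  have hd := C.one_le_d
  have hlt : C.Q.derivative.natDegree < C.Q.natDegree :=
    Polynomial.natDegree_derivative_lt (by change C.d ≠ 0; omega)
  have h0 : C.Q.derivative ≠ 0 := by
    rw [Ne, Polynomial.derivative_eq_zero]
    change C.d ≠ 0
    omega
  exact Polynomial.not_dvd_of_natDegree_lt h0 hlt

/-- The ring homomorphism `f ↦ f + (df/dx) ε` into the dual numbers, on `𝒜`. -/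
noncomputable def toDualNumberA : C.A →+* DualNumber C.L :=
  AdjoinRoot.lift
    (Polynomial.eval₂RingHom ((algebraMap C.L (DualNumber C.L)).comp (algebraMap (Zq p k) C.L))
      (algebraMap C.L (DualNumber C.L) C.x + DualNumber.eps))
    (algebraMap C.L (DualNumber C.L) C.y + algebraMap C.L (DualNumber C.L) (-C.Qx / C.Qy) *
      DualNumber.eps) (by
    have hee : (DualNumber.eps : DualNumber C.L) * DualNumber.eps = 0 := DualNumber.eps_mul_eps
    rw [Polynomial.eval₂_eval₂_add_of_mul_eq_zero _ _ _ _ _ hee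
      (by rw [mul_left_comm, hee, mul_zero])
      (by rw [mul_mul_mul_comm, hee, mul_zero])]
    have h1 : ∀ G : (Zq p k)[X][X], G.eval₂ (Polynomial.eval₂RingHom
        ((algebraMap C.L (DualNumber C.L)).comp (algebraMap (Zq p k) C.L))
        (algebraMap C.L (DualNumber C.L) C.x)) (algebraMap C.L (DualNumber C.L) C.y) =
        algebraMap C.L (DualNumber C.L) (C.ev G) := by
      intro G
      rw [ev_eq_eval₂, Polynomial.hom_eval₂]
      congr 1
      rw [incl_eq_eval₂RingHom]
      apply Polynomial.ringHom_ext <;> simp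
    rw [h1, h1, h1, ev_Q, map_zero, zero_add, ← mul_assoc, ← add_mul, ← map_mul, ← map_add]
    have h2 : C.ev C.Q.coeffDeriv + C.ev C.Q.derivative * (-C.Qx / C.Qy) = 0 := by
      change C.Qx + C.Qy * (-C.Qx / C.Qy) = 0
      have := C.Qy_ne_zero
      field_simp
      ring
    rw [h2, map_zero, zero_mul])

theorem fst_toDualNumberA (f : C.A) :
    TrivSqZeroExt.fst (C.toDualNumberA f) = algebraMap C.A C.L f := by
  have h : (TrivSqZeroExt.fstHom C.L C.L C.L : DualNumber C.L →+* C.L).comp C.toDualNumberA =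
      algebraMap C.A C.L := by
    apply AdjoinRoot.ringHom_ext
    · apply Polynomial.ringHom_ext
      · intro a
        simp [toDualNumberA, TrivSqZeroExt.algebraMap_eq_inl]
        rfl
      · simp [toDualNumberA, TrivSqZeroExt.algebraMap_eq_inl]
        rfl
    · simp [toDualNumberA, TrivSqZeroExt.algebraMap_eq_inl]
      rfl
  exact congrArg (fun g => g f) h

/-- The ring homomorphism `f ↦ f + (df/dx) ε` of the function field into its dual numbers. -/
noncomputable def toDualNumber : C.L →+* DualNumber C.L :=
  IsLocalization.lift (M := nonZeroDivisors C.A) (g := C.toDualNumberA) fun f => by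
    rw [TrivSqZeroExt.isUnit_iff_isUnit_fst, fst_toDualNumberA]
    exact IsLocalization.map_units C.L f

theorem toDualNumber_algebraMap (f : C.A) :
    C.toDualNumber (algebraMap C.A C.L f) = C.toDualNumberA f :=
  IsLocalization.lift_eq _ f

theorem fst_toDualNumber (f : C.L) : TrivSqZeroExt.fst (C.toDualNumber f) = f := by
  have h : (TrivSqZeroExt.fstHom C.L C.L C.L : DualNumber C.L →+* C.L).comp C.toDualNumber =
      RingHom.id C.L := by
    apply IsLocalization.ringHom_ext (nonZeroDivisors C.A)
    refine RingHom.ext fun f => ?_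
    simp only [RingHom.comp_apply, toDualNumber_algebraMap, RingHom.id_apply]
    exact C.fst_toDualNumberA f
  exact congrArg (fun g => g f) h

theorem toDualNumber_algebraMap_Qq (c : Qq p k) :
    C.toDualNumber (algebraMap (Qq p k) C.L c) =
      algebraMap C.L (DualNumber C.L) (algebraMap (Qq p k) C.L c) := by
  have h : C.toDualNumber.comp (algebraMap (Qq p k) C.L) =
      (algebraMap C.L (DualNumber C.L)).comp (algebraMap (Qq p k) C.L) := by
    apply IsLocalization.ringHom_ext (nonZeroDivisors (Zq p k))
    ext1 a
    simp only [RingHom.comp_apply]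
    rw [← IsScalarTower.algebraMap_apply (Zq p k) (Qq p k) C.L,
      IsScalarTower.algebraMap_apply (Zq p k) C.A C.L, toDualNumber_algebraMap,
      AdjoinRoot.algebraMap_eq']
    simp only [toDualNumberA, RingHom.comp_apply, AdjoinRoot.lift_of, Polynomial.algebraMap_eq,
      Polynomial.coe_eval₂RingHom, Polynomial.eval₂_C]
    rfl
  exact congrArg (fun g => g c) h

/-- The derivation `d/dx` of the function field. -/
noncomputable def ddx : Derivation (Qq p k) C.L C.L :=
  Derivation.mk'
    { toFun := fun f => TrivSqZeroExt.snd (C.toDualNumber f)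
      map_add' := fun f g => by rw [map_add, TrivSqZeroExt.snd_add]
      map_smul' := fun c f => by
        rw [Algebra.smul_def, map_mul, toDualNumber_algebraMap_Qq, TrivSqZeroExt.algebraMap_eq_inl,
          TrivSqZeroExt.snd_mul]
        simp [Algebra.smul_def] }
    fun f g => by
      simp only [LinearMap.coe_mk, AddHom.coe_mk]
      rw [map_mul, TrivSqZeroExt.snd_mul, fst_toDualNumber, fst_toDualNumber]
      simp [mul_comm]

theorem ddx_apply (f : C.L) : C.ddx f = TrivSqZeroExt.snd (C.toDualNumber f) := rfl

@[simp]
theorem ddx_x : C.ddx C.x = 1 := by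
  rw [ddx_apply, x, incl, RingHom.comp_apply, toDualNumber_algebraMap]
  simp [toDualNumberA, TrivSqZeroExt.algebraMap_eq_inl]

theorem ddx_y : C.ddx C.y = -C.Qx / C.Qy := by
  rw [ddx_apply, y, toDualNumber_algebraMap]
  simp [toDualNumberA, TrivSqZeroExt.algebraMap_eq_inl]

theorem ddx_algebraMap_Zq (a : Zq p k) : C.ddx (algebraMap (Zq p k) C.L a) = 0 := by
  rw [IsScalarTower.algebraMap_apply (Zq p k) (Qq p k) C.L]
  exact Derivation.map_algebraMap _ _

/-- Every `h ∈ ℚ_q(x, y)` has differential `(dh/dx) dx`. -/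
theorem D_eq (h : C.L) : KaehlerDifferential.D (Qq p k) C.L h =
    C.ddx h • KaehlerDifferential.D (Qq p k) C.L C.x := by
  set ω := KaehlerDifferential.D (Qq p k) C.L C.x
  -- the derivation `E = D - (d/dx) dx` vanishes on `x`, hence on `y`, hence everywhere
  let E : Derivation (Qq p k) C.L (Ω[C.L⁄(Qq p k)]) :=
    KaehlerDifferential.D (Qq p k) C.L - (LinearMap.toSpanSingleton C.L _ ω).compDer C.ddx
  have hE : ∀ f, E f = KaehlerDifferential.D (Qq p k) C.L f - C.ddx f • ω := fun f => rfl
  have hO : ∀ a : Zq p k, E (algebraMap (Zq p k) C.L a) = 0 := fun a => by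
    rw [IsScalarTower.algebraMap_apply (Zq p k) (Qq p k) C.L]
    exact Derivation.map_algebraMap _ _
  have hx : E C.x = 0 := by rw [hE, ddx_x, one_smul, sub_self]
  have hincl : ∀ g, E (C.incl g) = 0 := by
    intro g
    induction g using Polynomial.induction_on' with
    | add g h hg hh => rw [map_add, map_add, hg, hh, add_zero]
    | monomial n a =>
      rw [incl_eq_eval₂RingHom, Polynomial.coe_eval₂RingHom, Polynomial.eval₂_monomial,
        Derivation.leibniz, Derivation.leibniz_pow, hO, hx]
      simp
  have hev : ∀ G, E (C.ev G) = C.ev G.derivative • E C.y := by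
    intro G
    induction G using Polynomial.induction_on' with
    | add g h hg hh => rw [map_add, map_add, hg, hh, Polynomial.derivative_add, map_add, add_smul]
    | monomial n a =>
      rw [ev_eq_eval₂, ev_eq_eval₂, Polynomial.derivative_monomial, Polynomial.eval₂_monomial,
        Polynomial.eval₂_monomial, Derivation.leibniz, Derivation.leibniz_pow, hincl, smul_zero,
        add_zero, map_mul, map_natCast, mul_smul, mul_smul, Nat.cast_smul_eq_nsmul]
  have hy : E C.y = 0 := by
    have h1 := hev C.Q
    rw [ev_Q, map_zero] at h1
    exact (smul_eq_zero.mp h1.symm).resolve_left C.Qy_ne_zero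
  have hA : ∀ a : C.A, E (algebraMap C.A C.L a) = 0 := by
    intro a
    obtain ⟨G, rfl⟩ := AdjoinRoot.mk_surjective a
    have := hev G
    rwa [hy, smul_zero] at this
  have : E h = 0 := by
    obtain ⟨a, b, hb, rfl⟩ := IsFractionRing.div_surjective (A := C.A) h
    rw [Derivation.leibniz_div, hA, hA]
    simp
  rw [hE, sub_eq_zero] at this
  exact this

theorem D_x_ne_zero : KaehlerDifferential.D (Qq p k) C.L C.x ≠ 0 := by
  intro h
  have h1 := congrArg C.ddx.liftKaehlerDifferential h
  rw [Derivation.liftKaehlerDifferential_comp_D, ddx_x, map_zero] at h1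
  exact one_ne_zero h1

end CurveLift

/-! ### The discriminant -/

section Discriminant

variable {R : Type*} [CommRing R]

theorem Polynomial.Monic.resultant_derivative_eq [Nontrivial R] {G : R[X]} (hG : G.Monic)
    (hd : 0 < G.degree) :
    G.resultant G.derivative =
      (-1) ^ (G.natDegree * (G.natDegree - 1) / 2) * G.discr := by
  have h1 := Polynomial.resultant_deriv hd
  have h2 : G.derivative.natDegree ≤ G.natDegree - 1 := Polynomial.natDegree_derivative_le G
  have h3 := Polynomial.resultant_add_right_deg G G.derivative G.natDegree
    G.derivative.natDegree (G.natDegree - 1 - G.derivative.natDegree) le_rfl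
  rw [Nat.add_sub_cancel' h2, hG.coeff_natDegree, one_pow, one_mul, h1, hG.leadingCoeff,
    mul_one] at h3
  exact h3.symm

/-- A monic polynomial is coprime to its derivative if and only if its discriminant is a unit. -/
theorem Polynomial.Monic.isUnit_discr_iff [Nontrivial R] {G : R[X]} (hG : G.Monic)
    (hd : 0 < G.degree) : IsUnit G.discr ↔ IsCoprime G G.derivative := by
  rw [← Polynomial.isUnit_resultant_iff_isCoprime hG, hG.resultant_derivative_eq hd,
    IsUnit.mul_iff]
  exact (and_iff_right ((isUnit_one.neg).pow _)).symm

theorem Polynomial.Monic.discr_map [Nontrivial R] {S : Type*} [CommRing S] [Nontrivial S]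
    (φ : R →+* S) {G : R[X]} (hG : G.Monic) (hd : 0 < G.degree) :
    (G.map φ).discr = φ G.discr := by
  have h1 := Polynomial.resultant_deriv hd
  have h2 := Polynomial.resultant_deriv (f := G.map φ) (by rwa [hG.degree_map])
  rw [Polynomial.derivative_map, hG.natDegree_map, Polynomial.resultant_map_map, h1,
    hG.leadingCoeff, (hG.map φ).leadingCoeff] at h2
  simp only [map_mul, map_pow, map_neg, map_one, mul_one] at h2
  exact ((((isUnit_one (M := S)).neg).pow _).mul_left_cancel h2).symm

end Discriminant

namespace CurveLift

variable {p : ℕ} [Fact p.Prime] {k : Type u} [Field k] [Finite k] [CharP k p] (C : CurveLift p k)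

theorem degree_pos : 0 < C.Q.degree :=
  Polynomial.natDegree_pos_iff_degree_pos.mp C.one_le_d

/-- The discriminant is not divisible by `p`, because `𝒬` modulo `p` is separable in `y`. -/
theorem map_discr_ne_zero :
    C.Q.discr.map (WittVector.constantCoeff : Zq p k →+* k) ≠ 0 := by
  intro h0
  let φ : (Zq p k)[X] →+* RatFunc k := (algebraMap k[X] (RatFunc k)).comp
    (Polynomial.mapRingHom (WittVector.constantCoeff : Zq p k →+* k))
  have hsep := C.separable_mod
  rw [Polynomial.map_map] at hsep
  have h1 := ((C.monic.map φ).isUnit_discr_iff (by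
    rw [C.monic.degree_map]; exact C.degree_pos)).mpr hsep
  rw [C.monic.discr_map φ C.degree_pos] at h1
  refine h1.ne_zero ?_
  change algebraMap k[X] (RatFunc k) (C.Q.discr.map _) = 0
  rw [h0, map_zero]

theorem discr_ne_zero : C.Q.discr ≠ 0 := by
  intro h
  apply C.map_discr_ne_zero
  rw [h, Polynomial.map_zero]

theorem r_ne_zero : C.r ≠ 0 := by
  intro h
  apply C.discr_ne_zero
  rw [C.disc_eq, h, mul_zero]

theorem incl_r_ne_zero : C.incl C.r ≠ 0 :=
  (map_ne_zero_iff _ C.incl_injective).mpr C.r_ne_zero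

omit [Finite k] in
theorem constantCoeff_eq_zero_of_not_isUnit {a : Zq p k} (ha : ¬ IsUnit a) :
    WittVector.constantCoeff a = 0 := by
  by_contra h
  exact ha (WittVector.isUnit_of_coeff_zero_ne_zero a h)

/-- Every prime divisor `π` of the discriminant divides `r`.  As `Δ` is not divisible by `p`, `π` is not
constant, and in characteristic zero it occurs in `dΔ/dx` once less than in `Δ`. -/
theorem dvd_r_of_dvd_discr {π : (Zq p k)[X]} (hπ : Prime π) (h : π ∣ C.Q.discr) : π ∣ C.r := by
  have hdeg : π.natDegree ≠ 0 := by
    intro h0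
    obtain ⟨c, rfl⟩ := Polynomial.natDegree_eq_zero.mp h0
    obtain ⟨t, ht⟩ := h
    have hc : WittVector.constantCoeff c = 0 :=
      constantCoeff_eq_zero_of_not_isUnit fun hu => hπ.not_isUnit (Polynomial.isUnit_C.mpr hu)
    apply C.map_discr_ne_zero
    rw [ht, Polynomial.map_mul, Polynomial.map_C, hc, map_zero, zero_mul]
  by_contra hr
  obtain ⟨n, t, ht, hn⟩ := WfDvdMonoid.max_power_factor C.discr_ne_zero hπ.irreducible
  have hn0 : n ≠ 0 := by
    rintro rfl
    rw [pow_zero, one_mul] at hn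
    exact ht (hn ▸ h)
  -- if `π` did not divide `r`, its full power in `Δ` would divide `gcd(Δ, dΔ/dx)`
  have hg : π ^ n ∣ C.g := by
    refine hπ.pow_dvd_of_dvd_mul_right n hr ?_
    rw [← C.disc_eq, hn]
    exact dvd_mul_right _ _
  have h1 := ((C.isGCD _).mp hg).2
  obtain ⟨m, rfl⟩ := Nat.exists_eq_succ_of_ne_zero hn0
  rw [hn, Polynomial.derivative_mul, Polynomial.derivative_pow_succ] at h1
  have h2 := (dvd_add_left (dvd_mul_right (π ^ (m + 1)) _)).mp h1
  have h3 : π ^ m * π ∣ π ^ m * (Polynomial.C ((m : Zq p k) + 1) * Polynomial.derivative π * t) := by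
    rw [← pow_succ]
    convert h2 using 1
    ring
  have h4 := (mul_dvd_mul_iff_left (pow_ne_zero m hπ.ne_zero)).mp h3
  have h5 := (hπ.dvd_or_dvd h4).resolve_right ht
  have h6 : ((m : Zq p k) + 1) ≠ 0 := by exact_mod_cast m.succ_ne_zero
  refine Polynomial.not_dvd_of_natDegree_lt ?_ ?_ h5
  · refine mul_ne_zero (Polynomial.C_ne_zero.mpr h6) ?_
    rwa [Ne, Polynomial.derivative_eq_zero]
  · rw [Polynomial.natDegree_C_mul h6]
    exact Polynomial.natDegree_derivative_lt hdeg

theorem exists_discr_dvd_r_pow : ∃ n, C.Q.discr ∣ C.r ^ n := by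
  suffices H : ∀ a : (Zq p k)[X], a ≠ 0 → (∀ π, Prime π → π ∣ a → π ∣ C.r) → ∃ n, a ∣ C.r ^ n from
    H _ C.discr_ne_zero fun π hπ h => C.dvd_r_of_dvd_discr hπ h
  intro a
  induction a using UniqueFactorizationMonoid.induction_on_prime with
  | h₁ => exact fun h => absurd rfl h
  | h₂ a ha => exact fun _ _ => ⟨0, ha.dvd⟩
  | h₃ a π ha hπ ih =>
    intro _ h
    obtain ⟨n, hn⟩ := ih ha fun π' hπ' h' => h π' hπ' (h'.mul_left _)
    refine ⟨n + 1, ?_⟩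
    rw [pow_succ']
    exact mul_dvd_mul (h π hπ (dvd_mul_right _ _)) hn

theorem isUnit_leadingCoeff_discr (hr : IsUnit C.r.leadingCoeff) :
    IsUnit C.Q.discr.leadingCoeff := by
  obtain ⟨n, t, ht⟩ := C.exists_discr_dvd_r_pow
  have h1 := congrArg Polynomial.leadingCoeff ht
  rw [Polynomial.leadingCoeff_mul, Polynomial.leadingCoeff_pow] at h1
  exact isUnit_of_mul_isUnit_left (h1 ▸ hr.pow n)

/-- The discriminant is a multiple of `∂𝒬/∂y` in `𝒜`. -/
theorem exists_Qy_mul_eq_discr : ∃ V, C.Qy * C.ev V = C.incl C.Q.discr := by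
  obtain ⟨U, V, -, -, h⟩ := Polynomial.exists_mul_add_mul_eq_C_resultant C.Q C.Q.derivative
    le_rfl le_rfl (Or.inl (by have := C.one_le_d; change C.d ≠ 0; omega))
  have h1 := congrArg C.ev h
  rw [map_add, map_mul, map_mul, ev_Q, zero_mul, zero_add,
    C.monic.resultant_derivative_eq C.degree_pos] at h1
  refine ⟨V * (-1) ^ (C.Q.natDegree * (C.Q.natDegree - 1) / 2), ?_⟩
  have h2 : ∀ g, C.ev (Polynomial.C g) = C.incl g := fun g => by simp [ev_eq_eval₂]
  rw [h2] at h1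
  rw [map_mul, ← mul_assoc]
  change C.ev C.Q.derivative * C.ev V * _ = _
  rw [h1, map_mul]
  simp only [map_pow, map_neg, map_one]
  rw [mul_right_comm, ← mul_pow]
  simp

end CurveLift

/-! ### The leading coefficient of `r` -/

/-- Let `B = O[X] / I` be unramified over `O`, with the vanishing locus of `I` containing that of
`X * ρ`.  Then the sections `X = 0` and `ρ = 0` are disjoint. -/
theorem Algebra.FormallyUnramified.isUnit_coeff_zero {O : Type u} [CommRing O] [IsDomain O]
    [UniqueFactorizationMonoid O] {B : Type u} [CommRing B] [Algebra O B]
    [Algebra.FormallyUnramified O B] (π : O[X] →ₐ[O] B) (hπ : Function.Surjective π) (ρ : O[X])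
    (hV : ∀ q : Ideal O[X], q.IsPrime → Polynomial.X * ρ ∈ q → RingHom.ker π ≤ q)
    (hρ : ρ.coeff 0 ≠ 0) : IsUnit (ρ.coeff 0) := by
  classical
  -- the section `X = 0` is an isolated point of `Spec B` relatively to `O`
  have hker0 : ∀ f ∈ RingHom.ker π, f.coeff 0 = 0 := by
    intro f hf
    have h1 := hV (Ideal.span {Polynomial.X})
      ((Ideal.span_singleton_prime Polynomial.X_ne_zero).mpr Polynomial.prime_X)
      (Ideal.mul_mem_right _ _ (Ideal.mem_span_singleton_self _)) hf
    rw [Ideal.mem_span_singleton] at h1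
    exact Polynomial.X_dvd_iff.mp h1
  obtain ⟨c, hc⟩ : ∃ c : O[X], Polynomial.X * (1 - Polynomial.X * c) ∈ RingHom.ker π := by
    let σ : B →ₐ[O] O := AlgHom.comp
      (Ideal.Quotient.liftₐ (RingHom.ker π) (Polynomial.aeval (0 : O)) (by
        intro f hf
        rw [← Polynomial.coeff_zero_eq_aeval_zero]
        exact hker0 f hf))
      (Ideal.quotientKerAlgEquivOfSurjective hπ).symm.toAlgHom
    have hσ : ∀ f, σ (π f) = f.coeff 0 := by
      intro f
      have : (Ideal.quotientKerAlgEquivOfSurjective hπ).symm (π f) = Ideal.Quotient.mk _ f := by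
        rw [AlgEquiv.symm_apply_eq]
        rfl
      simp only [σ, AlgHom.comp_apply]
      erw [this]
      simp [Polynomial.coeff_zero_eq_aeval_zero]
    let J : Ideal B := Ideal.span {π Polynomial.X ^ 2}
    let I : Ideal (B ⧸ J) := Ideal.span {Ideal.Quotient.mk J (π Polynomial.X)}
    have hI : I ^ 2 = ⊥ := by
      rw [Ideal.span_singleton_pow, Ideal.span_singleton_eq_bot, ← map_pow,
        Ideal.Quotient.eq_zero_iff_mem]
      exact Ideal.mem_span_singleton_self _
    -- two lifts of the section along a square-zero thickening agree
    have key : Ideal.Quotient.mkₐ O J = (Algebra.ofId O (B ⧸ J)).comp σ := by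
      apply Algebra.FormallyUnramified.ext I ⟨2, hI⟩
      intro b
      obtain ⟨f, rfl⟩ := hπ b
      rw [Ideal.Quotient.eq, AlgHom.comp_apply, hσ]
      have h2 : f = Polynomial.X * f.divX + Polynomial.C (f.coeff 0) :=
        (Polynomial.X_mul_divX_add f).symm
      rw [Ideal.mem_span_singleton]
      refine ⟨Ideal.Quotient.mk J (π f.divX), ?_⟩
      rw [← map_mul, ← map_mul]
      nth_rewrite 1 [h2]
      have h3 : π (Polynomial.C (f.coeff 0)) = algebraMap O B (f.coeff 0) := π.commutes _
      rw [map_add, h3, Ideal.Quotient.mkₐ_eq_mk, map_add, Algebra.ofId_apply,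
        IsScalarTower.algebraMap_apply O B (B ⧸ J)]
      simp
    have h1 := DFunLike.congr_fun key (π Polynomial.X)
    rw [AlgHom.comp_apply, hσ, Polynomial.coeff_X_zero, map_zero, Ideal.Quotient.mkₐ_eq_mk,
      Ideal.Quotient.eq_zero_iff_mem, Ideal.mem_span_singleton] at h1
    obtain ⟨b, hb⟩ := h1
    obtain ⟨c, rfl⟩ := hπ b
    refine ⟨c, ?_⟩
    rw [RingHom.mem_ker, mul_sub, map_sub, mul_one, hb]
    simp only [map_mul]
    ring
  -- a prime factor of `ρ` cannot meet the section `X = 0`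
  have hρ0 : ρ ≠ 0 := by rintro rfl; simp at hρ
  obtain ⟨g, hg, hprod⟩ := UniqueFactorizationMonoid.exists_prime_factors ρ hρ0
  have hunit : ∀ h ∈ g, IsUnit (h.coeff 0) := by
    intro h hh
    have hdvd : h ∣ ρ := (Multiset.dvd_prod hh).trans hprod.dvd
    have h1 := hV (Ideal.span {h}) ((Ideal.span_singleton_prime (hg h hh).ne_zero).mpr (hg h hh))
      (Ideal.mul_mem_left _ _ (Ideal.mem_span_singleton.mpr hdvd)) hc
    rw [Ideal.mem_span_singleton] at h1
    rcases (hg h hh).dvd_or_dvd h1 with h2 | h2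
    · have h3 : Polynomial.X ∣ h :=
        ((hg h hh).irreducible.dvd_symm Polynomial.irreducible_X h2)
      exact absurd (Polynomial.X_dvd_iff.mp (h3.trans hdvd)) hρ
    · obtain ⟨e, he⟩ := h2
      have := congr_arg (fun f => Polynomial.coeff f 0) he
      simp only [Polynomial.coeff_sub, Polynomial.coeff_one_zero, Polynomial.mul_coeff_zero,
        Polynomial.coeff_X_zero, zero_mul, sub_zero] at this
      exact IsUnit.of_mul_eq_one _ this.symm
  have h2 : IsUnit (g.prod.coeff 0) := by
    rw [Polynomial.coeff_zero_eq_eval_zero, Polynomial.eval_multiset_prod]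
    clear hprod hg
    induction g using Multiset.induction_on with
    | empty => simp
    | cons a s ih =>
      rw [Multiset.map_cons, Multiset.prod_cons]
      refine IsUnit.mul ?_ (ih fun h hh => hunit h (Multiset.mem_cons_of_mem hh))
      rw [← Polynomial.coeff_zero_eq_eval_zero]
      exact hunit a (Multiset.mem_cons_self _ _)
  obtain ⟨v, hv⟩ := hprod
  rw [← hv, Polynomial.mul_coeff_zero]
  refine h2.mul ?_
  have := v.isUnit.map (Polynomial.constantCoeff (R := O))
  simpa using this

section ProjectiveLine

attribute [local instance] MvPolynomial.gradedAlgebra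

open HomogeneousLocalization

variable (O : Type u) [CommRing O]

/-- The coordinate ring of the chart `X₀ ≠ 0` of the projective line, which contains `x = ∞`. -/
abbrev InftyChart : Type u := Away (MvPolynomial.homogeneousSubmodule (Fin 2) O) (MvPolynomial.X 0)

theorem X_mem_homogeneousSubmodule (i : Fin 2) :
    (MvPolynomial.X i : MvPolynomial (Fin 2) O) ∈ MvPolynomial.homogeneousSubmodule (Fin 2) O 1 :=
  MvPolynomial.isHomogeneous_X _ _

/-- The structure map of the chart at infinity. -/
noncomputable def InftyChart.structureMap : O →+* InftyChart O :=
  (fromZeroRingHom (MvPolynomial.homogeneousSubmodule (Fin 2) O) _).comp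
    (algebraMap O (MvPolynomial.homogeneousSubmodule (Fin 2) O 0))

/-- Dehomogenisation `X₀ ↦ 1`, `X₁ ↦ X` of the chart at infinity. -/
noncomputable def InftyChart.toPolynomial : InftyChart O →+* O[X] :=
  (IsLocalization.Away.lift (S := Localization.Away (MvPolynomial.X 0 : MvPolynomial (Fin 2) O))
    (MvPolynomial.X 0) (g := (MvPolynomial.aeval ![1, Polynomial.X] :
      MvPolynomial (Fin 2) O →ₐ[O] O[X]).toRingHom) (by simp)).comp
    (algebraMap (InftyChart O) (Localization.Away (MvPolynomial.X 0 : MvPolynomial (Fin 2) O)))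

theorem InftyChart.toPolynomial_mk (n : ℕ) (a : MvPolynomial (Fin 2) O) (ha) :
    InftyChart.toPolynomial O
      (Away.mk (MvPolynomial.homogeneousSubmodule (Fin 2) O) (X_mem_homogeneousSubmodule O 0) n a ha)
      = MvPolynomial.aeval ![1, Polynomial.X] a := by
  rw [toPolynomial, RingHom.comp_apply, HomogeneousLocalization.algebraMap_apply, Away.val_mk,
    Localization.mk_eq_mk']
  simp only [IsLocalization.Away.lift]
  rw [IsLocalization.lift_mk'_spec]
  simp

/-- The coordinate `s = X₁ / X₀`. -/
noncomputable def InftyChart.s : InftyChart O :=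
  Away.mk (MvPolynomial.homogeneousSubmodule (Fin 2) O) (X_mem_homogeneousSubmodule O 0) 1
    (MvPolynomial.X 1) (by simpa using X_mem_homogeneousSubmodule O 1)

theorem InftyChart.val_structureMap (c : O) :
    (InftyChart.structureMap O c).val =
      algebraMap (MvPolynomial (Fin 2) O) _ (MvPolynomial.C c) := by
  rfl

theorem MvPolynomial.IsHomogeneous.aeval_mul {σ R S : Type*} [CommRing R] [CommRing S]
    (φ : R →+* S) {F : MvPolynomial σ R} {n : ℕ} (hF : F.IsHomogeneous n) (c : S) (g : σ → S) :
    MvPolynomial.eval₂ φ (fun i => c * g i) F = c ^ n * MvPolynomial.eval₂ φ g F := by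
  rw [MvPolynomial.eval₂_eq, MvPolynomial.eval₂_eq, Finset.mul_sum]
  refine Finset.sum_congr rfl fun d hd => ?_
  have h1 := hF (MvPolynomial.mem_support_iff.mp hd)
  simp_rw [mul_pow]
  rw [Finset.prod_mul_distrib, Finset.prod_pow_eq_pow_sum]
  have h2 : ∑ i ∈ d.support, d i = n := by
    rw [← h1, Finsupp.weight_apply, Finsupp.sum]
    simp
  rw [h2]
  ring

theorem Polynomial.aeval_homogenize_one_X {R : Type*} [CommRing R] (f : R[X]) {n : ℕ}
    (hn : f.natDegree ≤ n) :
    MvPolynomial.aeval ![1, Polynomial.X] (f.homogenize n) = f.reflect n := by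
  apply Polynomial.induction_with_natDegree_le
    (fun f => MvPolynomial.aeval ![1, Polynomial.X] (f.homogenize n) = f.reflect n) (N := n)
  · simp
  · intro i a _ hi
    simp [hi, Polynomial.revAt_le hi]
  · intro f g _ _ hf hg
    simp [hf, hg, Polynomial.reflect_add]
  · exact hn

theorem InftyChart.eval₂_toPolynomial (z : InftyChart O) :
    (InftyChart.toPolynomial O z).eval₂ (InftyChart.structureMap O) (InftyChart.s O) = z := by
  obtain ⟨n, a, ha, rfl⟩ :=
    Away.mk_surjective (MvPolynomial.homogeneousSubmodule (Fin 2) O) (X_mem_homogeneousSubmodule O 0) z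
  rw [InftyChart.toPolynomial_mk]
  apply HomogeneousLocalization.val_injective
  rw [← HomogeneousLocalization.algebraMap_apply, Polynomial.hom_eval₂, Away.val_mk]
  rw [Localization.mk_eq_mk', IsLocalization.eq_mk'_iff_mul_eq]
  set Λ := algebraMap (MvPolynomial (Fin 2) O)
    (Localization.Away (MvPolynomial.X 0 : MvPolynomial (Fin 2) O)) with hΛ
  set σ := algebraMap (InftyChart O)
    (Localization.Away (MvPolynomial.X 0 : MvPolynomial (Fin 2) O)) (InftyChart.s O) with hσ
  have hs : Λ (MvPolynomial.X 0) * σ = Λ (MvPolynomial.X 1) := by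
    rw [hσ, HomogeneousLocalization.algebraMap_apply, InftyChart.s, Away.val_mk,
      Localization.mk_eq_mk', mul_comm]
    have h := IsLocalization.mk'_spec (M := Submonoid.powers (MvPolynomial.X 0 : MvPolynomial (Fin 2) O))
      (Localization.Away (MvPolynomial.X 0 : MvPolynomial (Fin 2) O)) (MvPolynomial.X 1)
      ⟨MvPolynomial.X 0 ^ 1, ⟨1, rfl⟩⟩
    rw [← h, hΛ]
    simp only [pow_one]
  have h1 : a.IsHomogeneous n := by simpa using ha
  have h2 := h1.aeval_mul (Λ.comp MvPolynomial.C) (Λ (MvPolynomial.X 0)) ![1, σ]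
  have h3 : MvPolynomial.eval₂ (Λ.comp MvPolynomial.C)
      (fun i => Λ (MvPolynomial.X 0) * ![1, σ] i) a = Λ a := by
    have : (fun i => Λ (MvPolynomial.X 0) * ![1, σ] i) = fun i => Λ (MvPolynomial.X i) := by
      funext i; fin_cases i
      · simp
      · simpa using hs
    rw [this, ← MvPolynomial.hom_eval₂, MvPolynomial.eval₂_eta]
  rw [h3] at h2
  rw [h2, mul_comm, map_pow]
  congr 1
  rw [MvPolynomial.aeval_def, ← Polynomial.coe_eval₂RingHom, MvPolynomial.hom_eval₂]
  congr 1
  · ext c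
    simp [InftyChart.val_structureMap, hΛ]
  · funext i; fin_cases i <;> simp

theorem InftyChart.toPolynomial_structureMap (c : O) :
    InftyChart.toPolynomial O (InftyChart.structureMap O c) = Polynomial.C c := by
  rw [toPolynomial, RingHom.comp_apply, HomogeneousLocalization.algebraMap_apply,
    InftyChart.val_structureMap, IsLocalization.Away.lift_eq]
  simp

theorem InftyChart.toPolynomial_isLocalizationElem (f : O[X]) :
    InftyChart.toPolynomial O (Away.isLocalizationElem (X_mem_homogeneousSubmodule O 0)
      (g := MvPolynomial.X 1 * f.homogenize f.natDegree) (e := f.natDegree + 1)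
      (by rw [add_comm]; exact (MvPolynomial.isHomogeneous_X _ _).mul f.isHomogeneous_homogenize)) =
    Polynomial.X * f.reverse := by
  rw [Away.isLocalizationElem, InftyChart.toPolynomial_mk, pow_one, map_mul,
    MvPolynomial.aeval_X]
  simp only [Matrix.cons_val_one, Matrix.cons_val_zero]
  congr 1
  exact f.aeval_homogenize_one_X le_rfl

/-- The chart at infinity as an open subscheme of the projective line. -/
noncomputable def InftyChart.ι : Spec (CommRingCat.of (InftyChart O)) ⟶ ProjLine O :=
  Proj.awayι (MvPolynomial.homogeneousSubmodule (Fin 2) O) (MvPolynomial.X 0)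
    (X_mem_homogeneousSubmodule O 0) one_pos

instance : IsOpenImmersion (InftyChart.ι O) :=
  inferInstanceAs (IsOpenImmersion (Proj.awayι (MvPolynomial.homogeneousSubmodule (Fin 2) O)
    (MvPolynomial.X 0) (X_mem_homogeneousSubmodule O 0) one_pos))

theorem InftyChart.ι_comp_projLineStr :
    InftyChart.ι O ≫ projLineStr O =
      Spec.map (CommRingCat.ofHom (InftyChart.structureMap O)) :=
  (Proj.awayι_toSpecZero_assoc (MvPolynomial.homogeneousSubmodule (Fin 2) O) _
    (X_mem_homogeneousSubmodule O 0) one_pos _).trans (Spec.map_comp _ _).symm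

theorem InftyChart.mem_projLineOpen_iff (f : O[X]) (P : PrimeSpectrum (InftyChart O)) :
    InftyChart.ι O P ∈ projLineOpen f ↔ Away.isLocalizationElem (X_mem_homogeneousSubmodule O 0)
      (g := MvPolynomial.X 1 * f.homogenize f.natDegree) (e := f.natDegree + 1)
      (by rw [add_comm]; exact (MvPolynomial.isHomogeneous_X _ _).mul f.isHomogeneous_homogenize) ∉
      P.asIdeal := by
  have h5 := Proj.awayι_preimage_basicOpen (MvPolynomial.homogeneousSubmodule (Fin 2) O)
    (X_mem_homogeneousSubmodule O 0) one_pos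
    (g := MvPolynomial.X 1 * f.homogenize f.natDegree) (m' := f.natDegree + 1)
    (by rw [add_comm]; exact (MvPolynomial.isHomogeneous_X _ _).mul f.isHomogeneous_homogenize)
    (Nat.succ_pos _)
  exact Iff.of_eq (congrArg (fun U : (Spec (CommRingCat.of (InftyChart O))).Opens => P ∈ U) h5)

/-- The complement of `Spec O[x, 1/f]` in the projective line consists of the section `x = ∞` and the closure
of `f = 0`.  If it is unramified over `O`, the two are disjoint, which means that the leading coefficient
of `f` is a unit. -/
theorem isUnit_leadingCoeff_of_formallyUnramified [IsDomain O] [UniqueFactorizationMonoid O]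
    (f : O[X]) (hf : f ≠ 0) {D : Scheme.{u}} (i : D ⟶ ProjLine O) [IsClosedImmersion i]
    [FormallyUnramified (i ≫ projLineStr O)]
    (hD : (projLineOpen f : Set (ProjLine O)) = (Set.range i)ᶜ) : IsUnit f.leadingCoeff := by
  obtain ⟨I, e, he⟩ := IsClosedImmersion.Spec_iff.mp
    (inferInstance : IsClosedImmersion (Limits.pullback.snd i (InftyChart.ι O)))
  -- the divisor is unramified on the chart
  have h0 : FormallyUnramified (Limits.pullback.fst i (InftyChart.ι O)) := inferInstance
  have h1 : FormallyUnramified (e.inv ≫ Limits.pullback.fst i (InftyChart.ι O) ≫ i ≫ projLineStr O) :=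
    MorphismProperty.comp_mem _ _ _ (inferInstance : FormallyUnramified e.inv)
      (MorphismProperty.comp_mem _ _ _ h0 ‹_›)
  have h2 : e.inv ≫ Limits.pullback.fst i (InftyChart.ι O) ≫ i ≫ projLineStr O =
      Spec.map (CommRingCat.ofHom ((Ideal.Quotient.mk I).comp (InftyChart.structureMap O))) := by
    rw [Limits.pullback.condition_assoc, he, Category.assoc, e.inv_hom_id_assoc, InftyChart.ι_comp_projLineStr,
      ← Spec.map_comp]
    rfl
  rw [h2, HasRingHomProperty.Spec_iff (P := @FormallyUnramified)] at h1
  let φ := (Ideal.Quotient.mk I).comp (InftyChart.structureMap O)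
  let _ : Algebra O (InftyChart O ⧸ I) := φ.toAlgebra
  have h3 : Algebra.FormallyUnramified O (InftyChart O ⧸ I) := h1
  let π : O[X] →ₐ[O] (InftyChart O ⧸ I) :=
    Polynomial.aeval (Ideal.Quotient.mk I (InftyChart.s O))
  have hπ : ∀ g : O[X], π g = Ideal.Quotient.mk I
      (g.eval₂ (InftyChart.structureMap O) (InftyChart.s O)) := by
    intro g
    rw [Polynomial.hom_eval₂]
    rfl
  have key := Algebra.FormallyUnramified.isUnit_coeff_zero π ?_ f.reverse ?_ ?_
  · rwa [Polynomial.coeff_zero_reverse] at key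
  · intro b
    obtain ⟨z, rfl⟩ := Ideal.Quotient.mk_surjective b
    refine ⟨InftyChart.toPolynomial O z, ?_⟩
    rw [hπ, InftyChart.eval₂_toPolynomial]
  · intro q hq hmem g hg
    rw [RingHom.mem_ker, hπ, Ideal.Quotient.eq_zero_iff_mem] at hg
    let P : PrimeSpectrum (InftyChart O) :=
      ⟨q.comap (InftyChart.toPolynomial O), Ideal.comap_isPrime _ _⟩
    have hP : P ∈ Set.range (Limits.pullback.snd i (InftyChart.ι O)) := by
      rw [Scheme.Pullback.range_snd]
      change InftyChart.ι O P ∈ Set.range i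
      rw [← Set.notMem_compl_iff, ← hD]
      intro hmem'
      apply (InftyChart.mem_projLineOpen_iff O f P).mp hmem'
      change InftyChart.toPolynomial O _ ∈ q
      rw [InftyChart.toPolynomial_isLocalizationElem]
      exact hmem
    rw [he] at hP
    obtain ⟨z, hz⟩ := hP
    have h6 : I ≤ P.asIdeal := by
      rw [← hz]
      intro t ht
      change Ideal.Quotient.mk I t ∈ (e.hom z).asIdeal
      rw [Ideal.Quotient.eq_zero_iff_mem.mpr ht]
      exact zero_mem _
    have h7 : InftyChart.toPolynomial O
      (g.eval₂ (InftyChart.structureMap O) (InftyChart.s O)) ∈ q := h6 hg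
    rw [Polynomial.hom_eval₂] at h7
    have h8 : (InftyChart.toPolynomial O).comp (InftyChart.structureMap O) = Polynomial.C := by
      ext1 c
      exact InftyChart.toPolynomial_structureMap O c
    have h9 : InftyChart.toPolynomial O (InftyChart.s O) = Polynomial.X := by
      rw [InftyChart.s, InftyChart.toPolynomial_mk]
      simp
    rwa [h8, h9, Polynomial.eval₂_C_X] at h7
  · rwa [Polynomial.coeff_zero_reverse, Polynomial.leadingCoeff_ne_zero]

end ProjectiveLine

namespace CurveLift

variable {p : ℕ} [Fact p.Prime] {k : Type u} [Field k] [Finite k] [CharP k p] (C : CurveLift p k)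

/-- The only consequence of the good lift assumption which the reduction at infinity needs. -/
theorem GoodLift.isUnit_leadingCoeff (h : C.GoodLift) : IsUnit C.r.leadingCoeff := by
  obtain ⟨-, D, i, h1, h2, h3⟩ := h
  exact isUnit_leadingCoeff_of_formallyUnramified _ C.r C.r_ne_zero i h3

end CurveLift

/-! ### Smooth plane curves and Dedekind domains -/

section PlaneCurve

theorem Ideal.mul_eq_zero_of_mem_map_mk_sq {A : Type*} [CommRing A] (I : Ideal A) {u v : A ⧸ I ^ 2}
    (hu : u ∈ I.map (Ideal.Quotient.mk (I ^ 2))) (hv : v ∈ I.map (Ideal.Quotient.mk (I ^ 2))) :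
    u * v = 0 := by
  have h := Ideal.mul_mem_mul hu hv
  rwa [← sq, ← Ideal.map_pow, Ideal.map_quotient_self] at h

theorem Ideal.exists_eq_mk_mul_of_mem_map_mk {A : Type*} [CommRing A] (I : Ideal A) (a : A)
    {z : A ⧸ I} (hz : z ∈ (Ideal.span {a}).map (Ideal.Quotient.mk I)) :
    ∃ f, z = Ideal.Quotient.mk I (a * f) := by
  rw [Ideal.map_span, Set.image_singleton, Ideal.mem_span_singleton] at hz
  obtain ⟨c, rfl⟩ := hz
  obtain ⟨c, rfl⟩ := Ideal.Quotient.mk_surjective c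
  exact ⟨c, (map_mul _ _ _).symm⟩

/-- If `A / I` is formally smooth, then `A / I² → A / I` has a section `A / I → A / I²`, here composed
with `A → A / I`. -/
theorem Algebra.FormallySmooth.exists_section_quotient_sq (K : Type*) {A : Type*} [CommRing K]
    [CommRing A] [Algebra K A] (I : Ideal A) [Algebra.FormallySmooth K (A ⧸ I)] :
    ∃ τ : A →ₐ[K] A ⧸ I ^ 2, (∀ f ∈ I, τ f = 0) ∧
      ∀ f, τ f - Ideal.Quotient.mkₐ K (I ^ 2) f ∈ I.map (Ideal.Quotient.mk (I ^ 2)) := by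
  let J : Ideal (A ⧸ I ^ 2) := I.map (Ideal.Quotient.mk (I ^ 2))
  have hJ2 : J ^ 2 = ⊥ := by
    rw [← Ideal.map_pow, Ideal.map_quotient_self]
  let e : (A ⧸ I) →ₐ[K] ((A ⧸ I ^ 2) ⧸ J) := Ideal.Quotient.liftₐ I
    ((Ideal.Quotient.mkₐ K J).comp (Ideal.Quotient.mkₐ K (I ^ 2))) (by
      intro a ha
      rw [AlgHom.comp_apply, Ideal.Quotient.mkₐ_eq_mk, Ideal.Quotient.mkₐ_eq_mk,
        Ideal.Quotient.eq_zero_iff_mem]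
      exact Ideal.mem_map_of_mem _ ha)
  obtain ⟨σ, hσ⟩ := Algebra.FormallySmooth.exists_lift (R := K) J ⟨2, hJ2⟩ e
  refine ⟨σ.comp (Ideal.Quotient.mkₐ K I), fun f hf => ?_, fun f => ?_⟩
  · rw [AlgHom.comp_apply, Ideal.Quotient.mkₐ_eq_mk, Ideal.Quotient.eq_zero_iff_mem.mpr hf, map_zero]
  · rw [← Ideal.Quotient.eq_zero_iff_mem (I := I.map (Ideal.Quotient.mk (I ^ 2))), map_sub, sub_eq_zero]
    exact DFunLike.congr_fun hσ (Ideal.Quotient.mk I f)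

variable {K A : Type*} [Field K] [CharZero K] [CommRing A] [Algebra K A]

/-- The points of a smooth plane curve have a local parameter: if `G(x, y) = 0` and the partial
derivatives of `G` generate the unit ideal, then `P / P²` has dimension at most one. With `F = A / P`,
there is a section of `A / P² → F`, so that `P / P²` is spanned by the differences `a`, `b` of `x`,
`y` with the images of their residue classes, and `Gx a + Gy b = 0`. -/
theorem Ideal.exists_eq_span_singleton_sup_sq (x y : A) (hxy : Algebra.adjoin K {x, y} = ⊤)
    (G : K[X][X]) (hG : G.eval₂ (Polynomial.eval₂RingHom (algebraMap K A) x) y = 0)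
    (α β : A)
    (h1 : α * G.coeffDeriv.eval₂ (Polynomial.eval₂RingHom (algebraMap K A) x) y +
      β * G.derivative.eval₂ (Polynomial.eval₂RingHom (algebraMap K A) x) y = 1)
    (P : Ideal A) [hP : P.IsMaximal] : ∃ t ∈ P, P ≤ Ideal.span {t} ⊔ P ^ 2 := by
  classical
  have hft : Algebra.FiniteType K A := ⟨⟨{x, y}, by simpa using hxy⟩⟩
  let _ : Field (A ⧸ P) := Ideal.Quotient.field P
  have hfin : Module.Finite K (A ⧸ P) := finite_of_finite_type_of_isJacobsonRing K (A ⧸ P)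
  have het : Algebra.FormallyEtale K (A ⧸ P) := Algebra.FormallyEtale.of_isSeparable K (A ⧸ P)
  let B := A ⧸ P ^ 2
  let J : Ideal B := P.map (Ideal.Quotient.mk (P ^ 2))
  have hJmem : ∀ a, Ideal.Quotient.mk (P ^ 2) a ∈ J ↔ a ∈ P := by
    intro a
    rw [← Ideal.mem_comap, Ideal.comap_map_of_surjective _ Ideal.Quotient.mk_surjective,
      ← RingHom.ker_eq_comap_bot, Ideal.mk_ker, sup_eq_left.mpr (Ideal.pow_le_self two_ne_zero)]
  let ρ : A →ₐ[K] B := Ideal.Quotient.mkₐ K (P ^ 2)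
  obtain ⟨τ, hτP, hτ⟩ := Algebra.FormallySmooth.exists_section_quotient_sq K P
  have hρτ : ∀ f, ρ f - τ f ∈ J := fun f => by
    rw [← neg_sub]
    exact neg_mem (hτ f)
  have hJJ : ∀ u ∈ J, ∀ v ∈ J, u * v = 0 := fun u hu v hv => P.mul_eq_zero_of_mem_map_mk_sq hu hv
  let a := ρ x - τ x
  let b := ρ y - τ y
  have ha : a ∈ J := hρτ x
  have hb : b ∈ J := hρτ y
  have hspan : ∀ f : A, ρ f - τ f ∈ Ideal.span {a, b} := by
    intro f
    have hf : f ∈ Algebra.adjoin K {x, y} := hxy ▸ Algebra.mem_top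
    induction hf using Algebra.adjoin_induction with
    | mem f hf =>
      rcases hf with rfl | rfl
      · exact Ideal.subset_span (by simp [a])
      · exact Ideal.subset_span (by simp [b])
    | algebraMap c =>
      rw [ρ.commutes, τ.commutes, sub_self]
      exact zero_mem _
    | add f g _ _ hf hg =>
      rw [map_add, map_add, add_sub_add_comm]
      exact add_mem hf hg
    | mul f g _ _ hf hg =>
      have : ρ (f * g) - τ (f * g) = ρ f * (ρ g - τ g) + τ g * (ρ f - τ f) := by
        rw [map_mul, map_mul]; ring
      rw [this]
      exact add_mem (Ideal.mul_mem_left _ _ hg) (Ideal.mul_mem_left _ _ hf)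
  -- the linear relation between `a` and `b`
  have hev : ∀ (φ : A →ₐ[K] B) (H : K[X][X]),
      φ (H.eval₂ (Polynomial.eval₂RingHom (algebraMap K A) x) y) =
        H.eval₂ (Polynomial.eval₂RingHom (algebraMap K B) (φ x)) (φ y) := by
    intro φ H
    have := Polynomial.hom_eval₂ H (Polynomial.eval₂RingHom (algebraMap K A) x) φ.toRingHom y
    refine this.trans ?_
    congr 1
    apply Polynomial.ringHom_ext
    · intro c; simp
    · simp
  have htaylor := Polynomial.eval₂_eval₂_add_of_mul_eq_zero (algebraMap K B) (ρ x) (ρ y)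
    (-a) (-b) (by rw [neg_mul_neg]; exact hJJ a ha a ha) (by rw [neg_mul_neg]; exact hJJ a ha b hb)
    (by rw [neg_mul_neg]; exact hJJ b hb b hb) G
  rw [show ρ x + -a = τ x by simp only [a]; ring, show ρ y + -b = τ y by simp only [b]; ring,
    ← hev, ← hev, ← hev, ← hev, hG, map_zero, map_zero, zero_add] at htaylor
  set gx := G.coeffDeriv.eval₂ (Polynomial.eval₂RingHom (algebraMap K A) x) y
  set gy := G.derivative.eval₂ (Polynomial.eval₂RingHom (algebraMap K A) x) y
  have hrel : ρ gx * a + ρ gy * b = 0 := by linear_combination htaylor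
  have hunit : ρ α * ρ gx + ρ β * ρ gy = 1 := by
    rw [← map_mul, ← map_mul, ← map_add, h1, map_one]
  -- `P / P²` is spanned by a single element
  obtain ⟨ε, hε, hspan'⟩ : ∃ ε ∈ J, Ideal.span {a, b} ≤ Ideal.span {ε} := by
    refine ⟨ρ β * a - ρ α * b, sub_mem (Ideal.mul_mem_left _ _ ha) (Ideal.mul_mem_left _ _ hb), ?_⟩
    rw [Ideal.span_le]
    rintro z (rfl | rfl)
    · exact Ideal.mem_span_singleton.mpr ⟨ρ gy, by linear_combination ρ α * hrel - a * hunit⟩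
    · exact Ideal.mem_span_singleton.mpr ⟨-ρ gx, by linear_combination ρ β * hrel - b * hunit⟩
  obtain ⟨t, rfl⟩ := Ideal.Quotient.mk_surjective ε
  refine ⟨t, (hJmem t).mp hε, fun f hf => ?_⟩
  have hf1 := hspan' (hspan f)
  rw [hτP f hf, sub_zero, Ideal.mem_span_singleton] at hf1
  obtain ⟨c, hc⟩ := hf1
  obtain ⟨c, rfl⟩ := Ideal.Quotient.mk_surjective c
  have hmem : f - t * c ∈ P ^ 2 := by
    rw [← Ideal.Quotient.eq_zero_iff_mem, map_sub, map_mul, sub_eq_zero]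
    exact hc
  rw [← sub_add_cancel f (t * c), add_comm]
  exact Submodule.add_mem_sup (Ideal.mem_span_singleton.mpr ⟨c, rfl⟩) hmem

/-- A Noetherian domain of dimension at most one all of whose points have a local parameter is a
Dedekind domain. -/
theorem IsDedekindDomain.of_forall_exists_eq_span_singleton_sup_sq {A : Type*} [CommRing A] [IsDomain A]
    [IsNoetherianRing A] [Ring.DimensionLEOne A]
    (h : ∀ P : Ideal A, P.IsMaximal → ∃ t ∈ P, P ≤ Ideal.span {t} ⊔ P ^ 2) :
    IsDedekindDomain A := by
  have : IsDedekindDomainDvr A := by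
    constructor
    intro P hP0 hP
    have hPmax : P.IsMaximal := Ring.DimensionLEOne.maximalOfPrime hP0 hP
    obtain ⟨t, ht, hPt⟩ := h P hPmax
    have hnf : ¬ IsField (Localization.AtPrime P) := IsLocalization.AtPrime.not_isField A hP0 _
    refine ((IsDiscreteValuationRing.TFAE (Localization.AtPrime P) hnf).out 0 4).mpr ?_
    obtain ⟨r, hr1, hr⟩ := Submodule.exists_sub_one_mem_and_smul_le_of_fg_of_le_sup
      (I := P) (N := Ideal.span {t}) (N' := P) (P := P) (IsNoetherian.noetherian P) le_rfl
      (by rwa [smul_eq_mul, ← sq])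
    have hrP : r ∉ P := fun hr' => hPmax.ne_top
      ((Ideal.eq_top_iff_one P).mpr (by simpa using sub_mem hr' hr1))
    refine ⟨algebraMap A _ t, le_antisymm ?_ ?_⟩
    · rw [← Localization.AtPrime.map_eq_maximalIdeal, Ideal.map_le_iff_le_comap]
      intro a ha
      have h2 : r * a ∈ Ideal.span {t} := hr (Submodule.smul_mem_pointwise_smul a r P ha)
      obtain ⟨c, hc⟩ := Ideal.mem_span_singleton.mp h2
      have hu : IsUnit (algebraMap A (Localization.AtPrime P) r) :=
        IsLocalization.map_units (M := P.primeCompl) _ ⟨r, hrP⟩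
      rw [Ideal.mem_comap]
      refine (Ideal.unit_mul_mem_iff_mem _ hu).mp ?_
      rw [← map_mul, hc, map_mul]
      exact Ideal.mul_mem_right _ _ (Ideal.mem_span_singleton_self _)
    · rw [← Localization.AtPrime.map_eq_maximalIdeal]
      exact (Ideal.span_singleton_le_iff_mem _).mpr (Ideal.mem_map_of_mem _ ht)
  infer_instance

/-- A homomorphism out of `K[x][y]` is evaluation. -/
theorem Polynomial.eval₂_eval₂RingHom_eq {K B : Type*} [CommRing K] [CommRing B] [Algebra K B]
    (φ : K[X][X] →ₐ[K] B) (H : K[X][X]) :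
    H.eval₂ (Polynomial.eval₂RingHom (algebraMap K B) (φ (Polynomial.C Polynomial.X)))
        (φ Polynomial.X) = φ H := by
  have h1 : Polynomial.eval₂RingHom (Polynomial.eval₂RingHom (algebraMap K B)
      (φ (Polynomial.C Polynomial.X))) (φ Polynomial.X) = φ.toRingHom := by
    apply Polynomial.ringHom_ext
    · intro a
      have h2 : Polynomial.eval₂RingHom (algebraMap K B) (φ (Polynomial.C Polynomial.X)) =
          φ.toRingHom.comp Polynomial.C := by
        apply Polynomial.ringHom_ext
        · intro c
          have := φ.commutes c
          simpa using this.symm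
        · simp
      simpa using DFunLike.congr_fun h2 a
    · simp
  exact DFunLike.congr_fun h1 H

/-- The Jacobian criterion for a smooth plane curve `Q = 0`. -/
theorem Polynomial.exists_one_add_coeffDeriv_mul_eq {K : Type*} [Field K] (Q : K[X][X]) (hQ0 : Q ≠ 0)
    [Algebra.FormallySmooth K (AdjoinRoot Q)] :
    ∃ f g c, 1 + Q.coeffDeriv * f + Q.derivative * g = Q * c := by
  have : Algebra.FormallySmooth K (K[X][X] ⧸ Ideal.span {Q}) :=
    inferInstanceAs (Algebra.FormallySmooth K (AdjoinRoot Q))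
  obtain ⟨τ, hτ0, hτ⟩ := Algebra.FormallySmooth.exists_section_quotient_sq K (Ideal.span {Q})
  set ρ := Ideal.Quotient.mkₐ K (Ideal.span {Q} ^ 2)
  have ha := hτ (Polynomial.C Polynomial.X)
  have hb := hτ Polynomial.X
  obtain ⟨f, hf⟩ := Ideal.exists_eq_mk_mul_of_mem_map_mk _ Q ha
  obtain ⟨g, hg⟩ := Ideal.exists_eq_mk_mul_of_mem_map_mk _ Q hb
  have ht : τ Q = ρ Q + ρ Q.coeffDeriv * ρ (Q * f) + ρ Q.derivative * ρ (Q * g) := by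
    have h := Polynomial.eval₂_eval₂_add_of_mul_eq_zero
      (algebraMap K (K[X][X] ⧸ Ideal.span {Q} ^ 2))
      (ρ (Polynomial.C Polynomial.X)) (ρ Polynomial.X) _ _
      (Ideal.mul_eq_zero_of_mem_map_mk_sq _ ha ha) (Ideal.mul_eq_zero_of_mem_map_mk_sq _ ha hb)
      (Ideal.mul_eq_zero_of_mem_map_mk_sq _ hb hb) Q
    simp only [add_sub_cancel] at h
    have e := Polynomial.eval₂_eval₂RingHom_eq (K := K) (B := K[X][X] ⧸ Ideal.span {Q} ^ 2)
    exact (e τ Q).symm.trans (h.trans (congrArg₂ (· + ·) (congrArg₂ (· + ·) (e ρ Q)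
      (congrArg₂ (· * ·) (e ρ _) hf)) (congrArg₂ (· * ·) (e ρ _) hg)))
  rw [hτ0 Q (Ideal.mem_span_singleton_self _), ← map_mul, ← map_mul, ← map_add, ← map_add] at ht
  have ht' := Ideal.Quotient.eq_zero_iff_mem.mp ht.symm
  rw [Ideal.span_singleton_pow, Ideal.mem_span_singleton] at ht'
  obtain ⟨c, hc⟩ := ht'
  exact ⟨f, g, c, mul_left_cancel₀ hQ0 (by linear_combination hc)⟩

end PlaneCurve

/-! ### The affine curve over `ℚ_q` -/

section DedekindLogDerivation

open scoped WithZero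
open IsDedekindDomain

variable {K B L : Type*} [Field K] [CharZero K] [CommRing B] [IsDedekindDomain B] [Field L]
  [Algebra K B] [Algebra B L] [Algebra K L] [IsScalarTower K B L] [IsFractionRing B L]

omit [CharZero K] in
theorem IsDedekindDomain.HeightOneSpectrum.valuation_algebraMap_field (P : HeightOneSpectrum B)
    (c : K) (hc : c ≠ 0) : P.valuation L (algebraMap K L c) = 1 := by
  rw [IsScalarTower.algebraMap_apply K B L, HeightOneSpectrum.valuation_eq_one_iff_notMem]
  intro h
  refine P.isPrime.ne_top (Ideal.eq_top_of_isUnit_mem _ h ?_)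
  exact (IsUnit.mk0 c hc).map (algebraMap K B)

omit [CharZero K] in
theorem Valuation.aeval_sub_aeval_lt_one (v : Valuation L ℤᵐ⁰)
    (hK : ∀ c : K, c ≠ 0 → v (algebraMap K L c) = 1) {f g : L} (hf : v f ≤ 1) (hg : v g ≤ 1)
    (hfg : v (f - g) < 1) (h : K[X]) :
    v (Polynomial.aeval f h - Polynomial.aeval g h) < 1 := by
  induction h using Polynomial.induction_on' with
  | add h₁ h₂ ih₁ ih₂ =>
    rw [map_add, map_add, add_sub_add_comm]
    exact v.map_add_lt ih₁ ih₂
  | monomial n c =>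
    rw [Polynomial.aeval_monomial, Polynomial.aeval_monomial, ← mul_sub, map_mul]
    have hn : v (f ^ n - g ^ n) < 1 := by
      induction n with
      | zero => simp
      | succ n ih =>
        have : f ^ (n + 1) - g ^ (n + 1) = f * (f ^ n - g ^ n) + (f - g) * g ^ n := by ring
        rw [this]
        refine v.map_add_lt ?_ ?_
        · rw [map_mul]
          rw [mul_comm]
          exact mul_lt_one_of_lt_of_le ih hf
        · rw [map_mul, map_pow]
          exact mul_lt_one_of_lt_of_le hfg (pow_le_one' hg n)
    by_cases hc : c = 0
    · simp [hc]
    · rwa [hK c hc, one_mul]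

/-- `Valuation.derivation_lt_one` at a prime of a Dedekind domain `B` which has finite residue fields
over `K`, for a derivation of the fraction field which maps `B` into `δ⁻¹ B`. -/
theorem IsDedekindDomain.HeightOneSpectrum.valuation_derivation_lt_one (P : HeightOneSpectrum B)
    (hres : Algebra.IsIntegral K (B ⧸ P.asIdeal)) (D : Derivation K L L) (δ : L) (hδ : δ ≠ 0)
    (hD : ∀ b : B, P.valuation L (δ * D (algebraMap B L b)) ≤ 1)
    (s : L) (hs0 : s ≠ 0) (hs : P.valuation L s < 1) (hDs : D s = -s) (f : L)
    (hf : P.valuation L f ≤ 1) : P.valuation L (D f) < 1 := by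
  set v := P.valuation L with hv
  refine v.derivation_lt_one (P.valuation_algebraMap_field (K := K)) ?_ D ?_ s hs0 hs hDs f hf
  · intro f hf
    obtain ⟨b, hb⟩ := P.exists_valuation_sub_lt_of_integer hf 1
    obtain ⟨h, hmonic, hh⟩ := Algebra.IsIntegral.isIntegral (R := K) (Ideal.Quotient.mk P.asIdeal b)
    refine ⟨h, hmonic.ne_zero, ?_⟩
    have h1 : v (Polynomial.aeval (algebraMap B L b) h) < 1 := by
      rw [Polynomial.aeval_algebraMap_apply, hv, HeightOneSpectrum.valuation_lt_one_iff_mem,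
        ← Ideal.Quotient.eq_zero_iff_mem]
      rw [← Polynomial.aeval_def] at hh
      rw [← hh]
      exact (Polynomial.aeval_algHom_apply (Ideal.Quotient.mkₐ K P.asIdeal) b h).symm
    have h3 := v.map_add_lt h1 (v.aeval_sub_aeval_lt_one (P.valuation_algebraMap_field (K := K))
      hf (P.valuation_le_one b) (by rw [v.map_sub_swap]; exact hb) h)
    rwa [add_sub_cancel] at h3
  · have hvδ : v δ ≠ 0 := (v.ne_zero_iff).mpr hδ
    have hB : ∀ b : B, v (D (algebraMap B L b)) ≤ (v δ)⁻¹ := by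
      intro b
      have := hD b
      rw [map_mul] at this
      rwa [← one_div, le_div_iff₀' (zero_lt_iff.mpr hvδ)]
    refine ⟨(v δ)⁻¹, fun f hf => ?_⟩
    obtain ⟨n, d, hd⟩ := P.exists_primeCompl_mul_eq_of_integer f hf
    have hvd : v (algebraMap B L d) = 1 := (HeightOneSpectrum.valuation_eq_one_iff_notMem P).mpr d.2
    have h1 : D f * algebraMap B L d = D (algebraMap B L n) - f * D (algebraMap B L d) := by
      rw [← hd, Derivation.leibniz, smul_eq_mul, smul_eq_mul]
      ring
    have h2 := congrArg v h1
    rw [map_mul, hvd, mul_one] at h2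
    rw [h2]
    refine v.map_sub_le (hB _) ?_
    rw [map_mul]
    exact (mul_le_of_le_one_left' hf).trans (hB _)

end DedekindLogDerivation

namespace CurveLift

variable {p : ℕ} [Fact p.Prime] {k : Type u} [Field k] [Finite k] [CharP k p] (C : CurveLift p k)

/-- The coordinate ring `ℚ_q[x, y] / (𝒬)` of the affine plane curve, inside the function field. -/
noncomputable def AK : Subalgebra (Qq p k) C.L := Algebra.adjoin (Qq p k) {C.x, C.y}

theorem x_mem_AK : C.x ∈ C.AK := Algebra.subset_adjoin (by simp)
theorem y_mem_AK : C.y ∈ C.AK := Algebra.subset_adjoin (by simp)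

/-- The lift `𝒬` as a polynomial over `ℚ_q`. -/
noncomputable abbrev QK : (Qq p k)[X][X] :=
  C.Q.map (Polynomial.mapRingHom (algebraMap (Zq p k) (Qq p k)))

/-- Evaluation of `G ∈ ℚ_q[x][y]` at `(x, y)`. -/
noncomputable def evK : (Qq p k)[X][X] →+* C.L :=
  Polynomial.eval₂RingHom (Polynomial.eval₂RingHom (algebraMap (Qq p k) C.L) C.x) C.y

theorem evK_map (G : (Zq p k)[X][X]) :
    C.evK (G.map (Polynomial.mapRingHom (algebraMap (Zq p k) (Qq p k)))) = C.ev G := by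
  rw [ev_eq_eval₂, evK, Polynomial.coe_eval₂RingHom, Polynomial.eval₂_map]
  congr 1
  rw [incl_eq_eval₂RingHom]
  apply Polynomial.ringHom_ext
  · intro a
    simp [← IsScalarTower.algebraMap_apply]
  · simp

theorem ev_mem_AK (G : (Zq p k)[X][X]) : C.ev G ∈ C.AK := by
  rw [ev_eq_eval₂, Polynomial.eval₂_eq_sum_range]
  refine sum_mem fun i _ => mul_mem ?_ (pow_mem C.y_mem_AK _)
  rw [incl_eq_eval₂RingHom, Polynomial.coe_eval₂RingHom, Polynomial.eval₂_eq_sum_range]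
  refine sum_mem fun j _ => mul_mem ?_ (pow_mem C.x_mem_AK _)
  rw [IsScalarTower.algebraMap_apply (Zq p k) (Qq p k) C.L]
  exact C.AK.algebraMap_mem _

theorem incl_mem_AK (f : (Zq p k)[X]) : C.incl f ∈ C.AK := by
  have := C.ev_mem_AK (Polynomial.C f)
  rwa [ev_eq_eval₂, Polynomial.eval₂_C] at this

theorem algebraMap_A_mem_AK (f : C.A) : algebraMap C.A C.L f ∈ C.AK := by
  obtain ⟨G, rfl⟩ := AdjoinRoot.mk_surjective f
  exact C.ev_mem_AK G

theorem Qx_mem_AK : C.Qx ∈ C.AK := C.ev_mem_AK _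
theorem Qy_mem_AK : C.Qy ∈ C.AK := C.ev_mem_AK _

instance : IsFractionRing C.AK C.L := by
  refine IsFractionRing.of_field _ _ fun z => ?_
  obtain ⟨a, b, hb, rfl⟩ := IsFractionRing.div_surjective (A := C.A) z
  exact ⟨⟨_, C.algebraMap_A_mem_AK a⟩, ⟨_, C.algebraMap_A_mem_AK b⟩, rfl⟩

theorem adjoin_AK : Algebra.adjoin (Qq p k) {(⟨C.x, C.x_mem_AK⟩ : C.AK), ⟨C.y, C.y_mem_AK⟩} = ⊤ := by
  refine Eq.trans ?_ (Algebra.adjoin_adjoin_coe_preimage (R := Qq p k) (s := {C.x, C.y}))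
  have h : ({(⟨C.x, C.x_mem_AK⟩ : C.AK), ⟨C.y, C.y_mem_AK⟩} : Set C.AK) =
      (fun z : C.AK => (z : C.L)) ⁻¹' {C.x, C.y} := by
    ext z
    simp [Subtype.ext_iff]
  rw [h]
  rfl

instance : Algebra.FiniteType (Qq p k) C.AK :=
  Subalgebra.fg_iff_finiteType _ |>.mp ⟨(Set.toFinite {C.x, C.y}).toFinset, by simp [AK]⟩

instance : IsNoetherianRing C.AK := Algebra.FiniteType.isNoetherianRing (Qq p k) C.AK

/-- The coordinate ring is integral over `ℚ_q[x]`. -/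
theorem isIntegral_AK :
    (Polynomial.aeval (R := Qq p k) (⟨C.x, C.x_mem_AK⟩ : C.AK)).toRingHom.IsIntegral := by
  intro z
  have hz : z ∈ Algebra.adjoin (Qq p k) {(⟨C.x, C.x_mem_AK⟩ : C.AK), ⟨C.y, C.y_mem_AK⟩} :=
    C.adjoin_AK ▸ Algebra.mem_top
  set φ := (Polynomial.aeval (R := Qq p k) (⟨C.x, C.x_mem_AK⟩ : C.AK)).toRingHom
  induction hz using Algebra.adjoin_induction with
  | mem z hz =>
    rcases hz with rfl | rfl
    · have := φ.isIntegralElem_map (x := Polynomial.X)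
      simpa [φ] using this
    · refine ⟨C.QK, C.monic.map _, Subtype.ext ?_⟩
      have h1 := C.evK_map C.Q
      rw [ev_Q] at h1
      refine Eq.trans ?_ h1
      have h2 := Polynomial.hom_eval₂ C.QK φ C.AK.val.toRingHom ⟨C.y, C.y_mem_AK⟩
      refine h2.trans ?_
      rw [evK, Polynomial.coe_eval₂RingHom]
      congr 1
      apply Polynomial.ringHom_ext
      · intro c; simp [φ]
      · simp [φ]
  | algebraMap c =>
    have := φ.isIntegralElem_map (x := Polynomial.C c)
    simpa [φ] using this
  | add f g _ _ hf hg => exact RingHom.IsIntegralElem.add φ hf hg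
  | mul f g _ _ hf hg => exact RingHom.IsIntegralElem.mul φ hf hg

instance : Ring.DimensionLEOne C.AK := by
  let _ : Algebra (Qq p k)[X] C.AK :=
    (Polynomial.aeval (R := Qq p k) (⟨C.x, C.x_mem_AK⟩ : C.AK)).toRingHom.toAlgebra
  have : Algebra.IsIntegral (Qq p k)[X] C.AK := ⟨C.isIntegral_AK⟩
  exact Ring.DimensionLEOne.of_isIntegral (Qq p k)[X] C.AK

variable {C}

/-- The Jacobian criterion: on the smooth curve `𝒬 = 0` the partial derivatives of `𝒬` have no common
zero. -/
theorem SmoothLocus.exists_mul_add_mul_eq_one (h : C.SmoothLocus) :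
    ∃ α ∈ C.AK, ∃ β ∈ C.AK, α * C.Qx + β * C.Qy = 1 := by
  have := h.formallySmooth
  obtain ⟨f, g, c, h3⟩ := Polynomial.exists_one_add_coeffDeriv_mul_eq C.QK (C.monic.map _).ne_zero
  have h4 := congrArg C.evK h3
  have hmem : ∀ G, C.evK G ∈ C.AK := by
    intro G
    rw [evK, Polynomial.coe_eval₂RingHom, Polynomial.eval₂_eq_sum_range]
    refine sum_mem fun i _ => mul_mem ?_ (pow_mem C.y_mem_AK _)
    rw [Polynomial.coe_eval₂RingHom, Polynomial.eval₂_eq_sum_range]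
    exact sum_mem fun j _ => mul_mem (C.AK.algebraMap_mem _) (pow_mem C.x_mem_AK _)
  rw [map_mul, evK_map, ev_Q, zero_mul, map_add, map_add, map_mul, map_mul, map_one,
    Polynomial.coeffDeriv_map, evK_map, Polynomial.derivative_map, evK_map] at h4
  refine ⟨_, neg_mem (hmem f), _, neg_mem (hmem g), ?_⟩
  rw [Qx, Qy]
  linear_combination -h4

theorem SmoothLocus.isDedekindDomain_AK (h : C.SmoothLocus) : IsDedekindDomain C.AK := by
  obtain ⟨α, hα, β, hβ, h1⟩ := h.exists_mul_add_mul_eq_one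
  refine IsDedekindDomain.of_forall_exists_eq_span_singleton_sup_sq fun P hP => ?_
  have hev : ∀ G : (Qq p k)[X][X], ((G.eval₂ (Polynomial.eval₂RingHom (algebraMap (Qq p k) C.AK)
      ⟨C.x, C.x_mem_AK⟩) ⟨C.y, C.y_mem_AK⟩ : C.AK) : C.L) = C.evK G := by
    intro G
    refine (Polynomial.hom_eval₂ G _ C.AK.val.toRingHom ⟨C.y, C.y_mem_AK⟩).trans ?_
    rw [evK, Polynomial.coe_eval₂RingHom]
    congr 1
    apply Polynomial.ringHom_ext
    · intro c; simp
    · simp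
  refine Ideal.exists_eq_span_singleton_sup_sq (K := Qq p k) _ _ C.adjoin_AK C.QK ?_
    ⟨α, hα⟩ ⟨β, hβ⟩ ?_ P
  · apply Subtype.ext
    rw [hev, evK_map, ev_Q]
    rfl
  · apply Subtype.ext
    rw [Polynomial.coeffDeriv_map, Polynomial.derivative_map]
    push_cast
    rw [hev, hev, evK_map, evK_map]
    exact h1

variable (C)

theorem Qy_mul_ddx_mem_AK {f : C.L} (hf : f ∈ C.AK) : C.Qy * C.ddx f ∈ C.AK := by
  induction hf using Algebra.adjoin_induction with
  | mem f hf =>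
    rcases hf with rfl | rfl
    · rw [ddx_x, mul_one]
      exact C.Qy_mem_AK
    · rw [ddx_y, mul_div_cancel₀ _ C.Qy_ne_zero]
      exact neg_mem C.Qx_mem_AK
  | algebraMap c =>
    rw [Derivation.map_algebraMap, mul_zero]
    exact zero_mem _
  | add f g _ _ hf hg =>
    rw [map_add, mul_add]
    exact add_mem hf hg
  | mul f g hf' hg' hf hg =>
    rw [Derivation.leibniz, smul_eq_mul, smul_eq_mul]
    have : C.Qy * (f * C.ddx g + g * C.ddx f) = f * (C.Qy * C.ddx g) + g * (C.Qy * C.ddx f) := by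
      ring
    rw [this]
    exact add_mem (mul_mem hf' hg) (mul_mem hg' hf)

theorem aeval_x_eq_incl_map (f : (Zq p k)[X]) :
    Polynomial.aeval C.x (f.map (algebraMap (Zq p k) (Qq p k))) = C.incl f := by
  rw [incl_eq_eval₂RingHom, Polynomial.aeval_map_algebraMap, Polynomial.coe_eval₂RingHom,
    Polynomial.aeval_def]

variable {C}

open IsDedekindDomain in
/-- On the smooth affine curve, `r d/dx` is a regular vector field.  This is clear at the points where
`∂𝒬/∂y` does not vanish.  At any other point `P`, let `h` be the minimal polynomial of `x(P)`.  Then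
`-(h / h') d/dx` is logarithmic at `P` with respect to the function `h`, hence regular, and `h` divides
`r` because `r` vanishes at `P`. -/
theorem SmoothLocus.r_mul_ddx_mem_AK (h : C.SmoothLocus) {f : C.L} (hf : f ∈ C.AK) :
    C.incl C.r * C.ddx f ∈ C.AK := by
  have := h.isDedekindDomain_AK
  suffices H : C.incl C.r * C.ddx f ∈ (algebraMap C.AK C.L).range by
    obtain ⟨z, hz⟩ := H
    rw [← hz]
    exact z.2
  refine HeightOneSpectrum.mem_integers_of_valuation_le_one C.L _ fun P => ?_
  have hle : ∀ z ∈ C.AK, P.valuation C.L z ≤ 1 := fun z hz => P.valuation_le_one ⟨z, hz⟩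
  have hmem : ∀ z (hz : z ∈ C.AK), P.valuation C.L z < 1 ↔ (⟨z, hz⟩ : C.AK) ∈ P.asIdeal :=
    fun z hz => P.valuation_lt_one_iff_mem ⟨z, hz⟩
  rcases (hle _ C.Qy_mem_AK).lt_or_eq with hlt | heq
  · have hr1 : P.valuation C.L (C.incl C.r) < 1 := by
      obtain ⟨V, hV⟩ := C.exists_Qy_mul_eq_discr
      obtain ⟨n, g, hg⟩ := C.exists_discr_dvd_r_pow
      have h1 : P.valuation C.L (C.incl C.r) ^ n < 1 := by
        rw [← map_pow, ← map_pow, hg, map_mul, ← hV, map_mul, map_mul, mul_assoc]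
        exact mul_lt_one_of_lt_of_le hlt (mul_le_one' (hle _ (C.ev_mem_AK V))
          (hle _ (C.incl_mem_AK g)))
      by_contra hcon
      exact absurd h1 (not_lt.mpr (one_le_pow_of_one_le' (not_lt.mp hcon) n))
    have hPmax : P.asIdeal.IsMaximal := P.isMaximal
    let _ : Field (C.AK ⧸ P.asIdeal) := Ideal.Quotient.field P.asIdeal
    have hfin : Module.Finite (Qq p k) (C.AK ⧸ P.asIdeal) :=
      finite_of_finite_type_of_isJacobsonRing (Qq p k) (C.AK ⧸ P.asIdeal)
    have hint : Algebra.IsIntegral (Qq p k) (C.AK ⧸ P.asIdeal) := Algebra.IsIntegral.of_finite _ _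
    let x0 : C.AK ⧸ P.asIdeal := Ideal.Quotient.mk P.asIdeal ⟨C.x, C.x_mem_AK⟩
    let hh : (Qq p k)[X] := minpoly (Qq p k) x0
    have hx0 : IsIntegral (Qq p k) x0 := hint.isIntegral x0
    have hirr : Irreducible hh := minpoly.irreducible hx0
    have hcoe : ∀ g : (Qq p k)[X],
        ((Polynomial.aeval (⟨C.x, C.x_mem_AK⟩ : C.AK) g : C.AK) : C.L) = Polynomial.aeval C.x g :=
      fun g => (Polynomial.aeval_algHom_apply C.AK.val (⟨C.x, C.x_mem_AK⟩ : C.AK) g).symm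
    have haeval_mem : ∀ g : (Qq p k)[X], Polynomial.aeval C.x g ∈ C.AK := fun g =>
      hcoe g ▸ Subtype.coe_prop _
    have hval : ∀ g : (Qq p k)[X], P.valuation C.L (Polynomial.aeval C.x g) < 1 ↔
        Polynomial.aeval x0 g = 0 := by
      intro g
      rw [hmem _ (haeval_mem g), ← Ideal.Quotient.eq_zero_iff_mem]
      have h2 : Polynomial.aeval x0 g =
          Ideal.Quotient.mk P.asIdeal (Polynomial.aeval (⟨C.x, C.x_mem_AK⟩ : C.AK) g) :=
        Polynomial.aeval_algHom_apply (Ideal.Quotient.mkₐ (Qq p k) P.asIdeal) _ g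
      have h3 : (⟨Polynomial.aeval C.x g, haeval_mem g⟩ : C.AK) =
          Polynomial.aeval (⟨C.x, C.x_mem_AK⟩ : C.AK) g :=
        Subtype.ext (hcoe g).symm
      rw [h2, h3]
    have hs : P.valuation C.L (Polynomial.aeval C.x hh) < 1 := (hval _).mpr (minpoly.aeval _ _)
    have hd : P.valuation C.L (Polynomial.aeval C.x hh.derivative) = 1 := by
      refine le_antisymm (hle _ (haeval_mem _)) (not_lt.mp fun hlt' => ?_)
      exact hirr.separable.aeval_derivative_ne_zero (minpoly.aeval _ _) ((hval _).mp hlt')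
    have hd0 : Polynomial.aeval C.x hh.derivative ≠ 0 := by
      intro h0
      rw [h0, map_zero] at hd
      exact zero_ne_one hd
    obtain ⟨q, hq⟩ : hh ∣ C.r.map (algebraMap (Zq p k) (Qq p k)) := by
      refine minpoly.dvd _ _ ((hval _).mp ?_)
      rwa [aeval_x_eq_incl_map]
    have hs0 : Polynomial.aeval C.x hh ≠ 0 := by
      intro h0
      apply C.incl_r_ne_zero
      rw [← aeval_x_eq_incl_map, hq, map_mul, h0, zero_mul]
    let D : Derivation (Qq p k) C.L C.L :=
      (-(Polynomial.aeval C.x hh / Polynomial.aeval C.x hh.derivative)) • C.ddx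
    have hDapply : ∀ g, D g =
      -(Polynomial.aeval C.x hh / Polynomial.aeval C.x hh.derivative) * C.ddx g := fun g => rfl
    have hDs : D (Polynomial.aeval C.x hh) = -Polynomial.aeval C.x hh := by
      rw [hDapply, Derivation.map_aeval, ddx_x, smul_eq_mul, mul_one, neg_mul,
        div_mul_cancel₀ _ hd0]
    have key := P.valuation_derivation_lt_one (K := Qq p k) (L := C.L) hint D C.Qy
      C.Qy_ne_zero (fun b => by
        rw [hDapply, mul_left_comm, map_mul, Valuation.map_neg, map_div₀, hd, div_one]
        exact mul_le_one' hs.le (hle _ (C.Qy_mul_ddx_mem_AK b.2)))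
      _ hs0 hs hDs f (hle f hf)
    rw [hDapply, map_mul, Valuation.map_neg, map_div₀, hd, div_one] at key
    rw [← aeval_x_eq_incl_map, hq, map_mul, map_mul, map_mul, mul_right_comm]
    exact mul_le_one' key.le (hle _ (haeval_mem q))
  · have h1 := hle _ (C.Qy_mul_ddx_mem_AK hf)
    rw [map_mul, heq, one_mul] at h1
    rw [map_mul]
    exact mul_le_one' (hle _ (C.incl_mem_AK _)) h1

end CurveLift

/-! ### Filtration of a function field by the order at the zeros of a function -/

section OrderFiltration

open scoped WithZero
open IsDedekindDomain

variable {K L : Type*} (B : Type*) [Field K] [CharZero K] [CommRing B] [IsDedekindDomain B] [Field L]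
  [Algebra K B] [Algebra B L] [Algebra K L] [IsScalarTower K B L] [IsFractionRing B L]

/-- The elements of `L` whose order at every zero of `s` is at least `J` times the order of `s`. -/
def ordFiltration (s : L) (J : ℤ) : AddSubgroup L where
  carrier := {h | ∀ P : HeightOneSpectrum B, P.valuation L s < 1 →
    P.valuation L h ≤ P.valuation L s ^ J}
  zero_mem' P _ := by simp
  add_mem' {f g} hf hg P hP := (P.valuation L).map_add_le (hf P hP) (hg P hP)
  neg_mem' {f} hf P hP := by
    rw [Valuation.map_neg]
    exact hf P hP

variable {B}

theorem ordFiltration_antitone {s : L} (hs : s ≠ 0) : Antitone (ordFiltration B s) := by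
  intro i j hij h hh P hP
  refine (hh P hP).trans ?_
  exact zpow_le_zpow_right_of_le_one₀ (zero_lt_iff.mpr ((Valuation.ne_zero_iff _).mpr hs)) hP.le hij

theorem mul_mem_ordFiltration {s : L} (hs : s ≠ 0) {i j : ℤ} {f g : L} (hf : f ∈ ordFiltration B s i)
    (hg : g ∈ ordFiltration B s j) : f * g ∈ ordFiltration B s (i + j) := by
  intro P hP
  rw [map_mul, zpow_add₀ ((Valuation.ne_zero_iff _).mpr hs)]
  exact mul_le_mul' (hf P hP) (hg P hP)

theorem zpow_mem_ordFiltration (s : L) (i : ℤ) : s ^ i ∈ ordFiltration B s i := by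
  intro P _
  rw [map_zpow₀]

theorem algebraMap_mem_ordFiltration (s : L) (b : B) : algebraMap B L b ∈ ordFiltration B s 0 := by
  intro P _
  rw [zpow_zero]
  exact P.valuation_le_one b

variable (B) in
theorem finite_setOf_valuation_lt_one {s : L} (hs : s ≠ 0) (hsB : s ∈ (algebraMap B L).range) :
    {P : HeightOneSpectrum B | P.valuation L s < 1}.Finite := by
  obtain ⟨t, rfl⟩ := hsB
  have ht : t ≠ 0 := by
    rintro rfl
    simp at hs
  refine (Ideal.finite_factors (I := Ideal.span {t}) (by simpa using ht)).subset ?_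
  intro P hP
  exact (P.valuation_lt_one_iff_dvd t).mp hP

theorem exists_mem_ordFiltration {s : L} (hs : s ≠ 0) (hsB : s ∈ (algebraMap B L).range) (h : L) :
    ∃ n : ℕ, h ∈ ordFiltration B s (-n) := by
  have hfin := finite_setOf_valuation_lt_one B hs hsB
  have hP : ∀ P : HeightOneSpectrum B, ∃ n : ℕ, P.valuation L s < 1 →
      P.valuation L h ≤ P.valuation L s ^ (-n : ℤ) := by
    intro P
    by_cases hP : P.valuation L s < 1
    · by_cases hh : P.valuation L h = 0
      · exact ⟨0, fun _ => by simp [hh]⟩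
      obtain ⟨n, hn⟩ : ∃ n : ℕ, P.valuation L s ^ n ≤ (P.valuation L h)⁻¹ := by
        have hs0 : P.valuation L s ≠ 0 := (Valuation.ne_zero_iff _).mpr hs
        refine ⟨(WithZero.log (P.valuation L h)).toNat, ?_⟩
        rw [← WithZero.exp_log hs0, ← WithZero.exp_log hh, ← WithZero.exp_nsmul, ← WithZero.exp_neg,
          WithZero.exp_le_exp, WithZero.log_exp]
        rw [← WithZero.exp_log hs0, ← WithZero.exp_zero, WithZero.exp_lt_exp] at hP
        have h1 : (0:ℤ) ≤ (WithZero.log (P.valuation L h)).toNat := by positivity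
        have h2 : WithZero.log (P.valuation L h) ≤ (WithZero.log (P.valuation L h)).toNat :=
          Int.self_le_toNat _
        simp only [nsmul_eq_mul]
        nlinarith
      refine ⟨n, fun _ => ?_⟩
      rw [zpow_neg, zpow_natCast]
      exact le_inv_of_le_inv₀ (zero_lt_iff.mpr (pow_ne_zero _ ((Valuation.ne_zero_iff _).mpr hs))) hn
    · exact ⟨0, fun h => absurd h hP⟩
  choose n hn using hP
  refine ⟨hfin.toFinset.sup n, fun P hP => (hn P hP).trans ?_⟩
  refine zpow_le_zpow_right_of_le_one₀ (zero_lt_iff.mpr ((Valuation.ne_zero_iff _).mpr hs)) hP.le ?_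
  have := Finset.le_sup (f := n) (hfin.mem_toFinset.mpr hP)
  omega

theorem exists_algebraMap_eq_of_mem_ordFiltration {s : L} (hsB : s ∈ (algebraMap B L).range)
    {h : L} (hh : h ∈ ordFiltration B s 0) (n : ℕ) (hn : s ^ n * h ∈ (algebraMap B L).range) :
    h ∈ (algebraMap B L).range := by
  refine HeightOneSpectrum.mem_integers_of_valuation_le_one L _ fun P => ?_
  by_cases hP : P.valuation L s < 1
  · simpa using hh P hP
  · obtain ⟨b, hb⟩ := hn
    have h1 : P.valuation L s = 1 := by
      obtain ⟨t, rfl⟩ := hsB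
      exact le_antisymm (P.valuation_le_one t) (not_lt.mp hP)
    have h2 : P.valuation L (algebraMap B L b) ≤ 1 := P.valuation_le_one b
    rwa [hb, map_mul, map_pow, h1, one_pow, one_mul] at h2

omit [CharZero K] in
theorem algebraMap_field_mul_mem_ordFiltration (c : K) {s : L} {J : ℤ} {h : L}
    (hh : h ∈ ordFiltration B s J) : algebraMap K L c * h ∈ ordFiltration B s J := by
  intro P hP
  rw [map_mul]
  by_cases hc : c = 0
  · simp [hc]
  · rw [P.valuation_algebraMap_field c hc, one_mul]
    exact hh P hP

variable (D : Derivation K L L) {s : L}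
  (hD : ∀ P : HeightOneSpectrum B, P.valuation L s < 1 → ∀ f, P.valuation L f ≤ 1 →
    P.valuation L (D f) < 1)

include hD

theorem aeval_derivation_mem_ordFiltration [CharZero L] (hs : s ≠ 0) (hDs : D s = -s) (q : ℚ[X])
    {J : ℤ} {f : L} (hf : f ∈ ordFiltration B s J) :
    Polynomial.aeval D.toRatLinearMap q f ∈ ordFiltration B s J := by
  intro P hP
  refine ((P.valuation L).aeval_derivation_le (P.valuation_algebraMap_field (K := K)) D ?_ q f).trans
    (hf P hP)
  have hs0 : P.valuation L s ≠ 0 := (Valuation.ne_zero_iff _).mpr hs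
  have hlog : WithZero.log (P.valuation L s) < 0 := by
    rwa [← WithZero.exp_lt_exp, WithZero.exp_log hs0, WithZero.exp_zero]
  exact (P.valuation L).derivation_le (P.valuation_algebraMap_field (K := K)) D (hD P hP) s hs
    (-WithZero.log (P.valuation L s)).toNat (by omega)
    (by rw [Int.toNat_of_nonneg (by omega), neg_neg, WithZero.exp_log hs0]) hDs

/-- The product over the zeros `P` of `s` of the characteristic polynomials of `D` on the elements of
order at least `lo * e P` modulo those of order at least `hi * e P`. -/
theorem aeval_prod_logEigenvalues_mem_ordFiltration [CharZero L] (hs : s ≠ 0) (hDs : D s = -s)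
    (S : Finset (HeightOneSpectrum B)) (hS : ∀ P : HeightOneSpectrum B, P.valuation L s < 1 → P ∈ S)
    (e : HeightOneSpectrum B → ℕ) (he0 : ∀ P ∈ S, e P ≠ 0)
    (he : ∀ P ∈ S, P.valuation L s = WithZero.exp (-(e P : ℤ)))
    (lo hi : ℤ) (hlo : lo ≤ hi) {f : L} (hf : f ∈ ordFiltration B s lo) :
    Polynomial.aeval D.toRatLinearMap
      ((∑ P ∈ S, logEigenvalues (e P) (lo * e P) (hi * e P)).map
        fun a => Polynomial.X - Polynomial.C a).prod f ∈ ordFiltration B s hi := by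
  classical
  intro P hP
  have hPS := hS P hP
  rw [← Finset.add_sum_erase S _ hPS, Multiset.map_add, Multiset.prod_add, mul_comm, map_mul,
    Module.End.mul_apply]
  have hzpow : ∀ J : ℤ, P.valuation L s ^ J = WithZero.exp (-(J * e P)) := by
    intro J
    rw [he P hPS, ← WithZero.exp_zsmul]
    congr 1
    simp
  have h1 := (P.valuation L).aeval_prod_logEigenvalues_le (P.valuation_algebraMap_field (K := K)) D
    (hD P hP) s hs (e P) (he0 P hPS) (he P hPS) hDs (lo * e P) (hi * e P)
    (mul_le_mul_of_nonneg_right hlo (by positivity)) f (by rw [← hzpow]; exact hf P hP)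
  rw [hzpow]
  refine ((P.valuation L).aeval_derivation_le (P.valuation_algebraMap_field (K := K)) D ?_ _ _).trans
    h1
  exact (P.valuation L).derivation_le (P.valuation_algebraMap_field (K := K)) D (hD P hP) s hs
    (e P) (he0 P hPS) (he P hPS) hDs

end OrderFiltration

/-! ### Coordinates with respect to the functions `b_i` -/

namespace CurveLift

variable {p : ℕ} [Fact p.Prime] {k : Type u} [Field k] [Finite k] [CharP k p] (C : CurveLift p k)

theorem coe_xUnit_zpow (n : ℤ) : ((C.xUnit ^ n : C.Lˣ) : C.L) = C.x ^ n := by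
  rw [Units.val_zpow_eq_zpow_val]
  rfl

/-- Evaluation of Laurent polynomials over `ℤ_q` at the function `x`. -/
noncomputable abbrev evO : (Zq p k)[T;T⁻¹] →+* C.L :=
  LaurentPolynomial.eval₂ (algebraMap (Zq p k) C.L) C.xUnit

/-- Evaluation of Laurent polynomials over `ℚ_q` at the function `x`. -/
noncomputable abbrev evL : (Qq p k)[T;T⁻¹] →+* C.L :=
  LaurentPolynomial.eval₂ (algebraMap (Qq p k) C.L) C.xUnit

theorem evO_C_mul_T (c : Zq p k) (n : ℤ) :
    C.evO (LaurentPolynomial.C c * LaurentPolynomial.T n) = algebraMap (Zq p k) C.L c * C.x ^ n := by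
  rw [LaurentPolynomial.eval₂_C_mul_T, coe_xUnit_zpow]

theorem evL_C_mul_T (c : Qq p k) (n : ℤ) :
    C.evL (LaurentPolynomial.C c * LaurentPolynomial.T n) = algebraMap (Qq p k) C.L c * C.x ^ n := by
  rw [LaurentPolynomial.eval₂_C_mul_T, coe_xUnit_zpow]

theorem evL_T (n : ℤ) : C.evL (LaurentPolynomial.T n) = C.x ^ n := by
  rw [LaurentPolynomial.eval₂_T, coe_xUnit_zpow]

theorem evO_T (n : ℤ) : C.evO (LaurentPolynomial.T n) = C.x ^ n := by
  rw [LaurentPolynomial.eval₂_T, coe_xUnit_zpow]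

theorem evO_toLaurent (f : (Zq p k)[X]) : C.evO (Polynomial.toLaurent f) = C.incl f := by
  rw [LaurentPolynomial.eval₂_toLaurent, incl_eq_eval₂RingHom]
  rfl

/-- The inclusion of `ℤ_q[x, 1/x]` in `ℚ_q[x, 1/x]`. -/
noncomputable abbrev toQq : (Zq p k)[T;T⁻¹] →+* (Qq p k)[T;T⁻¹] :=
  AddMonoidAlgebra.mapRingHom ℤ (algebraMap (Zq p k) (Qq p k))

omit [Finite k] [CharP k p] in
theorem toQq_C_mul_T (c : Zq p k) (n : ℤ) :
    toQq (LaurentPolynomial.C c * LaurentPolynomial.T n) =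
      LaurentPolynomial.C (algebraMap (Zq p k) (Qq p k) c) * LaurentPolynomial.T n := by
  rw [← LaurentPolynomial.single_eq_C_mul_T, ← LaurentPolynomial.single_eq_C_mul_T,
    AddMonoidAlgebra.mapRingHom_single]

omit [Finite k] [CharP k p] in
theorem coeff_toQq (f : (Zq p k)[T;T⁻¹]) (n : ℤ) :
    (toQq f).coeff n = algebraMap (Zq p k) (Qq p k) (f.coeff n) :=
  AddMonoidAlgebra.coeff_mapRingHom _ _ _

theorem evL_toQq (f : (Zq p k)[T;T⁻¹]) : C.evL (toQq f) = C.evO f := by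
  induction f using LaurentPolynomial.induction_on' with
  | add f g hf hg => simp [hf, hg]
  | C_mul_T m c =>
    rw [toQq_C_mul_T, evL_C_mul_T, evO_C_mul_T, ← IsScalarTower.algebraMap_apply]

omit [Finite k] [CharP k p] in
theorem isIntegralVec_iff_exists {n : ℕ} (w : Fin n → (Qq p k)[T;T⁻¹]) :
    IsIntegralVec w ↔ ∃ v : Fin n → (Zq p k)[T;T⁻¹], w = fun i => toQq (v i) := by
  constructor
  · intro h
    have : ∀ i, ∃ v : (Zq p k)[T;T⁻¹], w i = toQq v := by
      intro i
      choose c hc using h i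
      refine ⟨∑ j ∈ (w i).coeff.support, .single j (c j), ?_⟩
      rw [map_sum]
      simp only [AddMonoidAlgebra.mapRingHom_single, hc]
      ext n
      rw [AddMonoidAlgebra.coeff_sum, Finsupp.finsetSum_apply]
      simp only [AddMonoidAlgebra.coeff_single, Finsupp.single_apply]
      simp +contextual
    choose v hv using this
    exact ⟨v, funext hv⟩
  · rintro ⟨v, rfl⟩ i j
    exact ⟨_, (coeff_toQq _ _).symm⟩

/-- The function `x` is transcendental over `ℚ_q`. -/
theorem evL_injective : Function.Injective C.evL := by
  rw [injective_iff_map_eq_zero]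
  intro f hf
  obtain ⟨c, hc, g, hg⟩ : ∃ c : Zq p k, c ≠ 0 ∧ ∃ g : (Zq p k)[T;T⁻¹],
      toQq g = LaurentPolynomial.C (algebraMap (Zq p k) (Qq p k) c) * f := by
    clear hf
    induction f using LaurentPolynomial.induction_on' with
    | add f₁ f₂ h₁ h₂ =>
      obtain ⟨c₁, hc₁, g₁, hg₁⟩ := h₁
      obtain ⟨c₂, hc₂, g₂, hg₂⟩ := h₂
      refine ⟨c₁ * c₂, mul_ne_zero hc₁ hc₂,
        LaurentPolynomial.C c₂ * g₁ + LaurentPolynomial.C c₁ * g₂, ?_⟩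
      have hC : ∀ c : Zq p k, toQq (LaurentPolynomial.C c) =
          LaurentPolynomial.C (algebraMap (Zq p k) (Qq p k) c) := by
        intro c
        simpa using toQq_C_mul_T c 0
      rw [map_add, map_mul, map_mul, hC, hC, hg₁, hg₂, map_mul, map_mul]
      ring
    | C_mul_T n a =>
      obtain ⟨⟨b, c⟩, h⟩ := IsLocalization.surj (nonZeroDivisors (Zq p k)) a
      refine ⟨c, nonZeroDivisors.coe_ne_zero c,
        LaurentPolynomial.C b * LaurentPolynomial.T n, ?_⟩
      rw [toQq_C_mul_T, ← mul_assoc, ← map_mul, ← h, mul_comm a]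
  have h1 : C.evO g = 0 := by rw [← evL_toQq, hg, map_mul, hf, mul_zero]
  obtain ⟨n, P, hP⟩ := LaurentPolynomial.exists_T_pow g
  have h2 : P = 0 := by
    apply C.incl_injective
    rw [← evO_toLaurent, hP, map_mul, h1, zero_mul, map_zero]
  have h3 : g = 0 := by
    have := (LaurentPolynomial.isUnit_T (R := Zq p k) n).mul_left_injective
    apply this
    simp only [zero_mul]
    rw [← hP, h2, map_zero]
  rw [h3, map_zero] at hg
  have h4 : IsUnit (LaurentPolynomial.C (algebraMap (Zq p k) (Qq p k) c)) :=
    (IsUnit.mk0 _ (by simpa using hc)).map _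
  exact (h4.mul_right_eq_zero).mp hg.symm

variable (W : GL (Fin C.d) (Zq p k)[T;T⁻¹])

theorem comb_add (v w : Fin C.d → (Qq p k)[T;T⁻¹]) : C.comb W (v + w) = C.comb W v + C.comb W w := by
  simp only [comb, Pi.add_apply, map_add, add_mul, Finset.sum_add_distrib]

theorem comb_mul (c : (Qq p k)[T;T⁻¹]) (w : Fin C.d → (Qq p k)[T;T⁻¹]) :
    C.comb W (fun i => c * w i) = C.evL c * C.comb W w := by
  simp only [comb, map_mul, Finset.mul_sum, mul_assoc]

theorem comb_sub (v w : Fin C.d → (Qq p k)[T;T⁻¹]) : C.comb W (v - w) = C.comb W v - C.comb W w := by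
  simp only [comb, Pi.sub_apply, map_sub, sub_mul, Finset.sum_sub_distrib]

theorem comb_zero : C.comb W 0 = 0 := by simp [comb]

theorem comb_single [DecidableEq (Fin C.d)] (i : Fin C.d) (c : (Qq p k)[T;T⁻¹]) :
    C.comb W (Pi.single i c) = C.evL c * C.b W i := by
  rw [comb, Finset.sum_eq_single i]
  · simp
  · intro j _ hj
    simp [Pi.single_eq_of_ne hj]
  · simp

/-- The ring `ℤ_q[x, 1/x, y]`. -/
noncomputable def AX : Subalgebra (Zq p k) C.L := Algebra.adjoin (Zq p k) {C.x, C.x⁻¹, C.y}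

theorem x_mem_AX : C.x ∈ C.AX := Algebra.subset_adjoin (by simp)
theorem inv_x_mem_AX : C.x⁻¹ ∈ C.AX := Algebra.subset_adjoin (by simp)
theorem y_mem_AX : C.y ∈ C.AX := Algebra.subset_adjoin (by simp)

theorem zpow_x_mem_AX (n : ℤ) : C.x ^ n ∈ C.AX := by
  obtain ⟨m, rfl | rfl⟩ := n.eq_nat_or_neg
  · exact zpow_natCast C.x m ▸ pow_mem C.x_mem_AX m
  · rw [zpow_neg, zpow_natCast, ← inv_pow]
    exact pow_mem C.inv_x_mem_AX m

theorem evO_mem_AX (f : (Zq p k)[T;T⁻¹]) : C.evO f ∈ C.AX := by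
  induction f using LaurentPolynomial.induction_on' with
  | add f g hf hg => rw [map_add]; exact add_mem hf hg
  | C_mul_T n c =>
    rw [evO_C_mul_T]
    exact mul_mem (C.AX.algebraMap_mem c) (C.zpow_x_mem_AX n)

theorem incl_mem_AX (f : (Zq p k)[X]) : C.incl f ∈ C.AX := by
  rw [← evO_toLaurent]
  exact C.evO_mem_AX _

theorem ev_mem_AX (G : (Zq p k)[X][X]) : C.ev G ∈ C.AX := by
  rw [ev_eq_eval₂, Polynomial.eval₂_eq_sum_range]
  exact sum_mem fun i _ => mul_mem (C.incl_mem_AX _) (pow_mem C.y_mem_AX i)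

theorem b_mem_AX (i : Fin C.d) : C.b W i ∈ C.AX :=
  sum_mem fun _ _ => mul_mem (C.evO_mem_AX _) (pow_mem C.y_mem_AX _)

theorem comb_toQq (v : Fin C.d → (Zq p k)[T;T⁻¹]) :
    C.comb W (fun i => toQq (v i)) = ∑ i, C.evO (v i) * C.b W i := by
  simp only [comb, evL_toQq]

theorem comb_mem_AX {w : Fin C.d → (Qq p k)[T;T⁻¹]} (hw : IsIntegralVec w) : C.comb W w ∈ C.AX := by
  obtain ⟨v, rfl⟩ := (isIntegralVec_iff_exists w).mp hw
  rw [comb_toQq]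
  exact sum_mem fun _ _ => mul_mem (C.evO_mem_AX _) (C.b_mem_AX W _)

/-- The powers of `y` in terms of the `b_j`, by the inverse matrix of `W`. -/
theorem pow_y_eq_sum (i : Fin C.d) :
    C.y ^ (i : ℕ) = ∑ j, C.evO ((W⁻¹).val j i) * C.b W j := by
  have h1 : ∀ l, ∑ j, C.evO (W.val l j) * C.evO ((W⁻¹).val j i) = if l = i then 1 else 0 := by
    intro l
    have h2 : (W.val * (W⁻¹).val) l i = (1 : Matrix _ _ _) l i := by
      rw [← Units.val_mul, mul_inv_cancel]
      rfl
    rw [Matrix.mul_apply, Matrix.one_apply] at h2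
    simp only [← map_mul, ← map_sum]
    rw [h2]
    split <;> simp
  simp only [b, Finset.mul_sum]
  rw [Finset.sum_comm]
  have h3 : ∀ l : Fin C.d, ∑ j, C.evO ((W⁻¹).val j i) * (C.evO (W.val l j) * C.y ^ (l : ℕ)) =
      (if l = i then 1 else 0) * C.y ^ (l : ℕ) := by
    intro l
    rw [← h1 l, Finset.sum_mul]
    exact Finset.sum_congr rfl fun j _ => by ring
  simp only [h3]
  simp

/-- The elements of `ℤ_q[x, 1/x, y]` are the integral combinations of the functions `b_i`. -/
theorem exists_comb_eq_of_mem_AX {h : C.L} (hh : h ∈ C.AX) :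
    ∃ w, IsIntegralVec w ∧ C.comb W w = h := by
  -- the integral combinations form a module under `ℤ_q[x, 1/x, y]`, and contain `1`
  let M : AddSubgroup C.L :=
    { carrier := {h | ∃ v : Fin C.d → (Zq p k)[T;T⁻¹], ∑ i, C.evO (v i) * C.b W i = h}
      zero_mem' := ⟨0, by simp⟩
      add_mem' := by
        rintro _ _ ⟨v, rfl⟩ ⟨w, rfl⟩
        exact ⟨v + w, by simp [add_mul, Finset.sum_add_distrib]⟩
      neg_mem' := by
        rintro _ ⟨v, rfl⟩
        exact ⟨-v, by simp⟩ }
  have hev : ∀ c, ∀ z ∈ M, C.evO c * z ∈ M := by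
    rintro c _ ⟨v, rfl⟩
    exact ⟨fun i => c * v i, by simp only [map_mul, Finset.mul_sum, mul_assoc]⟩
  have hpow : ∀ i ≤ C.d, C.y ^ i ∈ M := by
    have hlt : ∀ i < C.d, C.y ^ i ∈ M := fun i hi => ⟨_, (C.pow_y_eq_sum W ⟨i, hi⟩).symm⟩
    intro i hi
    rcases hi.lt_or_eq with hi | rfl
    · exact hlt i hi
    · have h1 := C.ev_Q
      rw [ev_eq_eval₂, Polynomial.eval₂_eq_sum_range, Finset.sum_range_succ,
        C.monic.coeff_natDegree, map_one, one_mul, add_eq_zero_iff_neg_eq] at h1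
      rw [← h1]
      refine neg_mem (sum_mem fun i hi => ?_)
      rw [← evO_toLaurent]
      exact hev _ _ (hlt i (Finset.mem_range.mp hi))
  have hy : ∀ z ∈ M, C.y * z ∈ M := by
    rintro _ ⟨v, rfl⟩
    rw [Finset.mul_sum]
    refine sum_mem fun i _ => ?_
    rw [mul_left_comm]
    refine hev _ _ ?_
    rw [b, Finset.mul_sum]
    refine sum_mem fun j _ => ?_
    rw [mul_left_comm]
    refine hev _ _ ?_
    rw [← pow_succ']
    exact hpow _ j.2
  have hM : ∀ h ∈ C.AX, ∀ z ∈ M, h * z ∈ M := by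
    intro h hh
    induction hh using Algebra.adjoin_induction with
    | mem h hh =>
      rcases hh with rfl | rfl | rfl
      · intro z hz
        simpa only [evO_T, zpow_one] using hev (LaurentPolynomial.T 1) z hz
      · intro z hz
        simpa only [evO_T, zpow_neg_one] using hev (LaurentPolynomial.T (-1)) z hz
      · exact hy
    | algebraMap c =>
      intro z hz
      simpa using hev (LaurentPolynomial.C c) z hz
    | add f g _ _ hf hg => exact fun z hz => add_mul f g z ▸ add_mem (hf z hz) (hg z hz)
    | mul f g _ _ hf hg => exact fun z hz => mul_assoc f g z ▸ hf _ (hg z hz)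
  obtain ⟨v, hv⟩ : h ∈ M := by
    have := hM h hh 1 (pow_zero C.y ▸ hpow 0 (Nat.zero_le _))
    rwa [mul_one] at this
  exact ⟨_, (isIntegralVec_iff_exists _).mpr ⟨v, rfl⟩, (C.comb_toQq W v).trans hv⟩

/-- Every element of a `ℚ_q`-algebra generated by a set `G` has a multiple in the `ℤ_q`-algebra generated
by `G`. -/
theorem exists_smul_mem_adjoin (G : Set C.L) {h : C.L} (hh : h ∈ Algebra.adjoin (Qq p k) G) :
    ∃ c : Zq p k, c ≠ 0 ∧ algebraMap (Zq p k) C.L c * h ∈ Algebra.adjoin (Zq p k) G := by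
  have hc : ∀ c, algebraMap (Zq p k) C.L c ∈ Algebra.adjoin (Zq p k) G :=
    fun c => Subalgebra.algebraMap_mem _ c
  induction hh using Algebra.adjoin_induction with
  | mem h hh => exact ⟨1, one_ne_zero, by simpa using Algebra.subset_adjoin hh⟩
  | algebraMap a =>
    obtain ⟨⟨b, c⟩, h⟩ := IsLocalization.surj (nonZeroDivisors (Zq p k)) a
    refine ⟨c, nonZeroDivisors.coe_ne_zero c, ?_⟩
    rw [IsScalarTower.algebraMap_apply (Zq p k) (Qq p k) C.L, ← map_mul, mul_comm, h,
      ← IsScalarTower.algebraMap_apply]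
    exact hc b
  | add f g _ _ hf hg =>
    obtain ⟨c, hc0, hcf⟩ := hf
    obtain ⟨e, he0, heg⟩ := hg
    refine ⟨c * e, mul_ne_zero hc0 he0, ?_⟩
    rw [map_mul]
    have := add_mem (mul_mem (hc e) hcf) (mul_mem (hc c) heg)
    convert this using 1
    ring
  | mul f g _ _ hf hg =>
    obtain ⟨c, hc0, hcf⟩ := hf
    obtain ⟨e, he0, heg⟩ := hg
    refine ⟨c * e, mul_ne_zero hc0 he0, ?_⟩
    rw [map_mul, mul_mul_mul_comm]
    exact mul_mem hcf heg

/-- The ring `ℚ_q[x, 1/x, y]`. -/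
noncomputable def AXK : Subalgebra (Qq p k) C.L := Algebra.adjoin (Qq p k) {C.x, C.x⁻¹, C.y}

theorem comb_div (c : Zq p k) (w : Fin C.d → (Qq p k)[T;T⁻¹]) :
    C.comb W (fun i => LaurentPolynomial.C (algebraMap (Zq p k) (Qq p k) c)⁻¹ * w i) =
      (algebraMap (Zq p k) C.L c)⁻¹ * C.comb W w := by
  rw [comb_mul, LaurentPolynomial.eval₂_C, map_inv₀, ← IsScalarTower.algebraMap_apply]

theorem exists_comb_eq_of_mem_AXK {h : C.L} (hh : h ∈ C.AXK) : ∃ w, C.comb W w = h := by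
  obtain ⟨c, hc, hch⟩ := C.exists_smul_mem_adjoin _ hh
  obtain ⟨w, -, hw⟩ := C.exists_comb_eq_of_mem_AX W hch
  refine ⟨_, (C.comb_div W c w).trans ?_⟩
  rw [hw, inv_mul_cancel_left₀]
  rwa [Ne, map_eq_zero_iff _ C.algebraMap_injective]

end CurveLift

/-! ### The points at infinity -/

namespace CurveLift

variable {p : ℕ} [Fact p.Prime] {k : Type u} [Field k] [Finite k] [CharP k p] (C : CurveLift p k)

open IsDedekindDomain

/-- The integral closure of `ℚ_q[1/x]` in the function field. -/
def BInf : Type u := integralClosure C.Kt C.L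

noncomputable instance : CommRing C.BInf := inferInstanceAs (CommRing (integralClosure C.Kt C.L))
instance : IsDomain C.BInf := inferInstanceAs (IsDomain (integralClosure C.Kt C.L))
noncomputable instance : Algebra C.Kt C.BInf :=
  inferInstanceAs (Algebra C.Kt (integralClosure C.Kt C.L))
noncomputable instance : Algebra (Qq p k) C.BInf :=
  inferInstanceAs (Algebra (Qq p k) (integralClosure C.Kt C.L))
noncomputable instance : Algebra C.BInf C.L :=
  inferInstanceAs (Algebra (integralClosure C.Kt C.L) C.L)
instance : FaithfulSMul C.BInf C.L :=
  (faithfulSMul_iff_algebraMap_injective _ _).mpr Subtype.coe_injective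
instance : IsScalarTower C.Kt C.BInf C.L :=
  IsScalarTower.of_algebraMap_eq fun _ => rfl
instance : IsScalarTower (Qq p k) C.Kt C.BInf :=
  inferInstanceAs (IsScalarTower (Qq p k) C.Kt (integralClosure C.Kt C.L))
instance : IsScalarTower (Qq p k) C.BInf C.L :=
  inferInstanceAs (IsScalarTower (Qq p k) (integralClosure C.Kt C.L) C.L)
instance : Algebra.IsIntegral C.Kt C.BInf :=
  inferInstanceAs (Algebra.IsIntegral C.Kt (integralClosure C.Kt C.L))

theorem mem_range_BInf {z : C.L} :
    z ∈ (algebraMap C.BInf C.L).range ↔ z ∈ integralClosure C.Kt C.L :=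
  ⟨fun ⟨b, hb⟩ => hb ▸ Subtype.property (p := fun z => z ∈ integralClosure C.Kt C.L) b,
    fun h => ⟨(⟨z, h⟩ : integralClosure C.Kt C.L), rfl⟩⟩

theorem inv_x_mem_Kt : C.x⁻¹ ∈ C.Kt := Algebra.subset_adjoin (by simp)

theorem mem_Kt_iff {z : C.L} : z ∈ C.Kt ↔ ∃ f : (Qq p k)[X], Polynomial.aeval C.x⁻¹ f = z := by
  rw [Kt, Algebra.adjoin_singleton_eq_range_aeval]
  rfl

instance : IsPrincipalIdealRing C.Kt := by
  let φ : (Qq p k)[X] →ₐ[Qq p k] C.Kt := Polynomial.aeval ⟨C.x⁻¹, C.inv_x_mem_Kt⟩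
  refine IsPrincipalIdealRing.of_surjective φ fun z => ?_
  obtain ⟨f, hf⟩ := C.mem_Kt_iff.mp z.2
  refine ⟨f, Subtype.ext (Eq.trans ?_ hf)⟩
  exact (Polynomial.aeval_algHom_apply C.Kt.val (⟨C.x⁻¹, C.inv_x_mem_Kt⟩ : C.Kt) f).symm

instance : Algebra.FiniteType (Qq p k) C.Kt :=
  Subalgebra.fg_iff_finiteType _ |>.mp ⟨{C.x⁻¹}, by simp [Kt]⟩

theorem exists_evL_mul_mem_Kt (f : (Qq p k)[T;T⁻¹]) : ∃ n : ℕ, C.evL f * C.x⁻¹ ^ n ∈ C.Kt := by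
  induction f using LaurentPolynomial.induction_on' with
  | add f g hf hg =>
    obtain ⟨m, hm⟩ := hf
    obtain ⟨n, hn⟩ := hg
    refine ⟨m + n, ?_⟩
    have := add_mem (mul_mem hm (pow_mem C.inv_x_mem_Kt n)) (mul_mem hn (pow_mem C.inv_x_mem_Kt m))
    convert this using 1
    rw [map_add]
    ring
  | C_mul_T n c =>
    refine ⟨n.toNat, ?_⟩
    rw [evL_C_mul_T, mul_assoc, ← zpow_natCast, ← zpow_neg_one, ← zpow_mul, ← zpow_add₀ C.x_ne_zero]
    refine mul_mem (C.Kt.algebraMap_mem c) ?_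
    have : n + -1 * (n.toNat : ℤ) = -((n.toNat - n).toNat : ℤ) := by omega
    rw [this, zpow_neg, zpow_natCast, ← inv_pow]
    exact pow_mem C.inv_x_mem_Kt _

/-- The function `1/x` in the integral closure of `ℚ_q[1/x]`. -/
noncomputable def sInf : C.BInf := algebraMap C.Kt C.BInf ⟨C.x⁻¹, C.inv_x_mem_Kt⟩

theorem algebraMap_sInf : algebraMap C.BInf C.L C.sInf = C.x⁻¹ := rfl

theorem inv_x_mem_range : C.x⁻¹ ∈ (algebraMap C.BInf C.L).range :=
  ⟨C.sInf, rfl⟩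

variable {C} {W : GL (Fin C.d) (Zq p k)[T;T⁻¹]}

namespace IsIntegralBasisAtInfinity

variable (hW : C.IsIntegralBasisAtInfinity W)

include hW

theorem b_mem (i : Fin C.d) : C.b W i ∈ integralClosure C.Kt C.L := by
  rw [← Subalgebra.mem_toSubmodule, ← hW.2]
  exact Submodule.subset_span ⟨i, rfl⟩

theorem finite : Module.Finite C.Kt C.BInf := by
  refine (Module.Finite.iff_fg (N := Subalgebra.toSubmodule (integralClosure C.Kt C.L))).mpr ?_
  rw [← hW.2]
  exact Submodule.fg_span (Set.finite_range _)

theorem comb_mul_mem (w : Fin C.d → (Qq p k)[T;T⁻¹]) :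
    ∃ n : ℕ, C.x⁻¹ ^ n * C.comb W w ∈ integralClosure C.Kt C.L := by
  have h1 : ∀ i, ∃ n : ℕ, C.evL (w i) * C.x⁻¹ ^ n ∈ C.Kt := fun i => C.exists_evL_mul_mem_Kt (w i)
  choose n hn using h1
  refine ⟨∑ i, n i, ?_⟩
  rw [comb, Finset.mul_sum]
  refine sum_mem fun i _ => ?_
  have h2 : C.evL (w i) * C.x⁻¹ ^ (∑ j, n j) ∈ C.Kt := by
    rw [← Finset.add_sum_erase _ _ (Finset.mem_univ i), pow_add, ← mul_assoc]
    exact mul_mem (hn i) (pow_mem C.inv_x_mem_Kt _)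
  rw [← mul_assoc, mul_comm (C.x⁻¹ ^ _)]
  exact mul_mem ((integralClosure C.Kt C.L).algebraMap_mem (⟨_, h2⟩ : C.Kt)) (hW.b_mem i)

theorem isFractionRing : IsFractionRing C.BInf C.L := by
  refine IsFractionRing.of_field _ _ fun z => ?_
  have h1 : ∀ a : C.A, ∃ n : ℕ, C.x⁻¹ ^ n * algebraMap C.A C.L a ∈ (algebraMap C.BInf C.L).range := by
    intro a
    have : algebraMap C.A C.L a ∈ C.AX := by
      obtain ⟨G, rfl⟩ := AdjoinRoot.mk_surjective a
      exact C.ev_mem_AX G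
    obtain ⟨w, -, hw⟩ := C.exists_comb_eq_of_mem_AX W this
    rw [← hw]
    obtain ⟨n, hn⟩ := hW.comb_mul_mem w
    exact ⟨n, C.mem_range_BInf.mpr hn⟩
  obtain ⟨a, b, hb, rfl⟩ := IsFractionRing.div_surjective (A := C.A) z
  obtain ⟨m, a', hm⟩ := h1 a
  obtain ⟨n, b', hn⟩ := h1 b
  have hs : C.x⁻¹ ≠ 0 := inv_ne_zero C.x_ne_zero
  refine ⟨C.sInf ^ n * a', C.sInf ^ m * b', ?_⟩
  rw [map_mul, map_mul, map_pow, map_pow, hm, hn, algebraMap_sInf, mul_left_comm,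
    mul_div_mul_left _ _ (pow_ne_zero _ hs), mul_div_mul_left _ _ (pow_ne_zero _ hs)]

theorem isDedekindDomain : IsDedekindDomain C.BInf := by
  have := hW.finite
  have := hW.isFractionRing
  have : IsNoetherianRing C.BInf := IsNoetherianRing.of_finite C.Kt C.BInf
  have : IsIntegrallyClosed C.BInf := by
    refine (isIntegrallyClosed_iff C.L).mpr fun {z} hz => ?_
    exact C.mem_range_BInf.mpr (isIntegral_trans (R := C.Kt) z hz)
  have : Ring.DimensionLEOne C.BInf := Ring.DimensionLEOne.integralClosure C.Kt C.L
  exact { }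

theorem finiteType : Algebra.FiniteType (Qq p k) C.BInf := by
  have := hW.finite
  exact Algebra.FiniteType.trans (S := C.Kt) inferInstance inferInstance

end IsIntegralBasisAtInfinity

section

variable (C)

/-- The derivation `x d/dx` of the function field. -/
noncomputable def theta : Derivation (Qq p k) C.L C.L := C.x • C.ddx

theorem theta_apply (f : C.L) : C.theta f = C.x * C.ddx f := rfl

theorem theta_inv_x : C.theta C.x⁻¹ = -C.x⁻¹ := by
  rw [theta_apply, Derivation.leibniz_inv, ddx_x, smul_eq_mul, mul_one]
  field_simp [C.x_ne_zero]

theorem theta_mem_Kt {f : C.L} (hf : f ∈ C.Kt) : C.theta f ∈ C.Kt := by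
  induction hf using Algebra.adjoin_induction with
  | mem f hf =>
    rw [Set.mem_singleton_iff.mp hf, theta_inv_x]
    exact neg_mem C.inv_x_mem_Kt
  | algebraMap c => rw [Derivation.map_algebraMap]; exact zero_mem _
  | add f g _ _ hf hg => rw [map_add]; exact add_mem hf hg
  | mul f g hf' hg' hf hg =>
    rw [Derivation.leibniz, smul_eq_mul, smul_eq_mul]
    exact add_mem (mul_mem hf' hg) (mul_mem hg' hf)

variable {C} [IsDedekindDomain C.BInf] [IsFractionRing C.BInf C.L]

/-- The points `P` at infinity are those where `1/x` vanishes, and its order there is `e_P`. -/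
theorem valuation_inv_x (P : HeightOneSpectrum C.BInf) (hP : P.valuation C.L C.x⁻¹ < 1) :
    P.valuation C.L C.x⁻¹ = WithZero.exp (-(P.asIdeal.ramificationIdx C.Kt : ℤ)) := by
  have hs : C.sInf ≠ 0 := by
    intro h
    have := congrArg (algebraMap C.BInf C.L) h
    rw [algebraMap_sInf, map_zero] at this
    exact inv_ne_zero C.x_ne_zero this
  let s0 : C.Kt := ⟨C.x⁻¹, C.inv_x_mem_Kt⟩
  have hmem : C.sInf ∈ P.asIdeal := by
    rw [← algebraMap_sInf] at hP
    exact (P.valuation_lt_one_iff_mem _).mp hP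
  have hover : P.asIdeal.LiesOver (Ideal.span {s0}) := by
    refine ⟨le_antisymm ?_ ?_⟩
    · rw [Ideal.span_le, Set.singleton_subset_iff]
      exact hmem
    · intro z hz
      obtain ⟨f, hf⟩ := C.mem_Kt_iff.mp z.2
      have h1 : z = s0 * Polynomial.aeval s0 f.divX + algebraMap _ _ (f.coeff 0) := by
        have h2 : z = Polynomial.aeval s0 f := by
          refine Subtype.ext (hf.symm.trans ?_)
          exact Polynomial.aeval_algHom_apply C.Kt.val s0 f
        rw [h2]
        conv_lhs => rw [← Polynomial.X_mul_divX_add f]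
        rw [map_add, map_mul, Polynomial.aeval_X, Polynomial.aeval_C]
      have hc : f.coeff 0 = 0 := by
        by_contra hc
        refine P.isPrime.ne_top (Ideal.eq_top_of_isUnit_mem _ (x := algebraMap C.Kt C.BInf
          (algebraMap _ _ (f.coeff 0))) ?_ (((IsUnit.mk0 _ hc).map _).map _))
        have h3 : algebraMap C.Kt C.BInf z ∈ P.asIdeal := hz
        rw [h1, map_add, map_mul] at h3
        exact (Ideal.add_mem_iff_right _ (Ideal.mul_mem_right _ _ hmem)).mp h3
      rw [h1, hc, map_zero, add_zero]
      exact Ideal.mul_mem_right _ _ (Ideal.mem_span_singleton_self _)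
  have hmap : (Ideal.span {s0}).map (algebraMap C.Kt C.BInf) = Ideal.span {C.sInf} := by
    rw [Ideal.map_span, Set.image_singleton]
    rfl
  have hbot : (Ideal.span {s0}).map (algebraMap C.Kt C.BInf) ≠ ⊥ := by
    rw [hmap]
    simpa using hs
  rw [← Ideal.ramificationIdx'_eq_ramificationIdx' (Ideal.span {s0}) P.asIdeal hbot,
    Ideal.IsDedekindDomain.ramificationIdx'_eq_multiplicity hbot P.isPrime, hmap, ← algebraMap_sInf,
    HeightOneSpectrum.valuation_of_algebraMap, P.intValuation_eq_exp_neg_multiplicity hs]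

theorem ramificationIdx_mem (P : HeightOneSpectrum C.BInf) (hP : P.valuation C.L C.x⁻¹ < 1) :
    P.asIdeal.ramificationIdx C.Kt ∈ C.ramificationIndicesAtInfinity := by
  refine ⟨P.asIdeal, P.isPrime, ⟨C.sInf, rfl, ?_⟩, rfl⟩
  rw [← algebraMap_sInf] at hP
  exact (P.valuation_lt_one_iff_mem _).mp hP

theorem ramificationIdx_ne_zero (P : HeightOneSpectrum C.BInf) (hP : P.valuation C.L C.x⁻¹ < 1) :
    P.asIdeal.ramificationIdx C.Kt ≠ 0 := by
  intro h
  rw [valuation_inv_x P hP, h] at hP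
  simp at hP

/-- `x d/dx` is a logarithmic vector field at the points at infinity.  It has bounded poles there, since the
integral closure is finitely generated by the `b_i`: a power `x⁻ᴺ` clears the poles of all `θ b_i`. -/
theorem valuation_theta_lt_one (hW : C.IsIntegralBasisAtInfinity W) (P : HeightOneSpectrum C.BInf)
    (hP : P.valuation C.L C.x⁻¹ < 1) (f : C.L) (hf : P.valuation C.L f ≤ 1) :
    P.valuation C.L (C.theta f) < 1 := by
  have := hW.finiteType
  have hPmax : P.asIdeal.IsMaximal := P.isMaximal
  let _ : Field (C.BInf ⧸ P.asIdeal) := Ideal.Quotient.field P.asIdeal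
  have hfin : Module.Finite (Qq p k) (C.BInf ⧸ P.asIdeal) :=
    finite_of_finite_type_of_isJacobsonRing (Qq p k) (C.BInf ⧸ P.asIdeal)
  have hint : Algebra.IsIntegral (Qq p k) (C.BInf ⧸ P.asIdeal) := Algebra.IsIntegral.of_finite _ _
  have hs0 : C.x⁻¹ ≠ 0 := inv_ne_zero C.x_ne_zero
  have h1 : ∀ i, ∃ n : ℕ, C.theta (C.b W i) ∈ ordFiltration C.BInf C.x⁻¹ (-n) := fun i =>
    exists_mem_ordFiltration hs0 C.inv_x_mem_range _
  choose n hn using h1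
  have hKt : ∀ z : C.L, z ∈ C.Kt → P.valuation C.L z ≤ 1 := fun z hz =>
    P.valuation_le_one (algebraMap C.Kt C.BInf ⟨z, hz⟩)
  have hKB : ∀ z : C.L, z ∈ integralClosure C.Kt C.L → P.valuation C.L z ≤ 1 := by
    intro z hz
    obtain ⟨b, rfl⟩ := C.mem_range_BInf.mpr hz
    exact P.valuation_le_one b
  -- `δ = x⁻ᴺ` is a common denominator for `x d/dx` on the integral closure
  set N := ∑ i, n i
  have hsN : P.valuation C.L (C.x⁻¹ ^ N) ≤ 1 := hKt _ (pow_mem C.inv_x_mem_Kt N)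
  refine P.valuation_derivation_lt_one (K := Qq p k) hint C.theta (C.x⁻¹ ^ N)
    (pow_ne_zero _ hs0) ?_ C.x⁻¹ hs0 hP C.theta_inv_x f hf
  intro b
  have hb : algebraMap C.BInf C.L b ∈ Submodule.span C.Kt (Set.range (C.b W)) := by
    rw [hW.2]
    exact C.mem_range_BInf.mp ⟨b, rfl⟩
  generalize algebraMap C.BInf C.L b = z at hb
  suffices P.valuation C.L z ≤ 1 ∧ P.valuation C.L (C.x⁻¹ ^ N * C.theta z) ≤ 1 from this.2
  induction hb using Submodule.span_induction with
  | mem z hz =>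
    obtain ⟨i, rfl⟩ := hz
    refine ⟨hKB _ (hW.b_mem i), ?_⟩
    have h2 := hn i P hP
    rw [map_mul, show N = n i + ∑ j ∈ Finset.univ.erase i, n j from
      (Finset.add_sum_erase _ _ (Finset.mem_univ i)).symm, pow_add, map_mul]
    have h3 : P.valuation C.L (C.x⁻¹ ^ ∑ x ∈ Finset.univ.erase i, n x) ≤ 1 :=
      hKt _ (pow_mem C.inv_x_mem_Kt _)
    have h4 : P.valuation C.L (C.x⁻¹ ^ n i) * P.valuation C.L (C.theta (C.b W i)) ≤ 1 := by
      refine (mul_le_mul_right h2 _).trans ?_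
      rw [map_pow, zpow_neg, zpow_natCast, mul_inv_cancel₀]
      exact pow_ne_zero _ ((Valuation.ne_zero_iff _).mpr hs0)
    rw [mul_right_comm]
    exact mul_le_one' h4 h3
  | zero => simp
  | add f g _ _ hf hg =>
    refine ⟨(Valuation.map_add_le _ hf.1 hg.1), ?_⟩
    rw [map_add, mul_add]
    exact Valuation.map_add_le _ hf.2 hg.2
  | smul c f _ hf =>
    have hc : c • f = (c : C.L) * f := rfl
    rw [hc, Derivation.leibniz, smul_eq_mul, smul_eq_mul, map_mul, mul_add]
    refine ⟨mul_le_one' (hKt _ c.2) hf.1, Valuation.map_add_le _ ?_ ?_⟩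
    · rw [mul_left_comm, map_mul]
      exact mul_le_one' (hKt _ c.2) hf.2
    · rw [map_mul, map_mul]
      exact mul_le_one' hsN (mul_le_one' hf.1 (hKt _ (C.theta_mem_Kt c.2)))

end

end CurveLift

/-! ### The order at infinity of coefficient vectors -/

theorem LaurentPolynomial.le_ordInfty_iff {A : Type*} [Semiring A] {f : A[T;T⁻¹]} {J : ℤ} :
    (J : WithTop ℤ) ≤ f.ordInfty ↔ ∀ n, f.coeff n ≠ 0 → J ≤ -n := by
  simp [LaurentPolynomial.ordInfty, Finset.le_min_iff]

namespace CurveLift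

variable {p : ℕ} [Fact p.Prime] {k : Type u} [Field k] [Finite k] [CharP k p] (C : CurveLift p k)

open IsDedekindDomain

theorem le_ordInf_iff {K : Type*} [Semiring K] {n : ℕ} {w : Fin n → K[T;T⁻¹]} {J : ℤ} :
    (J : WithTop ℤ) ≤ ordInf w ↔ ∀ i n, (w i).coeff n ≠ 0 → J ≤ -n := by
  simp only [ordInf, Finset.le_inf_iff, Finset.mem_univ, true_imp_iff,
    LaurentPolynomial.le_ordInfty_iff]

theorem evL_eq_sum (f : (Qq p k)[T;T⁻¹]) :
    C.evL f = ∑ n ∈ f.coeff.support, algebraMap (Qq p k) C.L (f.coeff n) * C.x ^ n := by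
  have h1 : f = ∑ n ∈ f.coeff.support, AddMonoidAlgebra.single n (f.coeff n) := by
    ext n
    rw [AddMonoidAlgebra.coeff_sum, Finsupp.finsetSum_apply]
    simp only [AddMonoidAlgebra.coeff_single, Finsupp.single_apply]
    simp +contextual
  conv_lhs => rw [h1]
  rw [map_sum]
  refine Finset.sum_congr rfl fun n _ => ?_
  rw [LaurentPolynomial.single_eq_C_mul_T, evL_C_mul_T]

variable [IsDedekindDomain C.BInf] [IsFractionRing C.BInf C.L]

/-- The functions whose order at every point over `x = ∞` is at least `J` times the order of `1/x`. -/
noncomputable abbrev Fil (J : ℤ) : AddSubgroup C.L := ordFiltration C.BInf C.x⁻¹ J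

variable {C}

theorem mul_mem_Fil {i j : ℤ} {f g : C.L} (hf : f ∈ C.Fil i) (hg : g ∈ C.Fil j) :
    f * g ∈ C.Fil (i + j) :=
  mul_mem_ordFiltration (inv_ne_zero C.x_ne_zero) hf hg

theorem Fil_antitone : Antitone C.Fil := ordFiltration_antitone (inv_ne_zero C.x_ne_zero)

theorem zpow_x_mem_Fil (n : ℤ) : C.x ^ n ∈ C.Fil (-n) := by
  have := zpow_mem_ordFiltration (B := C.BInf) C.x⁻¹ (-n)
  rwa [inv_zpow, zpow_neg, inv_inv] at this

theorem algebraMap_Qq_mul_mem_Fil (c : Qq p k) {J : ℤ} {h : C.L} (hh : h ∈ C.Fil J) :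
    algebraMap (Qq p k) C.L c * h ∈ C.Fil J :=
  algebraMap_field_mul_mem_ordFiltration c hh

theorem algebraMap_Zq_mul_mem_Fil (c : Zq p k) {J : ℤ} {h : C.L} (hh : h ∈ C.Fil J) :
    algebraMap (Zq p k) C.L c * h ∈ C.Fil J := by
  rw [IsScalarTower.algebraMap_apply (Zq p k) (Qq p k) C.L]
  exact algebraMap_Qq_mul_mem_Fil _ hh

theorem exists_mem_Fil (h : C.L) : ∃ n : ℕ, h ∈ C.Fil (-n) :=
  exists_mem_ordFiltration (inv_ne_zero C.x_ne_zero) C.inv_x_mem_range h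

theorem one_mem_Fil : (1 : C.L) ∈ C.Fil 0 := by
  simpa using zpow_x_mem_Fil (C := C) 0

variable {W : GL (Fin C.d) (Zq p k)[T;T⁻¹]}

namespace IsIntegralBasisAtInfinity

variable (hW : C.IsIntegralBasisAtInfinity W)
include hW

theorem b_mem_Fil (i : Fin C.d) : C.b W i ∈ C.Fil 0 := by
  obtain ⟨b, hb⟩ := C.mem_range_BInf.mpr (hW.b_mem i)
  rw [← hb]
  exact algebraMap_mem_ordFiltration _ b

omit [IsDedekindDomain C.BInf] [IsFractionRing C.BInf C.L] in
theorem comb_injective : Function.Injective (C.comb W) := by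
  intro v w hvw
  rw [← sub_eq_zero, ← comb_sub] at hvw
  rw [← sub_eq_zero]
  set w := v - w
  -- a relation over `ℚ_q[x, 1/x]` becomes one over `ℚ_q[1/x]` after division by a power of `x`
  choose n hn using fun i => C.exists_evL_mul_mem_Kt (w i)
  have hmem : ∀ i, C.evL (w i) * C.x⁻¹ ^ (∑ j, n j) ∈ C.Kt := by
    intro i
    rw [← Finset.add_sum_erase _ _ (Finset.mem_univ i), pow_add, ← mul_assoc]
    exact mul_mem (hn i) (pow_mem C.inv_x_mem_Kt _)
  have h1 : ∑ i, (⟨_, hmem i⟩ : C.Kt) • C.b W i = 0 := by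
    have h2 : ∀ i, (⟨_, hmem i⟩ : C.Kt) • C.b W i =
        C.x⁻¹ ^ (∑ j, n j) * (C.evL (w i) * C.b W i) := by
      intro i
      change C.evL (w i) * C.x⁻¹ ^ (∑ j, n j) * C.b W i = _
      ring
    rw [Finset.sum_congr rfl fun i _ => h2 i, ← Finset.mul_sum]
    change _ * C.comb W w = 0
    rw [hvw, mul_zero]
  have h3 := Fintype.linearIndependent_iff.mp hW.1 _ h1
  funext i
  have h4 := congrArg Subtype.val (h3 i)
  have h5 : C.evL (w i) = 0 :=
    (mul_eq_zero.mp h4).resolve_right (pow_ne_zero _ (inv_ne_zero C.x_ne_zero))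
  exact C.evL_injective (h5.trans (map_zero _).symm)

/-- The order at infinity of a coefficient vector is the order at infinity of the function: if `f` has order
at least `J`, then `x ^ J f` is integral over `ℚ_q[1/x]`, and the `b_i` are an integral basis. -/
theorem comb_mem_Fil_iff {w : Fin C.d → (Qq p k)[T;T⁻¹]} {J : ℤ} :
    C.comb W w ∈ C.Fil J ↔ (J : WithTop ℤ) ≤ ordInf w := by
  constructor
  · intro h
    obtain ⟨n, hn⟩ := hW.comb_mul_mem w
    have h1 : C.x ^ J * C.comb W w ∈ (algebraMap C.BInf C.L).range := by
      have h2 : C.x ^ J * C.comb W w ∈ C.Fil 0 := by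
        simpa using mul_mem_Fil (zpow_x_mem_Fil J) h
      refine exists_algebraMap_eq_of_mem_ordFiltration C.inv_x_mem_range h2 (n + J.toNat) ?_
      refine C.mem_range_BInf.mpr ?_
      have h3 : C.x⁻¹ ^ (n + J.toNat) * (C.x ^ J * C.comb W w) =
          C.x⁻¹ ^ (J.toNat - J).toNat * (C.x⁻¹ ^ n * C.comb W w) := by
        have h4 : C.x⁻¹ ^ J.toNat * C.x ^ J = C.x⁻¹ ^ (J.toNat - J).toNat := by
          rw [← zpow_natCast, ← zpow_natCast, inv_zpow', inv_zpow', ← zpow_add₀ C.x_ne_zero]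
          congr 1
          omega
        rw [← h4]
        ring
      rw [h3]
      exact mul_mem (pow_mem ((integralClosure C.Kt C.L).algebraMap_mem
        (⟨_, C.inv_x_mem_Kt⟩ : C.Kt)) _) hn
    rw [C.mem_range_BInf, ← Subalgebra.mem_toSubmodule, ← hW.2,
      Submodule.mem_span_range_iff_exists_fun] at h1
    obtain ⟨c, hc⟩ := h1
    choose P hP using fun i => C.mem_Kt_iff.mp (c i).2
    let v : Fin C.d → (Qq p k)[T;T⁻¹] := fun i =>
      ∑ j ∈ Finset.range ((P i).natDegree + 1),
        LaurentPolynomial.C ((P i).coeff j) * LaurentPolynomial.T (-J - j)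
    have hv : ∀ i, C.evL (v i) = C.x ^ (-J) * c i := by
      intro i
      rw [← hP i, Polynomial.aeval_eq_sum_range, map_sum, Finset.mul_sum]
      refine Finset.sum_congr rfl fun j _ => ?_
      rw [evL_C_mul_T, zpow_sub₀ C.x_ne_zero, Algebra.smul_def, zpow_natCast, inv_pow]
      ring
    have hvw : v = w := by
      apply hW.comb_injective
      rw [comb]
      have h5 : ∀ i, C.evL (v i) * C.b W i = C.x ^ (-J) * (c i • C.b W i) := by
        intro i
        rw [hv, mul_assoc]
        rfl
      rw [Finset.sum_congr rfl fun i _ => h5 i, ← Finset.mul_sum, hc, ← mul_assoc,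
        ← zpow_add₀ C.x_ne_zero]
      simp
    rw [← hvw, le_ordInf_iff]
    intro i m hm
    rw [AddMonoidAlgebra.coeff_sum, Finsupp.finsetSum_apply] at hm
    obtain ⟨j, -, hj⟩ := Finset.exists_ne_zero_of_sum_ne_zero hm
    rw [← LaurentPolynomial.single_eq_C_mul_T, AddMonoidAlgebra.coeff_single,
      Finsupp.single_apply] at hj
    have : -J - j = m := by
      by_contra hcon
      exact hj (if_neg hcon)
    omega
  · intro h
    rw [le_ordInf_iff] at h
    refine sum_mem fun i _ => ?_
    have h1 : C.evL (w i) ∈ C.Fil J := by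
      rw [evL_eq_sum]
      refine sum_mem fun n hn => algebraMap_Qq_mul_mem_Fil _ ?_
      exact Fil_antitone (h i n (Finsupp.mem_support_iff.mp hn)) (zpow_x_mem_Fil n)
    simpa using mul_mem_Fil h1 (hW.b_mem_Fil i)

end IsIntegralBasisAtInfinity

/-! ### Functions integral at infinity up to a given order -/

variable (C) in
/-- The functions which agree up to order `J` at infinity with an element of `ℤ_q[x, 1/x, y]`. -/
noncomputable def intFil (J : ℤ) : AddSubgroup C.L := C.AX.toSubring.toAddSubgroup ⊔ C.Fil J

theorem mem_intFil {J : ℤ} {h : C.L} :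
    h ∈ C.intFil J ↔ ∃ a ∈ C.AX, ∃ f ∈ C.Fil J, a + f = h := AddSubgroup.mem_sup

theorem mem_intFil_of_mem_AX {J : ℤ} {h : C.L} (hh : h ∈ C.AX) : h ∈ C.intFil J :=
  mem_intFil.mpr ⟨h, hh, 0, zero_mem _, add_zero h⟩

theorem mem_intFil_of_mem_Fil {J : ℤ} {h : C.L} (hh : h ∈ C.Fil J) : h ∈ C.intFil J :=
  mem_intFil.mpr ⟨0, zero_mem _, h, hh, zero_add h⟩

theorem x_mul_mem_intFil {J : ℤ} {h : C.L} (hh : h ∈ C.intFil (J + 1)) : C.x * h ∈ C.intFil J := by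
  obtain ⟨a, ha, f, hf, rfl⟩ := mem_intFil.mp hh
  refine mem_intFil.mpr ⟨C.x * a, mul_mem C.x_mem_AX ha, C.x * f, ?_, by ring⟩
  have := mul_mem_Fil (zpow_x_mem_Fil (C := C) 1) hf
  rwa [zpow_one, neg_add_cancel_comm_assoc] at this

/-- Coefficients of a function which is integral up to order `J` at infinity are integral in orders
less than `J`. -/
theorem IsIntegralBasisAtInfinity.coeff_mem_range (hW : C.IsIntegralBasisAtInfinity W)
    {v : Fin C.d → (Qq p k)[T;T⁻¹]} {J : ℤ} (hv : C.comb W v ∈ C.intFil J) (i : Fin C.d) (n : ℤ)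
    (hn : -n < J) : (v i).coeff n ∈ Set.range (algebraMap (Zq p k) (Qq p k)) := by
  obtain ⟨a, ha, f, hf, haf⟩ := mem_intFil.mp hv
  obtain ⟨w, hw, rfl⟩ := C.exists_comb_eq_of_mem_AX W ha
  rw [← eq_sub_iff_add_eq', ← comb_sub] at haf
  rw [haf, hW.comb_mem_Fil_iff, le_ordInf_iff] at hf
  have h1 : (v i).coeff n = (w i).coeff n := by
    by_contra hcon
    have := hf i n (by simpa [sub_eq_zero] using hcon)
    omega
  rw [h1]
  exact hw i n

variable (C) in
/-- The functions which are integral at infinity up to every order.  They form a ring although the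
`intFil J` do not, because every function has a bounded pole at infinity. -/
noncomputable def integralAtInfinity : Subalgebra (Zq p k) C.L where
  carrier := {h | ∀ J, h ∈ C.intFil J}
  add_mem' hf hg J := add_mem (hf J) (hg J)
  algebraMap_mem' c _ := mem_intFil_of_mem_AX (C.AX.algebraMap_mem c)
  mul_mem' := by
    intro g h hg hh J
    obtain ⟨n', hn'⟩ := exists_mem_Fil h
    obtain ⟨a, ha, f, hf, rfl⟩ := mem_intFil.mp (hg (J + n'))
    obtain ⟨n, hn⟩ := exists_mem_Fil a
    obtain ⟨a', ha', f', hf', haf'⟩ := mem_intFil.mp (hh (J + n))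
    refine mem_intFil.mpr ⟨a * a', mul_mem ha ha', a * f' + f * h, add_mem ?_ ?_, ?_⟩
    · have := mul_mem_Fil hn hf'
      rwa [neg_add_cancel_comm_assoc] at this
    · have := mul_mem_Fil hf hn'
      rwa [add_neg_cancel_right] at this
    · rw [← haf']
      ring

theorem incl_mem_Fil {f : (Zq p k)[X]} {N : ℤ} (h : ∀ i, f.coeff i ≠ 0 → (i : ℤ) ≤ N) :
    C.incl f ∈ C.Fil (-N) := by
  rw [incl_eq_eval₂RingHom, Polynomial.coe_eval₂RingHom, Polynomial.eval₂_eq_sum_range]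
  refine sum_mem fun i _ => ?_
  by_cases hi : f.coeff i = 0
  · rw [hi, map_zero, zero_mul]
    exact zero_mem _
  · refine algebraMap_Zq_mul_mem_Fil _ (Fil_antitone (neg_le_neg (h i hi)) ?_)
    simpa using zpow_x_mem_Fil (C := C) i

/-- A polynomial with invertible leading coefficient is invertible in the integral functions at infinity,
by the geometric series. -/
theorem inv_incl_mem_Fil_and_mem_integralAtInfinity {f : (Zq p k)[X]} (hf : IsUnit f.leadingCoeff) :
    (C.incl f)⁻¹ ∈ C.Fil f.natDegree ∧ (C.incl f)⁻¹ ∈ C.integralAtInfinity := by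
  obtain ⟨u, hu⟩ := hf
  let c : Zq p k := (u⁻¹ : (Zq p k)ˣ)
  have hf0 : C.incl f ≠ 0 := by
    rw [map_ne_zero_iff _ C.incl_injective]
    rintro rfl
    exact u.ne_zero (by simp at hu)
  set D := f.natDegree
  set α := algebraMap (Zq p k) C.L
  have hcu : α c * α f.leadingCoeff = 1 := by
    rw [← map_mul, ← hu, Units.inv_mul, map_one]
  have hsplit : C.incl f = α f.leadingCoeff * C.x ^ (D : ℤ) + C.incl f.eraseLead := by
    conv_lhs => rw [← f.eraseLead_add_C_mul_X_pow, map_add, map_mul, map_pow]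
    have : C.incl (Polynomial.C f.leadingCoeff) = α f.leadingCoeff := by
      rw [incl_eq_eval₂RingHom]
      simp [α]
    rw [this, zpow_natCast, add_comm]
    rfl
  have hxD : C.x ^ (D : ℤ) * C.x ^ (-(D : ℤ)) = 1 := by
    rw [← zpow_add₀ C.x_ne_zero]
    simp
  -- `f = (leading term) * (1 - t)` with `t` integral and vanishing at infinity
  set t : C.L := -(α c * (C.x ^ (-(D : ℤ)) * C.incl f.eraseLead)) with ht
  have htAX : t ∈ C.AX := neg_mem (mul_mem (C.AX.algebraMap_mem c)
    (mul_mem (C.zpow_x_mem_AX _) (C.incl_mem_AX _)))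
  have ht1 : t ∈ C.Fil 1 := by
    refine neg_mem (algebraMap_Zq_mul_mem_Fil _ ?_)
    have h1 : C.incl f.eraseLead ∈ C.Fil (-((D : ℤ) - 1)) := by
      refine incl_mem_Fil fun i hi => ?_
      rw [Polynomial.eraseLead_coeff] at hi
      have h2 : i ≠ D := fun h => hi (if_pos h)
      rw [if_neg h2] at hi
      have := Polynomial.le_natDegree_of_ne_zero hi
      omega
    have := mul_mem_Fil (zpow_x_mem_Fil (-(D : ℤ))) h1
    rwa [show (- -(D : ℤ) + -((D : ℤ) - 1)) = 1 by ring] at this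
  have h1t : 1 - t = α c * C.x ^ (-(D : ℤ)) * C.incl f := by
    rw [ht, hsplit]
    linear_combination (-1 : C.L) * hcu - α c * α f.leadingCoeff * hxD
  have h1t0 : 1 - t ≠ 0 := by
    rw [h1t]
    refine mul_ne_zero (mul_ne_zero ?_ (zpow_ne_zero _ C.x_ne_zero)) hf0
    intro h
    rw [h, zero_mul] at hcu
    exact zero_ne_one hcu
  have hinv : (C.incl f)⁻¹ = α c * (C.x ^ (-(D : ℤ)) * (1 - t)⁻¹) := by
    rw [← mul_assoc, eq_mul_inv_iff_mul_eq₀ h1t0, h1t]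
    field_simp
  have h0 : (1 - t)⁻¹ ∈ C.Fil 0 := by
    intro P hP
    have h2 : P.valuation C.L t < 1 := (ht1 P hP).trans_lt (by simpa using hP)
    rw [map_inv₀, Valuation.map_one_sub_of_lt _ h2]
    simp
  have hD : (C.incl f)⁻¹ ∈ C.Fil D := by
    rw [hinv]
    refine algebraMap_Zq_mul_mem_Fil _ ?_
    simpa using mul_mem_Fil (zpow_x_mem_Fil (-(D : ℤ))) h0
  refine ⟨hD, fun J => ?_⟩
  have hpow : ∀ n : ℕ, t ^ n ∈ C.Fil n := by
    intro n
    induction n with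
    | zero => simpa using one_mem_Fil (C := C)
    | succ n ih =>
      rw [pow_succ, Nat.cast_succ]
      exact mul_mem_Fil ih ht1
  refine mem_intFil.mpr ⟨α c * (C.x ^ (-(D : ℤ)) * ∑ i ∈ Finset.range J.toNat, t ^ i),
    mul_mem (C.AX.algebraMap_mem c) (mul_mem (C.zpow_x_mem_AX _)
      (sum_mem fun i _ => pow_mem htAX i)), t ^ J.toNat * (C.incl f)⁻¹,
    Fil_antitone ?_ (mul_mem_Fil (hpow _) hD), ?_⟩
  · have := Int.self_le_toNat J
    omega
  · have hgeom := mul_neg_geom_sum t J.toNat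
    have hsum : ∑ i ∈ Finset.range J.toNat, t ^ i = (1 - t ^ J.toNat) * (1 - t)⁻¹ := by
      rw [← hgeom, mul_comm (1 - t), mul_inv_cancel_right₀ h1t0]
    rw [hinv, hsum]
    clear_value t
    ring

end CurveLift

/-! ### Binomial coefficients of `x d/dx` -/

theorem succ_mul_binomPoly (n : ℕ) : Polynomial.C ((n : ℚ) + 1) * binomPoly (n + 1) =
    (Polynomial.X - Polynomial.C (n : ℚ)) * binomPoly n := by
  have h1 : ((n : ℚ) + 1) * ((n + 1).factorial : ℚ)⁻¹ = (n.factorial : ℚ)⁻¹ := by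
    rw [Nat.factorial_succ]
    push_cast
    field_simp
  rw [binomPoly, ← mul_assoc, ← map_mul, h1, descPochhammer_succ_right, binomPoly]
  simp only [map_natCast]
  ring

section

variable {K L : Type*} [Field K] [Field L] [Algebra K L] [CharZero L]

theorem Derivation.taylor_of_eq_zero (D : Derivation K L L) {c : L} (hc : D c = 0) :
    D.taylor c = PowerSeries.C c := by
  ext n
  rw [D.coeff_taylor, PowerSeries.coeff_C]
  cases n with
  | zero => simp [Derivation.dividedPow_zero]
  | succ n =>
    have h1 : ((n : L) + 1) ≠ 0 := by exact_mod_cast n.succ_ne_zero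
    apply mul_right_cancel₀ h1
    rw [D.succ_mul_dividedPow, hc]
    simp [Derivation.dividedPow]

theorem Derivation.taylor_of_eq_one (D : Derivation K L L) {x : L} (hx : D x = 1) :
    D.taylor x = PowerSeries.C x + PowerSeries.X := by
  ext n
  cases n with
  | zero => simp [D.coeff_taylor, Derivation.dividedPow_zero]
  | succ n =>
    have h1 : ((n : L) + 1) ≠ 0 := by exact_mod_cast n.succ_ne_zero
    apply mul_right_cancel₀ h1
    rw [D.coeff_taylor, D.succ_mul_dividedPow, hx, ← D.coeff_taylor,
      D.taylor_of_eq_zero D.map_one_eq_zero]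
    cases n <;> simp [PowerSeries.coeff_X]

/-- `binom(x ∂, n) = xⁿ ∂ⁿ / n!` for a derivation with `∂ x = 1`. -/
theorem Derivation.aeval_binomPoly (D : Derivation K L L) {x : L} (hx : D x = 1) (n : ℕ) (f : L) :
    Polynomial.aeval (x • D).toRatLinearMap (binomPoly n) f = x ^ n * D.dividedPow n f := by
  induction n with
  | zero => simp [binomPoly, Derivation.dividedPow_zero]
  | succ n ih =>
    have h1 : ((n : L) + 1) ≠ 0 := by exact_mod_cast n.succ_ne_zero
    apply mul_left_cancel₀ h1
    have h2 := congrArg (fun q => Polynomial.aeval (x • D).toRatLinearMap q f) (succ_mul_binomPoly n)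
    simp only [map_mul, Module.End.mul_apply, ih, map_sub, Polynomial.aeval_X, Polynomial.aeval_C,
      LinearMap.sub_apply, Module.algebraMap_end_apply] at h2
    rw [Algebra.smul_def, Algebra.smul_def] at h2
    simp only [map_add, map_one, eq_ratCast, Rat.cast_natCast] at h2
    rw [h2, Derivation.toRatLinearMap_apply, Derivation.smul_apply, Derivation.leibniz,
      Derivation.leibniz_pow, hx]
    have h3 : D (D.dividedPow n f) = D.dividedPow (n + 1) f * ((n : L) + 1) := by
      have h4 : D ((n.factorial : L)⁻¹) = 0 := by
        rw [Derivation.leibniz_inv, Derivation.map_natCast, smul_zero]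
      rw [D.succ_mul_dividedPow, Derivation.dividedPow, Derivation.dividedPow, Derivation.leibniz, h4,
        smul_zero, add_zero, smul_eq_mul, ← Function.iterate_succ_apply' D, Function.iterate_succ_apply D]
    rw [h3]
    simp only [smul_eq_mul, nsmul_eq_mul, mul_one]
    rcases n with _ | n
    · simp
    · simp only [Nat.add_sub_cancel]
      push_cast
      ring

end

namespace CurveLift

variable {p : ℕ} [Fact p.Prime] {k : Type u} [Field k] [Finite k] [CharP k p] (C : CurveLift p k)

open IsDedekindDomain

/-- The ring `ℤ_q[x, 1/x, y, 1/Δ]`. -/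
noncomputable def AXD : Subalgebra (Zq p k) C.L :=
  Algebra.adjoin (Zq p k) {C.x, C.x⁻¹, C.y, (C.incl C.Q.discr)⁻¹}

theorem inv_discr_mem_AXD : (C.incl C.Q.discr)⁻¹ ∈ C.AXD := Algebra.subset_adjoin (by simp)

theorem AX_le_AXD : C.AX ≤ C.AXD := Algebra.adjoin_mono (by
  intro z hz
  simp only [Set.mem_insert_iff, Set.mem_singleton_iff] at hz ⊢
  tauto)

theorem incl_discr_ne_zero : C.incl C.Q.discr ≠ 0 :=
  (map_ne_zero_iff _ C.incl_injective).mpr C.discr_ne_zero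

theorem inv_Qy_mem_AXD : C.Qy⁻¹ ∈ C.AXD := by
  obtain ⟨V, hV⟩ := C.exists_Qy_mul_eq_discr
  have : C.Qy⁻¹ = C.ev V * (C.incl C.Q.discr)⁻¹ := by
    rw [eq_mul_inv_iff_mul_eq₀ C.incl_discr_ne_zero, ← hV, inv_mul_cancel_left₀ C.Qy_ne_zero]
  rw [this]
  exact mul_mem (C.AX_le_AXD (C.ev_mem_AX V)) C.inv_discr_mem_AXD

theorem inv_r_mem_AXD : (C.incl C.r)⁻¹ ∈ C.AXD := by
  have : (C.incl C.r)⁻¹ = C.incl C.g * (C.incl C.Q.discr)⁻¹ := by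
    rw [eq_mul_inv_iff_mul_eq₀ C.incl_discr_ne_zero, C.disc_eq, map_mul, mul_comm (C.incl C.g),
      inv_mul_cancel_left₀ C.incl_r_ne_zero]
  rw [this]
  exact mul_mem (C.AX_le_AXD (C.incl_mem_AX C.g)) C.inv_discr_mem_AXD

theorem R_le_AXD : C.R ≤ C.AXD := by
  refine Algebra.adjoin_le ?_
  rintro z (rfl | rfl | rfl)
  · exact C.AX_le_AXD C.x_mem_AX
  · exact C.inv_r_mem_AXD
  · exact C.AX_le_AXD C.y_mem_AX

theorem taylor_x : C.ddx.taylor C.x = PowerSeries.C C.x + PowerSeries.X :=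
  C.ddx.taylor_of_eq_one C.ddx_x

theorem taylor_algebraMap (c : Zq p k) :
    C.ddx.taylor (algebraMap (Zq p k) C.L c) = PowerSeries.C (algebraMap (Zq p k) C.L c) :=
  C.ddx.taylor_of_eq_zero (C.ddx_algebraMap_Zq c)

theorem constantCoeff_taylor (f : C.L) : PowerSeries.constantCoeff (C.ddx.taylor f) = f := by
  rw [← PowerSeries.coeff_zero_eq_constantCoeff_apply, Derivation.coeff_taylor,
    Derivation.dividedPow_zero]

theorem dividedPow_inv_x_mem_AXD (n : ℕ) : C.ddx.dividedPow n C.x⁻¹ ∈ C.AXD := by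
  let S : Subring C.L := C.AXD.toSubring
  have hx : C.x ∈ S := C.AX_le_AXD C.x_mem_AX
  let t : PowerSeries S := PowerSeries.C ⟨C.x, hx⟩ + PowerSeries.X
  have ht : PowerSeries.map S.subtype t = C.ddx.taylor C.x := by
    rw [taylor_x, map_add, PowerSeries.map_C, PowerSeries.map_X]
    rfl
  rw [← Derivation.coeff_taylor]
  -- the Taylor expansion of `1/x` is the root of `(x + u) X - 1`
  refine PowerSeries.coeff_mem_of_eval_eq_zero S (Polynomial.C t * Polynomial.X - 1) _ ?_ ?_ C.x⁻¹
    (C.AX_le_AXD C.inv_x_mem_AX) ?_ n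
  · rw [Polynomial.eval₂_sub, Polynomial.eval₂_mul, Polynomial.eval₂_C, Polynomial.eval₂_X,
      Polynomial.eval₂_one, ht, ← map_mul, mul_inv_cancel₀ C.x_ne_zero, map_one, sub_self]
  · rw [constantCoeff_taylor]
    exact C.AX_le_AXD C.inv_x_mem_AX
  · rw [Polynomial.derivative_sub, Polynomial.derivative_one, sub_zero,
      Polynomial.derivative_C_mul, Polynomial.derivative_X, mul_one, Polynomial.eval₂_C, ht,
      constantCoeff_taylor, mul_inv_cancel₀ C.x_ne_zero]

theorem dividedPow_y_mem_AXD (n : ℕ) : C.ddx.dividedPow n C.y ∈ C.AXD := by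
  let S : Subring C.L := C.AXD.toSubring
  have hx : C.x ∈ S := C.AX_le_AXD C.x_mem_AX
  let t : PowerSeries S := PowerSeries.C ⟨C.x, hx⟩ + PowerSeries.X
  have ht : PowerSeries.map S.subtype t = C.ddx.taylor C.x := by
    rw [taylor_x, map_add, PowerSeries.map_C, PowerSeries.map_X]
    rfl
  let c : Zq p k →+* S := (algebraMap (Zq p k) C.L).codRestrict S fun a => C.AXD.algebraMap_mem a
  let φ : (Zq p k)[X] →+* PowerSeries S := Polynomial.eval₂RingHom (PowerSeries.C.comp c) t
  have hφ : (PowerSeries.map S.subtype).comp φ = C.ddx.taylor.comp C.incl := by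
    apply Polynomial.ringHom_ext
    · intro a
      rw [RingHom.comp_apply, RingHom.comp_apply, incl_eq_eval₂RingHom, Polynomial.coe_eval₂RingHom,
        Polynomial.coe_eval₂RingHom, Polynomial.eval₂_C, Polynomial.eval₂_C, taylor_algebraMap,
        RingHom.comp_apply, PowerSeries.map_C]
      rfl
    · rw [RingHom.comp_apply, Polynomial.coe_eval₂RingHom, Polynomial.eval₂_X, ht]
      rfl
  have hev : ∀ G : (Zq p k)[X][X], (G.map φ).eval₂ (PowerSeries.map S.subtype) (C.ddx.taylor C.y) =
      C.ddx.taylor (C.ev G) := by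
    intro G
    rw [Polynomial.eval₂_map, hφ, ev_eq_eval₂, Polynomial.hom_eval₂]
  rw [← Derivation.coeff_taylor]
  refine PowerSeries.coeff_mem_of_eval_eq_zero S (C.Q.map φ) _ ?_ ?_ C.Qy⁻¹
    C.inv_Qy_mem_AXD ?_ n
  · rw [hev, ev_Q, map_zero]
  · rw [constantCoeff_taylor]
    exact C.AX_le_AXD C.y_mem_AX
  · rw [Polynomial.derivative_map, hev, constantCoeff_taylor]
    exact mul_inv_cancel₀ C.Qy_ne_zero

/-- The divided powers of `d/dx` map `ℤ_q[x, 1/x, y]` into `ℤ_q[x, 1/x, y, 1/Δ]`, because the Taylor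
expansion of `y` is found by Newton's iteration. -/
theorem dividedPow_mem_AXD {f : C.L} (hf : f ∈ C.AX) (n : ℕ) : C.ddx.dividedPow n f ∈ C.AXD := by
  induction hf using Algebra.adjoin_induction generalizing n with
  | mem f hf =>
    rcases hf with rfl | rfl | rfl
    · rw [← Derivation.coeff_taylor, taylor_x, map_add]
      refine add_mem ?_ ?_
      · rw [PowerSeries.coeff_C]
        split
        · exact C.AX_le_AXD C.x_mem_AX
        · exact zero_mem _
      · rw [PowerSeries.coeff_X]
        split
        · exact one_mem _
        · exact zero_mem _
    · exact C.dividedPow_inv_x_mem_AXD n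
    · exact C.dividedPow_y_mem_AXD n
  | algebraMap c =>
    rw [← Derivation.coeff_taylor, taylor_algebraMap, PowerSeries.coeff_C]
    split
    · exact C.AXD.algebraMap_mem c
    · exact zero_mem _
  | add f g _ _ hf hg =>
    rw [Derivation.dividedPow_add]
    exact add_mem (hf n) (hg n)
  | mul f g _ _ hf hg =>
    rw [← Derivation.coeff_taylor, map_mul, PowerSeries.coeff_mul]
    refine sum_mem fun ij _ => ?_
    rw [Derivation.coeff_taylor, Derivation.coeff_taylor]
    exact mul_mem (hf _) (hg _)

variable {C} [IsDedekindDomain C.BInf] [IsFractionRing C.BInf C.L]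

/-- The only denominator `Δ` of `ℤ_q[x, 1/x, y, 1/Δ]` has an invertible leading coefficient. -/
theorem AXD_le_integralAtInfinity (hr : IsUnit C.r.leadingCoeff) : C.AXD ≤ C.integralAtInfinity := by
  refine Algebra.adjoin_le ?_
  rintro z (rfl | rfl | rfl | rfl)
  · exact fun J => mem_intFil_of_mem_AX C.x_mem_AX
  · exact fun J => mem_intFil_of_mem_AX C.inv_x_mem_AX
  · exact fun J => mem_intFil_of_mem_AX C.y_mem_AX
  · exact (inv_incl_mem_Fil_and_mem_integralAtInfinity (C.isUnit_leadingCoeff_discr hr)).2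

theorem aeval_theta_mem_Fil {W : GL (Fin C.d) (Zq p k)[T;T⁻¹]} (hW : C.IsIntegralBasisAtInfinity W)
    (q : ℚ[X]) {J : ℤ} {f : C.L} (hf : f ∈ C.Fil J) :
    Polynomial.aeval C.theta.toRatLinearMap q f ∈ C.Fil J :=
  aeval_derivation_mem_ordFiltration C.theta (fun P hP f hf => valuation_theta_lt_one hW P hP f hf)
    (inv_ne_zero C.x_ne_zero) C.theta_inv_x q hf

/-- The lattices `intFil J` are stable under `binom(θ, n) = xⁿ ∂ⁿ / n!`: on `ℤ_q[x, 1/x, y]` by Taylor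
expansion, on functions of high order because `θ` is logarithmic. -/
theorem aeval_binomPoly_mem_intFil {W : GL (Fin C.d) (Zq p k)[T;T⁻¹]}
    (hW : C.IsIntegralBasisAtInfinity W) (hr : IsUnit C.r.leadingCoeff) (n : ℕ) {J : ℤ} {f : C.L}
    (hf : f ∈ C.intFil J) :
    Polynomial.aeval C.theta.toRatLinearMap (binomPoly n) f ∈ C.intFil J := by
  obtain ⟨a, ha, g, hg, rfl⟩ := mem_intFil.mp hf
  rw [map_add]
  refine add_mem ?_ (mem_intFil_of_mem_Fil (aeval_theta_mem_Fil hW _ hg))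
  rw [theta, C.ddx.aeval_binomPoly C.ddx_x]
  exact AXD_le_integralAtInfinity hr (mul_mem (pow_mem (C.AX_le_AXD C.x_mem_AX) n)
    (C.dividedPow_mem_AXD ha n)) J

/-- If `∂f` is integral up to order `J + 1`, then `n binom(θ, n) f` is integral up to order `J`, being
`x binom(θ, n - 1) ∂f`. -/
theorem mul_aeval_binomPoly_mem_intFil {W : GL (Fin C.d) (Zq p k)[T;T⁻¹]}
    (hW : C.IsIntegralBasisAtInfinity W) (hr : IsUnit C.r.leadingCoeff) (n : ℕ) {J : ℤ} {f : C.L}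
    (hf : C.ddx f ∈ C.intFil (J + 1)) :
    ((n + 1 : ℕ) : C.L) * Polynomial.aeval C.theta.toRatLinearMap (binomPoly (n + 1)) f ∈
      C.intFil J := by
  have h1 := x_mul_mem_intFil (aeval_binomPoly_mem_intFil hW hr n hf)
  rw [theta, C.ddx.aeval_binomPoly C.ddx_x] at h1 ⊢
  rw [← C.ddx.succ_mul_dividedPow] at h1
  convert h1 using 1
  push_cast
  ring

theorem algebraMap_mul_mem_intFil (c : Zq p k) {J : ℤ} {f : C.L} (hf : f ∈ C.intFil J) :
    algebraMap (Zq p k) C.L c * f ∈ C.intFil J := by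
  obtain ⟨a, ha, g, hg, rfl⟩ := mem_intFil.mp hf
  rw [mul_add]
  exact add_mem (mem_intFil_of_mem_AX (mul_mem (C.AX.algebraMap_mem c) ha))
    (mem_intFil_of_mem_Fil (algebraMap_Zq_mul_mem_Fil c hg))

omit [Finite k] in
theorem isUnit_intCast_Zq {n : ℤ} (hn : ¬ (p : ℤ) ∣ n) : IsUnit (n : Zq p k) := by
  refine WittVector.isUnit_of_coeff_zero_ne_zero _ ?_
  change WittVector.constantCoeff (n : Zq p k) ≠ 0
  rwa [map_intCast, Ne, CharP.intCast_eq_zero_iff k p]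

/-- Let `f` have a pole of order at most `m` at infinity and a derivative which is integral up to order
`J + 1`.  If `m e < p ^ (N + 1)` for all ramification indices `e`, then `p ^ N f` is integral up to order
`J`.  The eigenvalues of `θ` on the functions with a pole of order at most `m`, modulo those of order at
least `J`, are the `-c / e_P` with `-m e_P ≤ c < J e_P`; they are not zero as `J ≤ 0`, and have valuation
at most `N`. -/
theorem pow_mul_mem_intFil {W : GL (Fin C.d) (Zq p k)[T;T⁻¹]}
    (hW : C.IsIntegralBasisAtInfinity W) (hr : IsUnit C.r.leadingCoeff) {m J : ℤ} {f : C.L}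
    (hm : -m ≤ J) (hJ : J ≤ 0) (hf : f ∈ C.Fil (-m)) (hf' : C.ddx f ∈ C.intFil (J + 1)) (N : ℕ)
    (hN : ∀ e ∈ C.ramificationIndicesAtInfinity, m * e < p ^ (N + 1)) :
    (p : C.L) ^ N * f ∈ C.intFil J := by
  have hs : C.x⁻¹ ≠ 0 := inv_ne_zero C.x_ne_zero
  have hfin := finite_setOf_valuation_lt_one C.BInf hs C.inv_x_mem_range
  have hS : ∀ P : HeightOneSpectrum C.BInf, P ∈ hfin.toFinset ↔ P.valuation C.L C.x⁻¹ < 1 :=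
    fun P => hfin.mem_toFinset
  let e : HeightOneSpectrum C.BInf → ℕ := fun P => P.asIdeal.ramificationIdx C.Kt
  have hp : ∀ n : ℕ, (p : C.L) ^ n = algebraMap (Zq p k) C.L ((p : Zq p k) ^ n) := by simp
  refine mem_of_aeval_prod_sub_mem (p := p) C.theta.toRatLinearMap (C.intFil J) (C.Fil J)
    (fun h hh => mem_intFil_of_mem_Fil hh)
    (fun n h hh => aeval_binomPoly_mem_intFil hW hr n hh) ?_
    (fun q h hh => aeval_theta_mem_Fil hW q hh) N _ ?_
    (∑ P ∈ hfin.toFinset, logEigenvalues (e P) ((-m) * e P) (J * e P)) ?_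
    (aeval_prod_logEigenvalues_mem_ordFiltration C.theta
      (fun P hP f hf => valuation_theta_lt_one hW P hP f hf) hs C.theta_inv_x hfin.toFinset
      (fun P hP => (hS P).mpr hP) e (fun P hP => ramificationIdx_ne_zero P ((hS P).mp hP))
      (fun P hP => valuation_inv_x P ((hS P).mp hP)) (-m) J hm ?_)
  · intro n hn h hh
    obtain ⟨u, hu⟩ := isUnit_intCast_Zq (k := k) hn
    have h1 := algebraMap_mul_mem_intFil ((u⁻¹ : (Zq p k)ˣ) : Zq p k) hh
    have h2 : (n : C.L) = algebraMap (Zq p k) C.L (u : Zq p k) := by rw [hu, map_intCast]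
    rwa [zsmul_eq_mul, h2, ← mul_assoc, ← map_mul, Units.inv_mul, map_one, one_mul] at h1
  -- `binom(θ, p ^ j) (p ^ N f)` is `p ^ (N - j)` times `p ^ j binom(θ, p ^ j) f`
  · intro j hj
    obtain ⟨n, hn⟩ := Nat.exists_eq_succ_of_ne_zero (pow_ne_zero j (Fact.out : p.Prime).ne_zero)
    have h1 := mul_aeval_binomPoly_mem_intFil hW hr n hf'
    have h2 := algebraMap_mul_mem_intFil ((p : Zq p k) ^ (N - j)) h1
    have h3 : (p : C.L) ^ N * f = (p ^ N : ℕ) • f := by simp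
    rw [h3, map_nsmul, nsmul_eq_mul, hn]
    convert h2 using 1
    rw [← mul_assoc, ← hp, ← Nat.succ_eq_add_one, ← hn, Nat.cast_pow, Nat.cast_pow, ← pow_add,
      Nat.sub_add_cancel hj]
  · intro a ha
    rw [Multiset.mem_sum] at ha
    obtain ⟨P, hP, ha⟩ := ha
    have hP' := (hS P).mp hP
    have he0 : e P ≠ 0 := ramificationIdx_ne_zero P hP'
    have heN := hN _ (ramificationIdx_mem P hP')
    rw [logEigenvalues, Multiset.mem_map] at ha
    obtain ⟨c, hc, rfl⟩ := ha
    rw [Finset.mem_val, Finset.mem_Ico] at hc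
    -- the valuation of `c / e P` is at most that of `c`, and `0 < -c ≤ m * e P < p ^ (N + 1)`
    have hcneg : c < 0 := lt_of_lt_of_le hc.2 (mul_nonpos_of_nonpos_of_nonneg hJ (by positivity))
    have hc0 : (-(c : ℚ)) ≠ 0 := by
      have : (c : ℚ) ≠ 0 := by exact_mod_cast hcneg.ne
      simpa using this
    have he0' : (e P : ℚ) ≠ 0 := by exact_mod_cast he0
    refine ⟨div_ne_zero hc0 he0', ?_⟩
    rw [padicValRat.div hc0 he0', padicValRat.of_nat]
    have h1 : padicValRat p (-(c : ℚ)) = padicValInt p c := by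
      rw [padicValRat.neg, padicValRat.of_int]
    have h2 : padicValInt p c < N + 1 := by
      by_contra hcon
      have h3 : ((p : ℤ) ^ (N + 1)) ∣ c :=
        (padicValInt_dvd_iff (N + 1) c).mpr (Or.inr (not_lt.mp hcon))
      have h4 : (p : ℤ) ^ (N + 1) ≤ -c := Int.le_of_dvd (by omega) (by rwa [dvd_neg])
      have h5 : m * e P < (p : ℤ) ^ (N + 1) := heN
      have h6 := hc.1
      rw [neg_mul] at h6
      omega
    rw [h1]
    omega
  · rw [hp]
    exact algebraMap_Zq_mul_mem_Fil _ hf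

end CurveLift

/-! ### Functions regular on the affine curve and at infinity -/

theorem LaurentPolynomial.coeff_mul_T {A : Type*} [Semiring A] (f : A[T;T⁻¹]) (m n : ℤ) :
    (f * LaurentPolynomial.T m).coeff n = f.coeff (n - m) := by
  have := AddMonoidAlgebra.coeff_mul_single_add f (1 : A) m (n - m)
  rwa [sub_add_cancel, mul_one] at this

theorem LaurentPolynomial.le_ordZero_iff {A : Type*} [Semiring A] {f : A[T;T⁻¹]} {J : ℤ} :
    (J : WithTop ℤ) ≤ f.ordZero ↔ ∀ n, f.coeff n ≠ 0 → J ≤ n := by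
  simp [LaurentPolynomial.ordZero, Finset.le_min_iff]

theorem Derivation.eq_zero_of_isAlgebraic {K L : Type*} [Field K] [CharZero K] [Field L] [Algebra K L]
    (D : Derivation K L L) {z : L} (hz : IsAlgebraic K z) : D z = 0 := by
  have h1 := D.map_aeval (minpoly K z) z
  rw [minpoly.aeval, map_zero, smul_eq_mul, eq_comm, mul_eq_zero] at h1
  exact h1.resolve_left
    ((minpoly.irreducible hz.isIntegral).separable.aeval_derivative_ne_zero (minpoly.aeval K z))

namespace CurveLift

variable {p : ℕ} [Fact p.Prime] {k : Type u} [Field k] [Finite k] [CharP k p] (C : CurveLift p k)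

open IsDedekindDomain

theorem le_ordZeroMatrix_iff {K : Type*} [Semiring K] {n : ℕ} {W : Matrix (Fin n) (Fin n) K[T;T⁻¹]}
    {J : ℤ} : (J : WithTop ℤ) ≤ ordZeroMatrix W ↔ ∀ i j n, (W i j).coeff n ≠ 0 → J ≤ n := by
  simp only [ordZeroMatrix, Finset.le_inf_iff, Finset.mem_univ, true_imp_iff,
    LaurentPolynomial.le_ordZero_iff]

theorem evO_eq_sum (f : (Zq p k)[T;T⁻¹]) :
    C.evO f = ∑ n ∈ f.coeff.support, algebraMap (Zq p k) C.L (f.coeff n) * C.x ^ n := by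
  have h1 : f = ∑ n ∈ f.coeff.support, AddMonoidAlgebra.single n (f.coeff n) := by
    ext n
    rw [AddMonoidAlgebra.coeff_sum, Finsupp.finsetSum_apply]
    simp only [AddMonoidAlgebra.coeff_single, Finsupp.single_apply]
    simp +contextual
  conv_lhs => rw [h1]
  rw [map_sum]
  refine Finset.sum_congr rfl fun n _ => ?_
  rw [LaurentPolynomial.single_eq_C_mul_T, evO_C_mul_T]

theorem algebraMap_Zq_mem (S : Subalgebra (Qq p k) C.L) (c : Zq p k) :
    algebraMap (Zq p k) C.L c ∈ S := by
  rw [IsScalarTower.algebraMap_apply (Zq p k) (Qq p k) C.L]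
  exact S.algebraMap_mem _

variable (W : GL (Fin C.d) (Zq p k)[T;T⁻¹])

theorem AK_le_AXK : C.AK ≤ C.AXK := Algebra.adjoin_mono (by
  intro z hz
  simp only [Set.mem_insert_iff, Set.mem_singleton_iff] at hz ⊢
  tauto)

theorem zpow_x_mul_b_mem_AK {a n : ℤ} (ha : (a : WithTop ℤ) ≤ ordZeroMatrix W.val) (hn : -a ≤ n)
    (i : Fin C.d) : C.x ^ n * C.b W i ∈ C.AK := by
  rw [le_ordZeroMatrix_iff] at ha
  rw [b, Finset.mul_sum]
  refine sum_mem fun j _ => ?_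
  rw [← mul_assoc]
  refine mul_mem ?_ (pow_mem C.y_mem_AK _)
  rw [← evO, evO_eq_sum, Finset.mul_sum]
  refine sum_mem fun l hl => ?_
  have hl' := ha j i l (Finsupp.mem_support_iff.mp hl)
  rw [mul_left_comm, ← zpow_add₀ C.x_ne_zero]
  refine mul_mem (C.algebraMap_Zq_mem _ _) ?_
  rw [show n + l = ((n + l).toNat : ℤ) by omega, zpow_natCast]
  exact pow_mem C.x_mem_AK _

/-- The elements of `ℚ_q[x, y]` have bounded pole order at `x = 0` as combinations of the `b_i`. -/
theorem exists_lowerBound_AK : ∃ n₀ : ℤ, ∀ h ∈ C.AK, ∃ w : Fin C.d → (Qq p k)[T;T⁻¹],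
    C.comb W w = h ∧ ∀ i n, (w i).coeff n ≠ 0 → n₀ ≤ n := by
  classical
  obtain ⟨n₀, hn₀⟩ := (Finset.univ.biUnion fun i => Finset.univ.biUnion fun j =>
    ((W⁻¹).val i j).coeff.support).bddBelow
  have hn₀' : ∀ i j n, ((W⁻¹).val i j).coeff n ≠ 0 → n₀ ≤ n := fun i j n h => hn₀ (by
    simp only [Finset.coe_biUnion, Set.mem_iUnion]
    exact ⟨i, by simp, j, by simp, by simpa using h⟩)
  refine ⟨n₀, ?_⟩
  -- the functions with a bounded pole form a space stable under `x` which contains `1, …, y ^ (d - 1)`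
  let V : Submodule (Qq p k) C.L :=
    { carrier := {h | ∃ w : Fin C.d → (Qq p k)[T;T⁻¹],
        C.comb W w = h ∧ ∀ i n, (w i).coeff n ≠ 0 → n₀ ≤ n}
      zero_mem' := ⟨0, C.comb_zero W, by simp⟩
      add_mem' := by
        rintro _ _ ⟨v, rfl, hv⟩ ⟨w, rfl, hw⟩
        refine ⟨v + w, C.comb_add W v w, fun i n h => ?_⟩
        by_cases h1 : (v i).coeff n = 0
        · refine hw i n fun h2 => h ?_
          simp [h1, h2]
        · exact hv i n h1
      smul_mem' := by
        rintro c _ ⟨w, rfl, hw⟩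
        refine ⟨fun i => LaurentPolynomial.C c * w i, ?_, fun i n h => hw i n fun h2 => h ?_⟩
        · rw [comb_mul, LaurentPolynomial.eval₂_C, Algebra.smul_def]
        · dsimp only
          rw [← LaurentPolynomial.smul_eq_C_mul]
          simp [h2] }
  have hx : ∀ h ∈ V, C.x * h ∈ V := by
    rintro _ ⟨w, rfl, hw⟩
    refine ⟨fun i => LaurentPolynomial.T 1 * w i, ?_, fun i n h => ?_⟩
    · rw [comb_mul, evL_T, zpow_one]
    · dsimp only at h
      rw [LaurentPolynomial.T_mul, LaurentPolynomial.coeff_mul_T] at h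
      have := hw i _ h
      omega
  have hy : ∀ i < C.d, C.y ^ i ∈ V := by
    intro i hi
    rw [C.pow_y_eq_sum W ⟨i, hi⟩]
    refine sum_mem fun j _ => ?_
    refine ⟨Pi.single j (toQq ((W⁻¹).val j ⟨i, hi⟩)), ?_, fun l n h => ?_⟩
    · rw [comb_single, evL_toQq]
    · by_cases hl : l = j
      · subst hl
        rw [Pi.single_eq_same, coeff_toQq] at h
        exact hn₀' _ _ n fun h2 => h (by rw [h2, map_zero])
      · rw [Pi.single_eq_of_ne hl] at h
        simp at h
  intro h hh
  change h ∈ V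
  -- division with remainder by the monic polynomial `𝒬`, after clearing denominators
  obtain ⟨c, hc, hch⟩ := C.exists_smul_mem_adjoin _ hh
  have hrange : Algebra.adjoin (Zq p k) {C.x, C.y} ≤ (IsScalarTower.toAlgHom (Zq p k) C.A C.L).range := by
    refine Algebra.adjoin_le ?_
    rintro z (rfl | rfl)
    · exact ⟨AdjoinRoot.of C.Q Polynomial.X, rfl⟩
    · exact ⟨AdjoinRoot.root C.Q, rfl⟩
  obtain ⟨G, hG⟩ := hrange hch
  obtain ⟨G, rfl⟩ := AdjoinRoot.mk_surjective G
  have hG' : C.ev G = algebraMap (Zq p k) C.L c * h := hG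
  have hmod : C.ev G = C.ev (G %ₘ C.Q) := by
    conv_lhs => rw [← Polynomial.modByMonic_add_div G C.Q, map_add, map_mul, ev_Q, zero_mul, add_zero]
  have hdeg : (G %ₘ C.Q).natDegree < C.d := by
    refine Polynomial.natDegree_modByMonic_lt G C.monic fun h1 => ?_
    have h2 : C.d = 0 := by rw [d, h1, Polynomial.natDegree_one]
    have := C.one_le_d
    omega
  have hV : algebraMap (Zq p k) C.L c * h ∈ V := by
    rw [← hG', hmod, ev_eq_eval₂, Polynomial.eval₂_eq_sum_range]
    refine sum_mem fun i hi => ?_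
    have hi' : i < C.d := by
      have := Finset.mem_range.mp hi
      omega
    rw [incl_eq_eval₂RingHom, Polynomial.coe_eval₂RingHom, Polynomial.eval₂_eq_sum_range,
      Finset.sum_mul]
    refine sum_mem fun j hj => ?_
    clear hj
    rw [mul_assoc, IsScalarTower.algebraMap_apply (Zq p k) (Qq p k) C.L, ← Algebra.smul_def]
    refine V.smul_mem _ ?_
    induction j with
    | zero => simpa using hy i hi'
    | succ j ih =>
      rw [pow_succ', mul_assoc]
      exact hx _ ih
  have hc' : algebraMap (Zq p k) (Qq p k) c ≠ 0 := by simpa using hc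
  have := V.smul_mem (algebraMap (Zq p k) (Qq p k) c)⁻¹ hV
  rwa [Algebra.smul_def, map_inv₀, ← IsScalarTower.algebraMap_apply, inv_mul_cancel_left₀] at this
  rwa [Ne, map_eq_zero_iff _ C.algebraMap_injective]

variable {C} {W} [IsDedekindDomain C.BInf] [IsFractionRing C.BInf C.L]

namespace IsIntegralBasisAtInfinity

variable (hW : C.IsIntegralBasisAtInfinity W)
include hW

/-- A regular function on the affine curve without poles at infinity is algebraic over `ℚ_q`: these
functions form a ring of finite dimension. -/
theorem isIntegral_of_mem_AK_of_mem_Fil {h : C.L} (h1 : h ∈ C.AK) (h2 : h ∈ C.Fil 0) :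
    IsIntegral (Qq p k) h := by
  let E : Subalgebra (Qq p k) C.L :=
    { carrier := {h | h ∈ C.AK ∧ h ∈ C.Fil 0}
      mul_mem' := fun {f g} hf hg => ⟨mul_mem hf.1 hg.1, by simpa using mul_mem_Fil hf.2 hg.2⟩
      add_mem' := fun {f g} hf hg => ⟨add_mem hf.1 hg.1, add_mem hf.2 hg.2⟩
      algebraMap_mem' := fun c => ⟨C.AK.algebraMap_mem c, by
        simpa using algebraMap_Qq_mul_mem_Fil c (one_mem_Fil (C := C))⟩ }
  refine IsIntegral.of_mem_of_fg E ?_ h ⟨h1, h2⟩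
  obtain ⟨n₀, hn₀⟩ := C.exists_lowerBound_AK W
  let B : Set C.L := Set.range fun ni : Set.Icc n₀ 0 × Fin C.d => C.x ^ (ni.1 : ℤ) * C.b W ni.2
  refine Submodule.FG.of_le (Submodule.fg_span (Set.finite_range _) : (Submodule.span _ B).FG) ?_
  rintro z ⟨hz1, hz2⟩
  obtain ⟨w, rfl, hw⟩ := hn₀ z hz1
  rw [hW.comb_mem_Fil_iff, le_ordInf_iff] at hz2
  refine sum_mem fun i _ => ?_
  rw [← evL, evL_eq_sum, Finset.sum_mul]
  refine sum_mem fun n hn => ?_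
  rw [mul_assoc, ← Algebra.smul_def]
  refine Submodule.smul_mem _ _ (Submodule.subset_span ⟨(⟨n, ?_⟩, i), rfl⟩)
  have h3 := Finsupp.mem_support_iff.mp hn
  have h4 := hz2 i n h3
  exact ⟨hw i n h3, by omega⟩

theorem one_notMem_Fil_one : (1 : C.L) ∉ C.Fil 1 := by
  intro h
  have hn : ∀ n : ℕ, (1 : C.L) ∈ C.Fil n := by
    intro n
    induction n with
    | zero => exact one_mem_Fil
    | succ n ih => simpa using mul_mem_Fil ih h
  obtain ⟨w, -, hw⟩ := C.exists_comb_eq_of_mem_AX W (one_mem C.AX)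
  have hw0 : w = 0 := by
    funext i
    ext m
    by_contra hcon
    have h1 := hn ((-m).toNat + 1)
    rw [← hw, hW.comb_mem_Fil_iff, le_ordInf_iff] at h1
    have := h1 i m (by simpa using hcon)
    omega
  rw [hw0, comb_zero] at hw
  exact zero_ne_one hw

/-- A regular function on the affine curve with zeros at all the points at infinity vanishes: if not zero, it
is algebraic over `ℚ_q`, and so is its inverse, which therefore has no poles. -/
theorem eq_zero_of_mem_AK_of_mem_Fil {h : C.L} (h1 : h ∈ C.AK) (h2 : h ∈ C.Fil 1) : h = 0 := by
  by_contra h0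
  have halg := (hW.isIntegral_of_mem_AK_of_mem_Fil h1 (Fil_antitone zero_le_one h2)).isAlgebraic
  have hinv : h⁻¹ ∈ C.Fil 0 := by
    intro P hP
    have h4 : h⁻¹ ∈ integralClosure (Qq p k) C.L := halg.inv.isIntegral
    have h5 : h⁻¹ ∈ (algebraMap C.BInf C.L).range := by
      rw [mem_range_BInf]
      exact h4.tower_top
    obtain ⟨b, hb⟩ := h5
    rw [← hb, zpow_zero]
    exact P.valuation_le_one b
  apply hW.one_notMem_Fil_one
  have := mul_mem_Fil hinv h2
  rwa [inv_mul_cancel₀ h0, zero_add] at this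

omit [IsDedekindDomain C.BInf] [IsFractionRing C.BInf C.L] in
theorem b_ne_zero (i : Fin C.d) : C.b W i ≠ 0 := hW.1.ne_zero i

/-- The order of `W` at `x = 0` is not positive, as otherwise `b_i / x` would be regular on the affine curve
and vanish at infinity. -/
theorem ordZero_nonpos {a : ℤ} (ha : (a : WithTop ℤ) ≤ ordZeroMatrix W.val) : a ≤ 0 := by
  by_contra hcon
  let i : Fin C.d := ⟨0, C.one_le_d⟩
  have h1 := mul_mem_Fil (zpow_x_mem_Fil (C := C) (-a)) (hW.b_mem_Fil i)
  have h2 := hW.eq_zero_of_mem_AK_of_mem_Fil (C.zpow_x_mul_b_mem_AK W ha le_rfl i)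
    (Fil_antitone (by omega) h1)
  exact mul_ne_zero (zpow_ne_zero _ C.x_ne_zero) (hW.b_ne_zero i) h2

end IsIntegralBasisAtInfinity

end CurveLift

/-! ### The case of a regular matrix `W` -/

theorem isCoprime_of_mul_sub_eq {R : Type*} [CommRing R] {a b c e g h : R} (h1 : g * b - c = a * h)
    (h2 : e * c = 1) : IsCoprime a b :=
  ⟨-(e * h), e * g, by linear_combination e * h1 + h2⟩

namespace CurveLift

variable {p : ℕ} [Fact p.Prime] {k : Type u} [Field k] [Finite k] [CharP k p] (C : CurveLift p k)

open IsDedekindDomain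

/-- If `∂𝒬/∂y` is invertible on the affine curve over `ℚ_q`, the discriminant and its divisor `r` are
constant. -/
theorem natDegree_r_eq_zero (h : C.Qy⁻¹ ∈ C.AK) : C.r.natDegree = 0 := by
  obtain ⟨c, hc, hch⟩ := C.exists_smul_mem_adjoin _ h
  have hrange : Algebra.adjoin (Zq p k) {C.x, C.y} ≤ (IsScalarTower.toAlgHom (Zq p k) C.A C.L).range := by
    refine Algebra.adjoin_le ?_
    rintro z (rfl | rfl)
    · exact ⟨AdjoinRoot.of C.Q Polynomial.X, rfl⟩
    · exact ⟨AdjoinRoot.root C.Q, rfl⟩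
  obtain ⟨G, hG⟩ := hrange hch
  obtain ⟨G, rfl⟩ := AdjoinRoot.mk_surjective G
  have hG' : C.ev G = algebraMap (Zq p k) C.L c * C.Qy⁻¹ := hG
  have h1 : C.ev (G * C.Q.derivative - Polynomial.C (Polynomial.C c)) = 0 := by
    rw [map_sub, map_mul, hG']
    change _ * C.Qy - _ = 0
    rw [inv_mul_cancel_right₀ C.Qy_ne_zero, sub_eq_zero, ev_eq_eval₂, Polynomial.eval₂_C,
      incl_eq_eval₂RingHom, Polynomial.coe_eval₂RingHom, Polynomial.eval₂_C]
  rw [ev, RingHom.comp_apply, map_eq_zero_iff _ (IsFractionRing.injective C.A C.L),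
    AdjoinRoot.mk_eq_zero] at h1
  obtain ⟨H, hH⟩ := h1
  let φ := Polynomial.mapRingHom (algebraMap (Zq p k) (Qq p k))
  have h2 := congrArg (Polynomial.map φ) hH
  rw [Polynomial.map_sub, Polynomial.map_mul, Polynomial.map_mul, Polynomial.map_C,
    ← Polynomial.derivative_map] at h2
  have hc' : algebraMap (Zq p k) (Qq p k) c ≠ 0 := by simpa using hc
  have hinv : Polynomial.C (Polynomial.C (algebraMap (Zq p k) (Qq p k) c)⁻¹) *
      Polynomial.C (φ (Polynomial.C c)) = 1 := by
    rw [← map_mul, Polynomial.coe_mapRingHom, Polynomial.map_C, ← map_mul, inv_mul_cancel₀ hc',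
      map_one, map_one]
  have hcop : IsCoprime (C.Q.map φ) (C.Q.map φ).derivative :=
    isCoprime_of_mul_sub_eq (R := (Qq p k)[X][X]) h2 hinv
  have hdeg : 0 < (C.Q.map φ).degree := by
    rw [C.monic.degree_map]
    exact C.degree_pos
  have hunit := ((C.monic.map φ).isUnit_discr_iff hdeg).mpr hcop
  rw [C.monic.discr_map φ C.degree_pos] at hunit
  have h3 := Polynomial.natDegree_eq_zero_of_isUnit hunit
  rw [Polynomial.coe_mapRingHom, Polynomial.natDegree_map_eq_of_injective
    (IsFractionRing.injective (Zq p k) (Qq p k)), C.disc_eq] at h3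
  have h4 := C.discr_ne_zero
  rw [C.disc_eq] at h4
  rw [Polynomial.natDegree_mul (left_ne_zero_of_mul h4) (right_ne_zero_of_mul h4)] at h3
  omega

theorem RK_le_AK (h : C.r.natDegree = 0) : C.RK ≤ C.AK := by
  refine Algebra.adjoin_le ?_
  rintro z (rfl | rfl | rfl)
  · exact C.x_mem_AK
  · rw [Polynomial.eq_C_of_natDegree_eq_zero h]
    have : C.incl (Polynomial.C (C.r.coeff 0)) = algebraMap (Qq p k) C.L (algebraMap _ _ (C.r.coeff 0)) := by
      rw [incl_eq_eval₂RingHom, Polynomial.coe_eval₂RingHom, Polynomial.eval₂_C,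
        ← IsScalarTower.algebraMap_apply]
    rw [this, ← map_inv₀]
    exact C.AK.algebraMap_mem _
  · exact C.y_mem_AK

variable {C} {W : GL (Fin C.d) (Zq p k)[T;T⁻¹]} [IsDedekindDomain C.BInf] [IsFractionRing C.BInf C.L]

namespace IsIntegralBasisAtInfinity

variable (hW : C.IsIntegralBasisAtInfinity W) (ha : ((0 : ℤ) : WithTop ℤ) ≤ ordZeroMatrix W.val)
include hW ha

/-- If `W` has no pole at `x = 0`, the functions `b_i` are regular everywhere, hence algebraic over `ℚ_q`, and
they span `ℚ_q[x, y]` over `ℚ_q[x]`.  Hence `d/dx` preserves `ℚ_q[x, y]`. -/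
theorem ddx_mem_AK {h : C.L} (hh : h ∈ C.AK) : C.ddx h ∈ C.AK := by
  have hb : ∀ i, C.b W i ∈ C.AK := fun i => by
    simpa using C.zpow_x_mul_b_mem_AK W ha (n := 0) le_rfl i
  have hdb : ∀ i, C.ddx (C.b W i) = 0 := fun i => C.ddx.eq_zero_of_isAlgebraic
    (hW.isIntegral_of_mem_AK_of_mem_Fil (hb i) (hW.b_mem_Fil i)).isAlgebraic
  obtain ⟨w, rfl⟩ := C.exists_comb_eq_of_mem_AXK W (C.AK_le_AXK hh)
  let pos : C.L := ∑ i, ∑ n ∈ (w i).coeff.support with 0 ≤ n,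
    algebraMap (Qq p k) C.L ((w i).coeff n) * C.x ^ n * C.b W i
  let neg : C.L := ∑ i, ∑ n ∈ (w i).coeff.support with ¬ 0 ≤ n,
    algebraMap (Qq p k) C.L ((w i).coeff n) * C.x ^ n * C.b W i
  have hsum : C.comb W w = pos + neg := by
    rw [← Finset.sum_add_distrib]
    refine Finset.sum_congr rfl fun i _ => ?_
    rw [Finset.sum_filter_add_sum_filter_not, ← Finset.sum_mul, ← evL_eq_sum]
  have hpos : pos ∈ C.AK := by
    refine sum_mem fun i _ => sum_mem fun n hn => mul_mem (mul_mem (C.AK.algebraMap_mem _) ?_) (hb i)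
    rw [← Int.toNat_of_nonneg (Finset.mem_filter.mp hn).2, zpow_natCast]
    exact pow_mem C.x_mem_AK _
  -- the part with negative exponents is regular on the affine curve and vanishes at infinity
  have hneg : neg = 0 := by
    refine hW.eq_zero_of_mem_AK_of_mem_Fil ?_ ?_
    · rw [← sub_eq_iff_eq_add'.mpr hsum]
      exact sub_mem hh hpos
    · refine sum_mem fun i _ => sum_mem fun n hn => ?_
      rw [mul_assoc]
      refine algebraMap_Qq_mul_mem_Fil _ ?_
      have h1 := mul_mem_Fil (zpow_x_mem_Fil (C := C) n) (hW.b_mem_Fil i)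
      have := (Finset.mem_filter.mp hn).2
      exact Fil_antitone (by omega) h1
  rw [hsum, hneg, add_zero, map_sum]
  refine sum_mem fun i _ => ?_
  rw [map_sum]
  refine sum_mem fun n hn => ?_
  rw [← Int.toNat_of_nonneg (Finset.mem_filter.mp hn).2, zpow_natCast, Derivation.leibniz, hdb,
    smul_zero, zero_add, Derivation.leibniz, Derivation.map_algebraMap, smul_zero, add_zero,
    Derivation.leibniz_pow, ddx_x]
  simp only [smul_eq_mul, nsmul_eq_mul, mul_one]
  exact mul_mem (hb i) (mul_mem (C.AK.algebraMap_mem _)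
    (mul_mem (natCast_mem _ _) (pow_mem C.x_mem_AK _)))

/-- If `W` has no pole at `x = 0`, smoothness forces `r` to be constant, so that a regular function on `𝒰`
which vanishes at infinity is zero.  Indeed `∂𝒬/∂x = -(dy/dx) ∂𝒬/∂y` with `dy/dx` regular, so that
`∂𝒬/∂y` alone generates the unit ideal. -/
theorem eq_zero_of_mem_RK_of_mem_Fil (hsm : C.SmoothLocus) {h : C.L} (h1 : h ∈ C.RK)
    (h2 : h ∈ C.Fil 1) : h = 0 := by
  obtain ⟨α, hα, β, hβ, hαβ⟩ := hsm.exists_mul_add_mul_eq_one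
  have hy := hW.ddx_mem_AK ha C.y_mem_AK
  have hQ : C.Qx = -C.Qy * C.ddx C.y := by
    rw [ddx_y]
    field_simp [C.Qy_ne_zero]
  have hinv : C.Qy⁻¹ = β - α * C.ddx C.y := by
    rw [inv_eq_iff_eq_inv, eq_comm, inv_eq_iff_eq_inv, eq_comm, inv_eq_of_mul_eq_one_right]
    rw [hQ] at hαβ
    linear_combination hαβ
  refine hW.eq_zero_of_mem_AK_of_mem_Fil (C.RK_le_AK (C.natDegree_r_eq_zero ?_) h1) h2
  rw [hinv]
  exact sub_mem hβ (mul_mem hα hy)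

end IsIntegralBasisAtInfinity

end CurveLift

/-! ### The reduction procedure -/

namespace CurveLift

variable {p : ℕ} [Fact p.Prime] {k : Type u} [Field k] [Finite k] [CharP k p] (C : CurveLift p k)

open IsDedekindDomain

theorem x_mem_RK : C.x ∈ C.RK := Algebra.subset_adjoin (by simp)
theorem inv_r_mem_RK : (C.incl C.r)⁻¹ ∈ C.RK := Algebra.subset_adjoin (by simp)

theorem AK_le_RK : C.AK ≤ C.RK := Algebra.adjoin_mono (by
  intro z hz
  simp only [Set.mem_insert_iff, Set.mem_singleton_iff] at hz ⊢
  tauto)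

theorem inv_Qy_mem_RK : C.Qy⁻¹ ∈ C.RK := by
  obtain ⟨V, hV⟩ := C.exists_Qy_mul_eq_discr
  obtain ⟨n, g, hg⟩ := C.exists_discr_dvd_r_pow
  have h1 := congrArg C.incl hg
  rw [map_pow, map_mul, ← hV] at h1
  have h2 : C.Qy⁻¹ = C.ev V * C.incl g * (C.incl C.r)⁻¹ ^ n := by
    rw [inv_pow, eq_mul_inv_iff_mul_eq₀ (pow_ne_zero _ C.incl_r_ne_zero), h1, mul_assoc,
      inv_mul_cancel_left₀ C.Qy_ne_zero]
  rw [h2]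
  exact mul_mem (C.AK_le_RK (mul_mem (C.ev_mem_AK V) (C.incl_mem_AK g))) (pow_mem C.inv_r_mem_RK n)

theorem ddx_mem_RK {f : C.L} (hf : f ∈ C.RK) : C.ddx f ∈ C.RK := by
  have hAK : ∀ f ∈ C.AK, C.ddx f ∈ C.RK := by
    intro f hf
    have h1 : C.ddx f = C.Qy⁻¹ * (C.Qy * C.ddx f) := by rw [inv_mul_cancel_left₀ C.Qy_ne_zero]
    rw [h1]
    exact mul_mem C.inv_Qy_mem_RK (C.AK_le_RK (C.Qy_mul_ddx_mem_AK hf))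
  induction hf using Algebra.adjoin_induction with
  | mem f hf =>
    rcases hf with rfl | rfl | rfl
    · exact hAK _ C.x_mem_AK
    · rw [Derivation.leibniz_inv, smul_eq_mul]
      exact mul_mem (neg_mem (pow_mem C.inv_r_mem_RK 2)) (hAK _ (C.incl_mem_AK _))
    · exact hAK _ C.y_mem_AK
  | algebraMap c =>
    rw [Derivation.map_algebraMap]
    exact zero_mem _
  | add f g _ _ hf hg =>
    rw [map_add]
    exact add_mem hf hg
  | mul f g hf' hg' hf hg =>
    rw [Derivation.leibniz, smul_eq_mul, smul_eq_mul]
    exact add_mem (mul_mem hf' hg) (mul_mem hg' hf)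

theorem aeval_theta_mem_RK (q : ℚ[X]) {f : C.L} (hf : f ∈ C.RK) :
    Polynomial.aeval C.theta.toRatLinearMap q f ∈ C.RK := by
  induction q using Polynomial.induction_on' with
  | add q₁ q₂ h₁ h₂ =>
    rw [map_add, LinearMap.add_apply]
    exact add_mem h₁ h₂
  | monomial n a =>
    rw [Polynomial.aeval_monomial, Module.End.mul_apply, Module.algebraMap_end_apply,
      Algebra.smul_def]
    refine mul_mem ?_ ?_
    · have : algebraMap ℚ C.L a = algebraMap (Qq p k) C.L (algebraMap ℚ (Qq p k) a) := by simp
      rw [this]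
      exact C.RK.algebraMap_mem _
    · induction n with
      | zero => simpa using hf
      | succ n ih =>
        rw [pow_succ', Module.End.mul_apply, Derivation.toRatLinearMap_apply, theta_apply]
        exact mul_mem C.x_mem_RK (C.ddx_mem_RK ih)

theorem R_le_RK {f : C.L} (hf : f ∈ C.R) : f ∈ C.RK := by
  induction hf using Algebra.adjoin_induction with
  | mem f hf => exact Algebra.subset_adjoin hf
  | algebraMap c => exact C.algebraMap_Zq_mem _ c
  | add f g _ _ hf hg => exact add_mem hf hg
  | mul f g _ _ hf hg => exact mul_mem hf hg

variable (W : GL (Fin C.d) (Zq p k)[T;T⁻¹])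

theorem form_eq_D_add_form_iff (w w' : Fin C.d → (Qq p k)[T;T⁻¹]) (f : C.L) :
    C.form W w = KaehlerDifferential.D (Qq p k) C.L f + C.form W w' ↔
      C.comb W w / C.incl C.r = C.ddx f + C.comb W w' / C.incl C.r := by
  rw [form, form, C.D_eq f, ← add_smul]
  exact (smul_left_injective C.L C.D_x_ne_zero).eq_iff

theorem div_mem_RK_of_form_mem {w : Fin C.d → (Qq p k)[T;T⁻¹]} (hw : C.form W w ∈ C.OmegaU) :
    C.comb W w / C.incl C.r ∈ C.RK := by
  have h1 : ∃ c ∈ C.RK, C.form W w = c • KaehlerDifferential.D (Qq p k) C.L C.x := by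
    generalize C.form W w = η at hw
    induction hw using Submodule.span_induction with
    | mem η hη =>
      obtain ⟨h, rfl⟩ := hη
      exact ⟨_, C.ddx_mem_RK (C.R_le_RK h.2), C.D_eq _⟩
    | zero => exact ⟨0, zero_mem _, by rw [zero_smul]⟩
    | add η ξ _ _ hη hξ =>
      obtain ⟨c, hc, rfl⟩ := hη
      obtain ⟨e, he, rfl⟩ := hξ
      exact ⟨c + e, add_mem hc he, by rw [add_smul]⟩
    | smul a η _ hη =>
      obtain ⟨c, hc, rfl⟩ := hη
      exact ⟨a * c, mul_mem (C.R_le_RK a.2) hc, by rw [mul_smul]; rfl⟩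
  obtain ⟨c, hc, h2⟩ := h1
  rw [form] at h2
  rwa [smul_left_injective C.L C.D_x_ne_zero h2]

variable {C} {W}

omit [Finite k] [CharP k p] in
theorem exists_ordInf_eq {n : ℕ} {w : Fin n → (Qq p k)[T;T⁻¹]} {β : ℤ} (h : ordInf w ≤ β) :
    ∃ o : ℤ, ordInf w = o ∧ o ≤ β := by
  obtain ⟨o, ho⟩ := WithTop.ne_top_iff_exists.mp (ne_top_of_le_ne_top WithTop.coe_ne_top h)
  refine ⟨o, ho.symm, ?_⟩
  rw [← ho] at h
  exact_mod_cast h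

theorem poleOrder_eq {w : Fin C.d → (Qq p k)[T;T⁻¹]} {o : ℤ} (ho : ordInf w = o) :
    C.poleOrder w = -o - C.r.natDegree + 1 := by
  rw [poleOrder, ho]
  rfl

theorem IsIntegralBasisAtInfinity.exists_ordZeroMatrix_eq (hW : C.IsIntegralBasisAtInfinity W) :
    ∃ a : ℤ, ordZeroMatrix W.val = a := by
  rcases h : ordZeroMatrix W.val with _ | a
  · exfalso
    refine hW.b_ne_zero ⟨0, C.one_le_d⟩ (Finset.sum_eq_zero fun i _ => ?_)
    have h0 : W.val i ⟨0, C.one_le_d⟩ = 0 := by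
      refine LaurentPolynomial.ext fun n => ?_
      by_contra hcon
      have h1 : ((n + 1 : ℤ) : WithTop ℤ) ≤ ordZeroMatrix W.val := by
        rw [h]
        exact le_top
      have := le_ordZeroMatrix_iff.mp h1 i _ n (by simpa using hcon)
      omega
    rw [h0, map_zero, zero_mul]
  · exact ⟨a, rfl⟩

theorem bound_eq {a : ℤ} (ha : ordZeroMatrix W.val = a) :
    C.bound W = ((a + (1 - C.r.natDegree) : ℤ) : WithTop ℤ) := by
  rw [bound, ha]
  rfl

variable [IsDedekindDomain C.BInf] [IsFractionRing C.BInf C.L]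

theorem div_r_mem_Fil (hr : IsUnit C.r.leadingCoeff) {h : C.L} {J : ℤ} (hh : h ∈ C.Fil J) :
    h / C.incl C.r ∈ C.Fil (J + C.r.natDegree) := by
  rw [div_eq_mul_inv]
  exact mul_mem_Fil hh (inv_incl_mem_Fil_and_mem_integralAtInfinity hr).1

theorem comb_ne_zero_of_ordInf_eq (hW : C.IsIntegralBasisAtInfinity W) {w : Fin C.d → (Qq p k)[T;T⁻¹]} {o : ℤ}
    (ho : ordInf w = o) : C.comb W w ≠ 0 := by
  intro h0
  have h1 : C.comb W w ∈ C.Fil (o + 1) := h0 ▸ zero_mem _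
  rw [hW.comb_mem_Fil_iff, ho, WithTop.coe_le_coe] at h1
  omega

/-- As long as the reduction procedure goes on, the pole order is positive.  With `a ≤ 0` the order of `W` at
`x = 0`, it is at least `-a`, so that only `a = 0` could be an exception; then the form would be given by
a function vanishing at infinity, hence zero. -/
theorem one_le_poleOrder (hW : C.IsIntegralBasisAtInfinity W) (hsm : C.SmoothLocus)
    (hr : IsUnit C.r.leadingCoeff) {a o : ℤ} (ha : ordZeroMatrix W.val = a)
    {w : Fin C.d → (Qq p k)[T;T⁻¹]} (ho : ordInf w = o) (hoa : o ≤ a + (1 - C.r.natDegree))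
    (hw : C.comb W w / C.incl C.r ∈ C.RK) : 1 ≤ -o - C.r.natDegree + 1 := by
  have ha0 := hW.ordZero_nonpos ha.ge
  by_contra hcon
  obtain rfl : a = 0 := by omega
  have h1 : C.comb W w / C.incl C.r ∈ C.Fil 1 :=
    Fil_antitone (by omega) (div_r_mem_Fil hr (hW.comb_mem_Fil_iff.mpr ho.ge))
  exact comb_ne_zero_of_ordInf_eq hW ho ((div_eq_zero_iff.mp
    (hW.eq_zero_of_mem_RK_of_mem_Fil ha.ge hsm hw h1)).resolve_right C.incl_r_ne_zero)

/-- A regular function on the generic fibre of `𝒰` has a leading term at infinity which is a constant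
combination of the functions `x ^ m b_i`. -/
theorem exists_leadingTerm (hW : C.IsIntegralBasisAtInfinity W) (hr : IsUnit C.r.leadingCoeff)
    {f : C.L} (hf : f ∈ C.RK) {m : ℤ} (hfm : f ∈ C.Fil (-m)) :
    ∃ c : Fin C.d → Qq p k,
      f - C.comb W (fun i => LaurentPolynomial.C (c i) * LaurentPolynomial.T m) ∈ C.Fil (-m + 1) := by
  obtain ⟨c, hc, hcf⟩ := C.exists_smul_mem_adjoin _ hf
  obtain ⟨a, ha, φ, hφ, h1⟩ := mem_intFil.mp
    (AXD_le_integralAtInfinity hr (C.R_le_AXD hcf) (-m + 1))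
  obtain ⟨v, -, rfl⟩ := C.exists_comb_eq_of_mem_AX W ha
  have hv : C.comb W v ∈ C.Fil (-m) := by
    rw [eq_sub_of_add_eq h1]
    exact sub_mem (algebraMap_Zq_mul_mem_Fil _ hfm) (Fil_antitone (by omega) hφ)
  rw [hW.comb_mem_Fil_iff, le_ordInf_iff] at hv
  have hc' : algebraMap (Zq p k) (Qq p k) c ≠ 0 := by simpa using hc
  have hcL : algebraMap (Zq p k) C.L c ≠ 0 := by
    rwa [Ne, map_eq_zero_iff _ C.algebraMap_injective]
  let e : Fin C.d → Qq p k := fun i => (algebraMap (Zq p k) (Qq p k) c)⁻¹ * (v i).coeff m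
  refine ⟨e, ?_⟩
  have hlead : C.comb W v - C.comb W (fun i => LaurentPolynomial.C ((v i).coeff m) *
      LaurentPolynomial.T m) ∈ C.Fil (-m + 1) := by
    rw [← comb_sub, hW.comb_mem_Fil_iff, le_ordInf_iff]
    intro i n hn
    rw [Pi.sub_apply, ← LaurentPolynomial.single_eq_C_mul_T, AddMonoidAlgebra.coeff_sub,
      Finsupp.sub_apply, AddMonoidAlgebra.coeff_single, Finsupp.single_apply] at hn
    split at hn
    · next h =>
      subst h
      exact absurd (sub_self _) hn
    · next h =>
      rw [sub_zero] at hn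
      have := hv i n hn
      omega
  have hscale : C.comb W (fun i => LaurentPolynomial.C (e i) * LaurentPolynomial.T m) =
      (algebraMap (Zq p k) C.L c)⁻¹ *
        C.comb W (fun i => LaurentPolynomial.C ((v i).coeff m) * LaurentPolynomial.T m) := by
    rw [← comb_div]
    simp only [e, map_mul, mul_assoc]
  rw [hscale]
  have h2 : f - (algebraMap (Zq p k) C.L c)⁻¹ *
        C.comb W (fun i => LaurentPolynomial.C ((v i).coeff m) * LaurentPolynomial.T m) =
      algebraMap (Qq p k) C.L (algebraMap (Zq p k) (Qq p k) c)⁻¹ * (φ + (C.comb W v -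
        C.comb W (fun i => LaurentPolynomial.C ((v i).coeff m) * LaurentPolynomial.T m))) := by
    rw [map_inv₀, ← IsScalarTower.algebraMap_apply, mul_add, mul_sub, ← add_sub_assoc, ← mul_add,
      add_comm φ, h1, inv_mul_cancel_left₀ hcL]
  rw [h2]
  exact algebraMap_Qq_mul_mem_Fil _ (add_mem hφ hlead)

/-- Functions with a pole of order at most `m > 0` at infinity have a primitive for `x d/dx` up to functions
with a pole of order less than `m`: the eigenvalues of `x d/dx` on the quotient are not zero. -/
theorem exists_theta_sub_mem_Fil (hW : C.IsIntegralBasisAtInfinity W) {m : ℤ} (hm : 1 ≤ m) {g : C.L}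
    (hg : g ∈ C.RK) (hgm : g ∈ C.Fil (-m)) :
    ∃ f ∈ C.RK, f ∈ C.Fil (-m) ∧ C.theta f - g ∈ C.Fil (-m + 1) := by
  have hs : C.x⁻¹ ≠ 0 := inv_ne_zero C.x_ne_zero
  have hfin := finite_setOf_valuation_lt_one C.BInf hs C.inv_x_mem_range
  have hS : ∀ P : HeightOneSpectrum C.BInf, P ∈ hfin.toFinset ↔ P.valuation C.L C.x⁻¹ < 1 :=
    fun P => hfin.mem_toFinset
  let e : HeightOneSpectrum C.BInf → ℕ := fun P => P.asIdeal.ramificationIdx C.Kt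
  set χ : ℚ[X] := ((∑ P ∈ hfin.toFinset, logEigenvalues (e P) ((-m) * e P) ((-m + 1) * e P)).map
    fun a => Polynomial.X - Polynomial.C a).prod with hχ
  have hχg : Polynomial.aeval C.theta.toRatLinearMap χ g ∈ C.Fil (-m + 1) :=
    aeval_prod_logEigenvalues_mem_ordFiltration C.theta
      (fun P hP f hf => valuation_theta_lt_one hW P hP f hf) hs C.theta_inv_x hfin.toFinset
      (fun P hP => (hS P).mpr hP) e (fun P hP => ramificationIdx_ne_zero P ((hS P).mp hP))
      (fun P hP => valuation_inv_x P ((hS P).mp hP)) (-m) (-m + 1) (by omega) hgm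
  have hχ0 : χ.coeff 0 ≠ 0 := by
    rw [Polynomial.coeff_zero_eq_eval_zero, hχ, Polynomial.eval_multiset_prod, Multiset.map_map]
    intro h0
    rw [Multiset.prod_eq_zero_iff, Multiset.mem_map] at h0
    obtain ⟨a, ha, ha0⟩ := h0
    rw [Multiset.mem_sum] at ha
    obtain ⟨P, hP, ha⟩ := ha
    rw [logEigenvalues, Multiset.mem_map] at ha
    obtain ⟨c, hc, rfl⟩ := ha
    rw [Finset.mem_val, Finset.mem_Ico] at hc
    have hcneg : c < 0 := lt_of_lt_of_le hc.2
      (mul_nonpos_of_nonpos_of_nonneg (by omega) (by positivity))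
    have he0 : (e P : ℚ) ≠ 0 := by exact_mod_cast ramificationIdx_ne_zero P ((hS P).mp hP)
    have hc0 : (c : ℚ) ≠ 0 := by exact_mod_cast hcneg.ne
    simp [he0, hc0] at ha0
  -- as `χ = X q + χ(0)`, the function `-q(θ) g / χ(0)` is a solution up to `χ(θ) g / χ(0)`
  refine ⟨Polynomial.aeval C.theta.toRatLinearMap (Polynomial.C (-(χ.coeff 0)⁻¹) * χ.divX) g,
    C.aeval_theta_mem_RK _ hg, aeval_theta_mem_Fil hW _ hgm, ?_⟩
  have h1 : C.theta (Polynomial.aeval C.theta.toRatLinearMap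
        (Polynomial.C (-(χ.coeff 0)⁻¹) * χ.divX) g) - g =
      Polynomial.aeval C.theta.toRatLinearMap (Polynomial.C (-(χ.coeff 0)⁻¹))
        (Polynomial.aeval C.theta.toRatLinearMap χ g) := by
    have h2 : ∀ f : C.L, C.theta f = Polynomial.aeval C.theta.toRatLinearMap (Polynomial.X : ℚ[X]) f := by
      intro f
      rw [Polynomial.aeval_X, Derivation.toRatLinearMap_apply]
    have h3 : g = Polynomial.aeval C.theta.toRatLinearMap (1 : ℚ[X]) g := by simp
    conv_lhs =>
      rw [h2]
      right
      rw [h3]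
    rw [← Module.End.mul_apply, ← map_mul, ← LinearMap.sub_apply, ← map_sub, ← Module.End.mul_apply,
      ← map_mul]
    congr 2
    have h4 : Polynomial.C (-(χ.coeff 0)⁻¹) * Polynomial.C (χ.coeff 0) = -1 := by
      rw [← map_mul, neg_mul, inv_mul_cancel₀ hχ0, map_neg, map_one]
    linear_combination Polynomial.C (-(χ.coeff 0)⁻¹) * Polynomial.X_mul_divX_add χ - h4
  rw [h1]
  exact aeval_theta_mem_Fil hW _ hχg

/-- One step of the reduction procedure can be carried out.  The leading term of a solution of
`θ f₀ ≡ x h`, where `h dx` is the form, has the required shape, and the new coefficient vector exists because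
`r d/dx` is a regular vector field on the affine curve. -/
theorem exists_step (hW : C.IsIntegralBasisAtInfinity W) (hsm : C.SmoothLocus)
    (hr : IsUnit C.r.leadingCoeff) {a o m : ℤ} (ha : (a : WithTop ℤ) ≤ ordZeroMatrix W.val)
    {w : Fin C.d → (Qq p k)[T;T⁻¹]} (ho : ordInf w = o) (hm : m = -o - C.r.natDegree + 1) (hm1 : 1 ≤ m)
    (ham : -a ≤ m) (hw : C.comb W w / C.incl C.r ∈ C.RK) :
    ∃ (c : Fin C.d → Qq p k) (w' : Fin C.d → (Qq p k)[T;T⁻¹]),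
      C.comb W (fun i => LaurentPolynomial.C (c i) * LaurentPolynomial.T m) ∈ C.AK ∧
      C.comb W w / C.incl C.r = C.ddx (C.comb W
        (fun i => LaurentPolynomial.C (c i) * LaurentPolynomial.T m)) + C.comb W w' / C.incl C.r ∧
      ((o + 1 : ℤ) : WithTop ℤ) ≤ ordInf w' := by
  have h1 : C.x * (C.comb W w / C.incl C.r) ∈ C.Fil (-m) := by
    have h2 := mul_mem_Fil (zpow_x_mem_Fil (C := C) 1)
      (div_r_mem_Fil hr (hW.comb_mem_Fil_iff.mpr ho.ge))
    rw [zpow_one] at h2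
    exact Fil_antitone (by omega) h2
  obtain ⟨f₀, hf₀, hf₀m, hθ⟩ := exists_theta_sub_mem_Fil hW hm1 (mul_mem C.x_mem_RK hw) h1
  obtain ⟨c, hc⟩ := exists_leadingTerm hW hr hf₀ hf₀m
  set f := C.comb W (fun i => LaurentPolynomial.C (c i) * LaurentPolynomial.T m) with hf
  have hfAK : f ∈ C.AK := by
    refine sum_mem fun i _ => ?_
    rw [← evL, evL_C_mul_T, mul_assoc]
    exact mul_mem (C.AK.algebraMap_mem _) (C.zpow_x_mul_b_mem_AK W ha ham i)
  obtain ⟨v, hv⟩ := C.exists_comb_eq_of_mem_AXK W (C.AK_le_AXK (hsm.r_mul_ddx_mem_AK hfAK))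
  refine ⟨c, w - v, hfAK, ?_, ?_⟩
  · rw [comb_sub, hv, sub_div, mul_div_cancel_left₀ _ C.incl_r_ne_zero]
    ring
  · rw [← hW.comb_mem_Fil_iff, comb_sub, hv]
    have h3 : C.theta (f₀ - f) ∈ C.Fil (-m + 1) := by
      have := aeval_theta_mem_Fil hW Polynomial.X hc
      rwa [Polynomial.aeval_X, Derivation.toRatLinearMap_apply] at this
    have h4 := sub_mem h3 hθ
    have h5 := mul_mem_Fil (zpow_x_mem_Fil (C := C) (-1)) h4
    have h6 : C.incl C.r ∈ C.Fil (-C.r.natDegree) :=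
      incl_mem_Fil fun i hi => by exact_mod_cast Polynomial.le_natDegree_of_ne_zero hi
    have h7 := mul_mem_Fil h6 h5
    have h8 : C.incl C.r * (C.x ^ (-1 : ℤ) * (C.theta (f₀ - f) - (C.theta f₀ -
        C.x * (C.comb W w / C.incl C.r)))) = C.comb W w - C.incl C.r * C.ddx f := by
      rw [map_sub, theta_apply, theta_apply, zpow_neg_one]
      have := C.x_ne_zero
      have := C.incl_r_ne_zero
      field_simp
      ring
    rw [h8] at h7
    exact Fil_antitone (by omega) h7

omit [IsDedekindDomain C.BInf] [IsFractionRing C.BInf C.L] in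
theorem le_ordInf_iff_bound_lt {a : ℤ} (ha : ordZeroMatrix W.val = a) {n : ℕ}
    {w : Fin n → (Qq p k)[T;T⁻¹]} :
    ((a + 2 - C.r.natDegree : ℤ) : WithTop ℤ) ≤ ordInf w ↔ C.bound W < ordInf w := by
  rw [bound_eq ha]
  cases h : ordInf w with
  | top => exact iff_of_true le_top (WithTop.coe_lt_top _)
  | coe o =>
    rw [WithTop.coe_le_coe, WithTop.coe_lt_coe]
    omega

/-- The reduction procedure can be carried out to its end, because every step increases the order at
infinity. -/
theorem exists_reduces (hW : C.IsIntegralBasisAtInfinity W) (hsm : C.SmoothLocus)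
    (hr : IsUnit C.r.leadingCoeff) {a : ℤ} (ha : ordZeroMatrix W.val = a) (n : ℕ)
    (w : Fin C.d → (Qq p k)[T;T⁻¹]) (hw : C.comb W w / C.incl C.r ∈ C.RK)
    (hn : ((a + 2 - C.r.natDegree - n : ℤ) : WithTop ℤ) ≤ ordInf w) : ∃ u, C.Reduces W w u := by
  induction n generalizing w with
  | zero => exact ⟨w, .done w ((le_ordInf_iff_bound_lt ha).mp (by simpa using hn))⟩
  | succ n ih =>
    by_cases hdone : C.bound W < ordInf w
    · exact ⟨w, .done w hdone⟩
    have hle := not_lt.mp hdone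
    obtain ⟨o, ho, hoa⟩ := exists_ordInf_eq (hle.trans_eq (bound_eq ha))
    have hm1 := one_le_poleOrder hW hsm hr ha ho hoa hw
    rw [← poleOrder_eq ho] at hm1
    obtain ⟨c, w', hf, heq, hlt⟩ := exists_step hW hsm hr ha.ge ho (poleOrder_eq ho) hm1
      (by rw [poleOrder_eq ho]; omega) hw
    have hf' := C.AK_le_RK hf
    obtain ⟨u, hu⟩ := ih w' (by
      rw [← sub_eq_iff_eq_add'.mpr heq]
      exact sub_mem hw (C.ddx_mem_RK hf')) (by
        refine le_trans ?_ hlt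
        rw [ho, WithTop.coe_le_coe] at hn
        rw [WithTop.coe_le_coe]
        push_cast at hn
        omega)
    refine ⟨u, .step w w' u c hle hf' ((C.form_eq_D_add_form_iff W w w' _).mpr heq) ?_ hu⟩
    rw [ho]
    refine lt_of_lt_of_le ?_ hlt
    rw [WithTop.coe_lt_coe]
    omega

/-- The result of the reduction procedure differs from the initial form by the differential of a
combination of the `b_i` in which only the powers of `x` with exponents from `max 1 (-a)` to the
initial pole order occur. -/
theorem Reduces.exists_ddx_add (hW : C.IsIntegralBasisAtInfinity W) (hsm : C.SmoothLocus)
    (hr : IsUnit C.r.leadingCoeff) {a : ℤ} (ha : ordZeroMatrix W.val = a)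
    {w u : Fin C.d → (Qq p k)[T;T⁻¹]} (h : C.Reduces W w u) (hw : C.comb W w / C.incl C.r ∈ C.RK)
    (o : ℤ) (ho : (o : WithTop ℤ) ≤ ordInf w) :
    C.bound W < ordInf u ∧ ∃ v : Fin C.d → (Qq p k)[T;T⁻¹],
      C.comb W w / C.incl C.r = C.ddx (C.comb W v) + C.comb W u / C.incl C.r ∧
      ∀ i n, (v i).coeff n ≠ 0 → 1 ≤ n ∧ -a ≤ n ∧ n ≤ -o - C.r.natDegree + 1 := by
  induction h with
  | done u hu => exact ⟨hu, 0, by simp [comb_zero], by simp⟩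
  | step w w' u c hle hreg heq hlt _ ih =>
    rw [form_eq_D_add_form_iff] at heq
    obtain ⟨hu, v, hv, hvn⟩ := ih (by
      rw [← sub_eq_iff_eq_add'.mpr heq]
      exact sub_mem hw (C.ddx_mem_RK hreg)) (ho.trans hlt.le)
    obtain ⟨o', ho', hoa⟩ := exists_ordInf_eq (hle.trans_eq (bound_eq ha))
    have hm1 := one_le_poleOrder hW hsm hr ha ho' hoa hw
    refine ⟨hu, (fun i => LaurentPolynomial.C (c i) * LaurentPolynomial.T (C.poleOrder w)) + v, ?_,
      fun i n hn => ?_⟩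
    · rw [comb_add, map_add, heq, hv, add_assoc]
    · rw [ho', WithTop.coe_le_coe] at ho
      by_cases hvi : (v i).coeff n = 0
      · rw [Pi.add_apply, AddMonoidAlgebra.coeff_add, Finsupp.add_apply, hvi, add_zero,
          ← LaurentPolynomial.single_eq_C_mul_T, AddMonoidAlgebra.coeff_single,
          Finsupp.single_apply] at hn
        have hnm : C.poleOrder w = n := by
          by_contra hcon
          exact hn (if_neg hcon)
        rw [poleOrder_eq ho'] at hnm
        omega
      · exact hvn i n hvi

end CurveLift

/-! ### Loss of precision -/

namespace CurveLift

variable {p : ℕ} [Fact p.Prime] {k : Type u} [Field k] [Finite k] [CharP k p] {C : CurveLift p k}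
  {W : GL (Fin C.d) (Zq p k)[T;T⁻¹]} [IsDedekindDomain C.BInf] [IsFractionRing C.BInf C.L]

omit [IsDedekindDomain C.BInf] [IsFractionRing C.BInf C.L] in
theorem comb_smul (c : Qq p k) (w : Fin C.d → (Qq p k)[T;T⁻¹]) :
    C.comb W (fun i => c • w i) = algebraMap (Qq p k) C.L c * C.comb W w := by
  simp only [LaurentPolynomial.smul_eq_C_mul]
  rw [comb_mul, LaurentPolynomial.eval₂_C]

theorem isIntegralVec_of_comb_mem_AXD (hW : C.IsIntegralBasisAtInfinity W)
    (hr : IsUnit C.r.leadingCoeff) {w : Fin C.d → (Qq p k)[T;T⁻¹]} (hw : C.comb W w ∈ C.AXD) :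
    IsIntegralVec w := fun i n =>
  hW.coeff_mem_range (AXD_le_integralAtInfinity hr hw (-n + 1)) i n (by omega)

omit [IsDedekindDomain C.BInf] [IsFractionRing C.BInf C.L] in
theorem ddx_mem_AXD {f : C.L} (hf : f ∈ C.AX) : C.ddx f ∈ C.AXD := by
  have := C.dividedPow_mem_AXD hf 1
  simpa [Derivation.dividedPow] using this

/-- The loss of precision in the reduction procedure: `p ^ N` times the primitive is integral at infinity
in all the orders which occur in it, hence integral. -/
theorem isIntegralVec_of_reduces (hW : C.IsIntegralBasisAtInfinity W) (hsm : C.SmoothLocus)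
    (hr : IsUnit C.r.leadingCoeff) {a : ℤ} (ha : ordZeroMatrix W.val = a)
    {w u : Fin C.d → (Qq p k)[T;T⁻¹]} (h : C.Reduces W w u) (hwi : IsIntegralVec w)
    (hw : C.comb W w / C.incl C.r ∈ C.RK) {o : ℤ} (ho : ordInf w = o)
    (hoa : o ≤ a + (1 - C.r.natDegree)) (N : ℕ)
    (hN : ∀ e ∈ C.ramificationIndicesAtInfinity, C.poleOrder w * e < p ^ (N + 1)) :
    IsIntegralVec fun i => (p : Qq p k) ^ N • u i := by
  have hm1 := one_le_poleOrder hW hsm hr ha ho hoa hw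
  have ha0 := hW.ordZero_nonpos ha.ge
  rw [poleOrder_eq ho] at hN
  obtain ⟨hu, v, hv, hvn⟩ := h.exists_ddx_add hW hsm hr ha hw o ho.ge
  set m := -o - C.r.natDegree + 1 with hm
  have hwAX : C.comb W w / C.incl C.r ∈ C.AXD := by
    rw [div_eq_mul_inv]
    exact mul_mem (C.AX_le_AXD (C.comb_mem_AX W hwi)) C.inv_r_mem_AXD
  have huFil : C.comb W u / C.incl C.r ∈ C.Fil (a + 2) := by
    have h1 := div_r_mem_Fil hr (hW.comb_mem_Fil_iff.mpr ((le_ordInf_iff_bound_lt ha).mpr hu))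
    rwa [sub_add_cancel] at h1
  have hp : ∀ f : C.L, (p : C.L) ^ N * f = algebraMap (Qq p k) C.L ((p : Qq p k) ^ N) * f := by simp
  have hvFil : C.comb W v ∈ C.Fil (-m) := by
    rw [hW.comb_mem_Fil_iff, le_ordInf_iff]
    intro i n hn
    have := hvn i n hn
    omega
  -- all exponents occurring in `v` are at least `max 1 (-a)`, that is, their orders are less than
  -- `J = min (a + 1) 0`
  have hdv : C.ddx (C.comb W v) ∈ C.intFil (min (a + 1) 0 + 1) := by
    rw [← sub_eq_iff_eq_add.mpr hv]
    exact sub_mem (AXD_le_integralAtInfinity hr hwAX _)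
      (mem_intFil_of_mem_Fil (Fil_antitone (by omega) huFil))
  have hpv := pow_mul_mem_intFil hW hr (m := m) (J := min (a + 1) 0) (by omega) (by omega) hvFil hdv N hN
  rw [hp, ← comb_smul] at hpv
  have hvi : IsIntegralVec fun i => (p : Qq p k) ^ N • v i := by
    intro i n
    by_cases hn : (v i).coeff n = 0
    · refine ⟨0, ?_⟩
      simp [hn]
    · have := hvn i n hn
      exact hW.coeff_mem_range hpv i n (by omega)
  have hvAX := C.comb_mem_AX W hvi
  refine isIntegralVec_of_comb_mem_AXD hW hr ?_
  rw [comb_smul, ← hp]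
  have h1 : (p : C.L) ^ N * C.comb W u = C.incl C.r * ((p : C.L) ^ N * (C.comb W w / C.incl C.r) -
      C.ddx ((p : C.L) ^ N * C.comb W v)) := by
    have h2 : C.ddx ((p : C.L) ^ N * C.comb W v) = (p : C.L) ^ N * C.ddx (C.comb W v) := by
      rw [hp, hp, ← Algebra.smul_def, Derivation.map_smul, Algebra.smul_def]
    rw [h2, hv]
    have := C.incl_r_ne_zero
    field_simp
    ring
  rw [h1, hp (C.comb W v), ← comb_smul]
  exact mul_mem (C.AX_le_AXD (C.incl_mem_AX _)) (sub_mem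
    (mul_mem (pow_mem (natCast_mem _ p) N) hwAX) (ddx_mem_AXD hvAX))

end CurveLift

theorem mainTheorem8 (p : ℕ) [Fact p.Prime] (k : Type u) [Field k] [Finite k] [CharP k p]
    (C : CurveLift p k) (hgood : C.GoodLift) (hsmooth : C.SmoothLocus)
    (W : GL (Fin C.d) (Zq p k)[T;T⁻¹]) (hW : C.IsIntegralBasisAtInfinity W)
    (w : Fin C.d → (Qq p k)[T;T⁻¹]) (hw : CurveLift.IsIntegralVec w)
    (hω : C.form W w ∈ C.OmegaU)
    (hord : CurveLift.ordInf w ≤ C.bound W)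
    (m : ℤ) (hm : m = C.poleOrder w)
    (eInf : ℕ) (heInf : IsGreatest C.ramificationIndicesAtInfinity eInf) :
    (∃ u, C.Reduces W w u) ∧
    ∀ u, C.Reduces W w u →
      CurveLift.IsIntegralVec
        (fun i => ((p : Qq p k) ^ ⌊Real.logb p ((m : ℝ) * (eInf : ℝ))⌋) • u i) := by
  have := hW.isDedekindDomain
  have := hW.isFractionRing
  have hr := hgood.isUnit_leadingCoeff
  have hRK := C.div_mem_RK_of_form_mem W hω
  obtain ⟨a, ha⟩ := hW.exists_ordZeroMatrix_eq
  obtain ⟨o, ho, hoa⟩ := CurveLift.exists_ordInf_eq (hord.trans_eq (CurveLift.bound_eq ha))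
  have hm1 : 1 ≤ m := by
    rw [hm, CurveLift.poleOrder_eq ho]
    exact CurveLift.one_le_poleOrder hW hsmooth hr ha ho hoa hRK
  refine ⟨CurveLift.exists_reduces hW hsmooth hr ha (a + 2 - C.r.natDegree - o).toNat w hRK ?_,
    fun u hu => ?_⟩
  · rw [ho, WithTop.coe_le_coe]
    omega
  · obtain ⟨n, rfl⟩ := Int.eq_ofNat_of_zero_le (show 0 ≤ m by omega)
    have hfloor : ⌊Real.logb p ((((n : ℕ) : ℤ) : ℝ) * (eInf : ℝ))⌋ = (Nat.log p (n * eInf) : ℤ) := by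
      rw [← Int.log_natCast (R := ℝ), ← Real.floor_logb_natCast (by positivity)]
      push_cast
      rfl
    rw [hfloor]
    simp only [zpow_natCast]
    refine CurveLift.isIntegralVec_of_reduces hW hsmooth hr ha hu hw hRK ho hoa _ fun e he => ?_
    rw [← hm]
    have h1 : n * e ≤ n * eInf := Nat.mul_le_mul_left n (heInf.2 he)
    have h2 := Nat.lt_pow_succ_log_self (Fact.out : p.Prime).one_lt (n * eInf)
    exact_mod_cast h1.trans_lt h2
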